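/- **Theorem 5.3.** Let $N\ge 1$ and $x\in\mathbb R^N$ with $x_1>\dots>x_{N-1}>x_N=0$. Put $$H(y)_i=\sum_{j\ne i}\Bigl(\frac1{y_i-y_j}+\frac1{y_i+y_j}\Bigr)\qquad(i=1,\dots,N),$$ let $C_N^D=\{y:\ y_1\ge\dots\ge y_{N-1}\ge|y_N|\}$, and let $\phi$ be the solution of $\dot\phi(t)=H(\phi(t))$, $\phi(0)=x$, in the interior of $C_N^D$ for all $t\ge0$. Let $B$ be an $N$-dimensional Brownian motion with respect to a filtration $(\mathcal F_t)_{t\ge0}$, and for $k\ge\frac12$ let $X^D_{\cdot,k}$ be the Bessel process of type $D_N$ with multiplicity $k$, driven by $B$ and started at $\sqrt k\,x$, i.e. the adapted continuous solution in $C_N^D$ of $$dX^D_{t,k}=dB_t+k\,H(X^D_{t,k})\,dt,\qquad X^D_{0,k}=\sqrt k\,x,\qquad E\int_0^t\|H(X^D_{s,k})\|\,ds<\infty\ \ (t\ge0)$$ (which is at a wall of $C_N^D$ only at a null set of times). Let $X_{t,k}=(X^{D,1}_{t,k},\dots,X^{D,N-1}_{t,k},|X^{D,N}_{t,k}|)$.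 Let $W$ be the continuous solution of the linear SDE $$dW^i_t=dB^i_t+\sum_{j\ne i}\Bigl(\frac{W^j_t-W^i_t}{(\phi_i(t)-\phi_j(t))^2}-\frac{W^j_t+W^i_t}{(\phi_i(t)+\phi_j(t))^2}\Bigr)dt\quad(i=1,\dots,N),\qquad W_0=0,$$ and $\tilde W=(W^1,\dots,W^{N-1},|W^N|)$. Then: 1. For every $k\ge\frac12$, $X_{\cdot,k}$ is a Bessel process of type $B_N$ with multiplicities $(k_1,k_2)=(0,k)$ started at $\sqrt k\,x$. That is, it is a continuous adapted process in $\{y_1\ge\dots\ge y_N\ge0\}$ which has two equal coordinates only at a null set of times, and it solves the martingale problem for $Lf=\frac12\Delta f+k\sum_iH(y)_i\,\partial_if$ on the compactly supported $f\in C^2(\mathbb R^N)$ that are invariant under all permutations and sign changes of the coordinates. 2. For every $t\ge0$, $$\sup_{0\le s\le t,\ k\ge1/2}\sqrt k\,\bigl\|X_{s,k}-\sqrt k\,\phi(s)-\tilde W_s\bigr\|<\infty\quad\text{a.s.},$$ i.e. $\sqrt k\,(X_{t,k}/\sqrt k-\phi(t))\to\tilde W_t$ for $k\to\infty$, a.s.,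 locally uniformly in $t$, with rate $O(1/\sqrt k)$. Here the supremum at a sample point is over those $k$ for which the integrated equation for $X^D_{\cdot,k}$ holds at this sample point (for each fixed $k$, this is almost every sample point). 3. $W$ is a Gaussian process. For every $t>0$, $|W^N_t|$ has a non-degenerate half-normal distribution (the law of $|Z|$ with $Z\sim\mathcal N(0,v)$ for some $v>0$), and the law of $\tilde W_t$ is not Gaussian. -/

import Mathlib

open MeasureTheory ProbabilityTheory Set
open scoped NNReal ENNReal Laplacian

noncomputable section

namespace BesselLimit

/-- The space `ℝ^N`, `N = n + 1 ≥ 1`, with the Euclidean norm. The last coordinate `x_N` is the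
coordinate with index `Fin.last n`. -/
abbrev Vec (n : ℕ) : Type := EuclideanSpace ℝ (Fin (n + 1))

/-- The closed Weyl chamber `x_1 ≥ … ≥ x_{N-1} ≥ |x_N|` of type `D_N`. -/
def chamberD (n : ℕ) : Set (Vec n) := {y | ∀ i j, i < j → |y j| ≤ y i}

/-- The interior `x_1 > … > x_{N-1} > |x_N|` of the Weyl chamber of type `D_N`. -/
def openChamberD (n : ℕ) : Set (Vec n) := {y | ∀ i j, i < j → |y j| < y i}

/-- The closed Weyl chamber `x_1 ≥ … ≥ x_N ≥ 0` of type `B_N`. -/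
def chamberB (n : ℕ) : Set (Vec n) := {y | (∀ i j, i < j → y j ≤ y i) ∧ ∀ i, 0 ≤ y i}

/-- The vector field `H(y)_i = ∑_{j ≠ i} (1 / (y_i - y_j) + 1 / (y_i + y_j))` of type `D_N`. -/
def driftD {n : ℕ} (y : Vec n) : Vec n :=
  WithLp.toLp 2 fun i => ∑ j ∈ Finset.univ.erase i, (1 / (y i - y j) + 1 / (y i + y j))

/-- `φ` is, on `[0, ∞)`, the solution of the ODE `φ' = H(φ)`, `φ(0) = x`, in the interior of the
Weyl chamber of type `D_N`. -/
structure IsFlowD {n : ℕ} (x : Vec n) (φ : ℝ → Vec n) : Prop where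
  init : φ 0 = x
  mem : ∀ t, 0 ≤ t → φ t ∈ openChamberD n
  deriv : ∀ t, 0 ≤ t → HasDerivWithinAt φ (driftD (φ t)) (Ici 0) t

/-- The matrix `A` (the Jacobian of `H`) at the point `y`: the matrix `A(t, x)` of the linear SDE
is `linMatrix (φ t)`. -/
def linMatrix {n : ℕ} (y : Vec n) : Matrix (Fin (n + 1)) (Fin (n + 1)) ℝ :=
  Matrix.of fun i j =>
    if i = j then ∑ l ∈ Finset.univ.erase i, (-1 / (y i - y l) ^ 2 - 1 / (y i + y l) ^ 2)
    else 1 / (y i - y j) ^ 2 - 1 / (y i + y j) ^ 2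

variable {Ω : Type*} {mΩ : MeasurableSpace Ω}

/-- `B` is an `N`-dimensional standard Brownian motion with respect to the filtration `𝓕`. -/
structure IsBrownianVec {n : ℕ} (B : ℝ≥0 → Ω → Vec n) (𝓕 : Filtration ℝ≥0 mΩ) (P : Measure Ω) :
    Prop where
  adapted : ∀ t, Measurable[𝓕 t] (B t)
  coord : ∀ i, IsBrownianReal (fun t ω => B t ω i) P
  indep_coord : iIndepFun (fun i ω (t : ℝ≥0) => B t ω i) P
  indep_incr : ∀ s t, s ≤ t →
    Indep (MeasurableSpace.comap (fun ω => B t ω - B s ω) inferInstance) (𝓕 s) P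

/-- The path `p` solves `p(t) = y₀ + b(t) + k ∫_0^t H(p(s)) ds` for the driving path `b`, in the
closed Weyl chamber of type `D_N`, with absolutely convergent drift integral. As the drift is
infinite at the walls, the path can only be there at a null set of times. -/
structure IsBesselDPath {n : ℕ} (k : ℝ) (y₀ : Vec n) (b p : ℝ≥0 → Vec n) : Prop where
  cont : Continuous p
  mem : ∀ t, p t ∈ chamberD n
  ae_mem : ∀ᵐ s ∂(volume.restrict (Ici (0 : ℝ))), p s.toNNReal ∈ openChamberD n
  integrable : ∀ t : ℝ≥0, IntervalIntegrable (fun s : ℝ => driftD (p s.toNNReal)) volume 0 t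
  eq : ∀ t : ℝ≥0, p t = y₀ + b t + k • ∫ s in (0 : ℝ)..t, driftD (p s.toNNReal)

/-- `X` is the Bessel process of type `D_N` with multiplicity `k` and start in `y₀`, driven by the
Brownian motion `B`: the adapted solution of `dX = dB + k H(X) dt` for which the expectation of
`∫_0^t ‖H(X_s)‖ ds` is finite for all `t`. -/
structure IsBesselD {n : ℕ} (k : ℝ) (y₀ : Vec n) (B : ℝ≥0 → Ω → Vec n)
    (𝓕 : Filtration ℝ≥0 mΩ) (P : Measure Ω) (X : ℝ≥0 → Ω → Vec n) : Prop where
  adapted : ∀ t, Measurable[𝓕 t] (X t)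
  path : ∀ᵐ ω ∂P, IsBesselDPath k y₀ (fun t => B t ω) (fun t => X t ω)
  drift_lt_top : ∀ t : ℝ≥0,
    ∫⁻ ω, ∫⁻ s in Icc (0 : ℝ) t, ‖driftD (X s.toNNReal ω)‖ₑ ∂volume ∂P < ∞

/-- Invariance under the Weyl group of type `B_N`: permutations and sign changes of the
coordinates. -/
def IsInvariantB {n : ℕ} (f : Vec n → ℝ) : Prop :=
  ∀ (σ : Equiv.Perm (Fin (n + 1))) (ε : Fin (n + 1) → ℤˣ) (y : Vec n),
    f (WithLp.toLp 2 fun i => ((ε i : ℤ) : ℝ) * y (σ i)) = f y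

/-- The generator of the Bessel processes of type `B_N` with multiplicities `(k₁, k₂)`. -/
def genB {n : ℕ} (k₁ k₂ : ℝ) (f : Vec n → ℝ) (y : Vec n) : ℝ :=
  1 / 2 * Laplacian.laplacian f y
    + k₂ * ∑ i, (∑ j ∈ Finset.univ.erase i, (1 / (y i - y j) + 1 / (y i + y j)))
        * fderiv ℝ f y (EuclideanSpace.single i 1)
    + k₁ * ∑ i, 1 / y i * fderiv ℝ f y (EuclideanSpace.single i 1)

/-- The process `f(Y_t) - ∫_0^t (L f)(Y_s) ds` of the martingale problem. -/
def martB {n : ℕ} (k₁ k₂ : ℝ) (f : Vec n → ℝ) (Y : ℝ≥0 → Ω → Vec n) (t : ℝ≥0) (ω : Ω) : ℝ :=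
  f (Y t ω) - ∫ s in (0 : ℝ)..t, genB k₁ k₂ f (Y s.toNNReal ω)

/-- `Y` is a Bessel process of type `B_N` with multiplicities `(k₁, k₂)` and start in `y₀`: a
continuous process in the closed Weyl chamber of type `B_N` that solves the martingale problem of
the generator `genB k₁ k₂` on the compactly supported `C²` functions on `ℝ^N` that are invariant
under the Weyl group (this domain encodes the reflection at the walls). The process is at the
points where the formula for the generator is singular only at a null set of times. -/
structure IsBesselB {n : ℕ} (k₁ k₂ : ℝ) (y₀ : Vec n) (𝓕 : Filtration ℝ≥0 mΩ) (P : Measure Ω)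
    (Y : ℝ≥0 → Ω → Vec n) : Prop where
  adapted : ∀ t, Measurable[𝓕 t] (Y t)
  init : ∀ᵐ ω ∂P, Y 0 ω = y₀
  path : ∀ᵐ ω ∂P, Continuous (fun t => Y t ω) ∧ ∀ t, Y t ω ∈ chamberB n
  ae_regular : ∀ᵐ ω ∂P, ∀ᵐ s ∂(volume.restrict (Ici (0 : ℝ))),
    (∀ i j, i ≠ j → Y s.toNNReal ω i ≠ Y s.toNNReal ω j) ∧
      (k₁ ≠ 0 → ∀ i, Y s.toNNReal ω i ≠ 0)
  martingale : ∀ f : Vec n → ℝ, ContDiff ℝ 2 f → HasCompactSupport f → IsInvariantB f →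
    (∀ t, Integrable (martB k₁ k₂ f Y t) P) ∧
      ∀ s t, s ≤ t → P[martB k₁ k₂ f Y t | 𝓕 s] =ᵐ[P] martB k₁ k₂ f Y s

/-- `W` is the (pathwise unique) solution of the linear SDE `dW = dB + A(t, x) W dt`, `W_0 = 0`,
with `A(t, x) = linMatrix (φ t)`. -/
def IsLimitW {n : ℕ} (φ : ℝ → Vec n) (B : ℝ≥0 → Ω → Vec n) (P : Measure Ω)
    (W : ℝ≥0 → Ω → Vec n) : Prop :=
  ∀ᵐ ω ∂P, Continuous (fun t => W t ω) ∧ ∀ t : ℝ≥0,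
    W t ω = B t ω
      + ∫ s in (0 : ℝ)..t, Matrix.toEuclideanLin (linMatrix (φ s)) (W s.toNNReal ω)

/-- The map `(y_1, …, y_N) ↦ (y_1, …, y_{N-1}, |y_N|)`. -/
def foldLast {n : ℕ} (y : Vec n) : Vec n :=
  WithLp.toLp 2 fun i => if i = Fin.last n then |y i| else y i

/-- The half-normal (one-sided normal) distribution: the law of `|Z|` for `Z ∼ N(0, v)`. -/
def halfNormal (v : ℝ≥0) : Measure ℝ := (gaussianReal 0 v).map fun z => |z|

end BesselLimit

end

noncomputable section

namespace BesselLimit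

open Filter Topology

variable {Ω : Type*} {mΩ : MeasurableSpace Ω}

/-! ### The drift, its dissipativity and Taylor expansion, folding, and the deterministic flow. -/

section

/-! Convergence. The drift H is homogeneous of degree -1, so q = p/√k solves q = x + b/√k + ∫ H(q):
the multiplicity enters only through the size of the noise. Since 1/t decreases on each half-line, H
is dissipative on the open chamber (`inner_driftD_sub_le`). Hence, for two paths with the same
noise, H cannot drive them apart, and their distance is controlled by the distance of the starting
points and the defect with which the second path solves the equation (`IsBesselDPath.norm_sub_le`).
This needs neither a Gronwall factor nor any distance of q from the walls. The path φ + w/√k has the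
noise of q, and by Taylor's formula its defect is O(1/k) once k is so large that it stays well
inside the chamber. The remaining bounded range of k is handled by comparison with a path far inside
the chamber. Folding the last coordinate does not increase the error, because φ_N = 0. The constants
depend only on φ and on the paths of B and W, so one null set serves all k (`bddAbove_of_path`).

Type B. Folding is, at each point, either the identity or the reflection of the last coordinate. An
invariant f is unchanged by this reflection, its Laplacian is invariant and H is equivariant, so f
and Lf take the same values along the folded process as the corresponding expressions along the type
D process. No local time appears, and the martingale problem reduces to Dynkin's formula for dX = dB
+ a dt (`HasDrift.setIntegral_eq_zero`). This is derived from Taylor expansions on grids, the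
Brownian and the drift part of each increment being treated separately.

The limit. W solves a linear equation, so it is a pathwise limit of Euler schemes, whose values are
finite linear combinations of values of B. Limits of centred Gaussian variables are centred
Gaussian. As φ_N = 0, the last row of the matrix is diagonal, and W^N solves a scalar equation whose
Euler variances are bounded away from 0 (`le_eulerVar`). Finally |W^N| is nonnegative and not
constant, so it cannot be Gaussian. -/

lemma norm_le_sum_abs {n : ℕ} (y : Vec n) : ‖y‖ ≤ ∑ i, |y i| := by
  have h : y = ∑ i, EuclideanSpace.single i (y i) := by
    ext j
    simp [Finset.sum_apply]
  calc ‖y‖ = ‖∑ i, EuclideanSpace.single i (y i)‖ := by rw [← h]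
    _ ≤ ∑ i, ‖EuclideanSpace.single i (y i)‖ := norm_sum_le _ _
    _ = ∑ i, |y i| := by simp

lemma abs_apply_le_norm {n : ℕ} (y : Vec n) (i : Fin (n + 1)) : |y i| ≤ ‖y‖ :=
  PiLp.norm_apply_le y i

@[simp]
lemma driftD_apply {n : ℕ} (y : Vec n) (i : Fin (n + 1)) :
    driftD y i = ∑ j ∈ Finset.univ.erase i, (1 / (y i - y j) + 1 / (y i + y j)) := rfl

lemma driftD_smul {n : ℕ} (c : ℝ) (y : Vec n) : driftD (c • y) = c⁻¹ • driftD y := by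
  ext i
  simp only [driftD_apply, PiLp.smul_apply, smul_eq_mul, Finset.mul_sum]
  refine Finset.sum_congr rfl fun j _ => ?_
  rw [← mul_sub, ← mul_add]
  simp only [one_div, mul_inv]
  ring

lemma smul_mem_openChamberD {n : ℕ} {c : ℝ} (hc : 0 < c) {y : Vec n} (hy : y ∈ openChamberD n) :
    c • y ∈ openChamberD n := by
  intro i j hij
  have := hy i j hij
  simp only [PiLp.smul_apply, smul_eq_mul, abs_mul, abs_of_pos hc]
  gcongr

lemma openChamberD_sub_add {n : ℕ} {y : Vec n} (hy : y ∈ openChamberD n) {i j : Fin (n + 1)}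
    (hij : i < j) : 0 < y i - y j ∧ 0 < y i + y j := by
  have := abs_lt.1 (hy i j hij)
  constructor <;> linarith

lemma sum_erase_comm {ι : Type*} [Fintype ι] [DecidableEq ι] (F : ι → ι → ℝ) :
    ∑ i, ∑ j ∈ Finset.univ.erase i, F i j = ∑ i, ∑ j ∈ Finset.univ.erase i, F j i := by
  refine Finset.sum_comm' fun i j => ?_
  simp [eq_comm]

/-- The function 1/t is decreasing on each of the two half-lines; the hypothesis puts a and b in the
same one. -/
lemma inv_sub_inv_mul_sub_nonpos {a b : ℝ} (h : 0 < a * b) : (1 / a - 1 / b) * (a - b) ≤ 0 := by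
  have ha : a ≠ 0 := fun h0 => by simp [h0] at h
  have hb : b ≠ 0 := fun h0 => by simp [h0] at h
  have : (1 / a - 1 / b) * (a - b) = -((a - b) ^ 2 / (a * b)) := by field_simp; ring
  rw [this]
  have := div_nonneg (sq_nonneg (a - b)) h.le
  linarith

/-- The drift is a monotone (dissipative) vector field on the open chamber. -/
lemma inner_driftD_sub_le {n : ℕ} {y z : Vec n} (hy : y ∈ openChamberD n)
    (hz : z ∈ openChamberD n) : inner ℝ (y - z) (driftD y - driftD z) ≤ 0 := by
  set F : Fin (n + 1) → Fin (n + 1) → ℝ := fun i j =>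
    ((1 / (y i - y j) + 1 / (y i + y j)) - (1 / (z i - z j) + 1 / (z i + z j))) * (y i - z i)
    with hF
  have h1 : inner ℝ (y - z) (driftD y - driftD z)
      = ∑ i, ∑ j ∈ Finset.univ.erase i, F i j := by
    rw [PiLp.inner_apply]
    refine Finset.sum_congr rfl fun i _ => ?_
    simp only [PiLp.sub_apply, driftD_apply, ← Finset.sum_sub_distrib, hF,
      ← Finset.sum_mul]
    simp
  -- Symmetrising over (i, j) lets each pair contribute one monotonicity term for the difference and
  -- one for the sum of the coordinates.
  have h2 : 2 * ∑ i, ∑ j ∈ Finset.univ.erase i, F i j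
      = ∑ i, ∑ j ∈ Finset.univ.erase i, (F i j + F j i) := by
    rw [two_mul]
    nth_rw 2 [sum_erase_comm]
    simp only [← Finset.sum_add_distrib]
  have h3 : ∑ i, ∑ j ∈ Finset.univ.erase i, (F i j + F j i) ≤ 0 := by
    refine Finset.sum_nonpos fun i _ => Finset.sum_nonpos fun j hj => ?_
    have hji : j ≠ i := Finset.ne_of_mem_erase hj
    have e : F i j + F j i
        = (1 / (y i - y j) - 1 / (z i - z j)) * ((y i - y j) - (z i - z j))
          + (1 / (y i + y j) - 1 / (z i + z j)) * ((y i + y j) - (z i + z j)) := by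
      simp only [hF]
      rw [show y j - y i = -(y i - y j) by ring, show z j - z i = -(z i - z j) by ring,
        add_comm (y j), add_comm (z j), one_div_neg_eq_neg_one_div, one_div_neg_eq_neg_one_div]
      ring
    rw [e]
    refine add_nonpos (inv_sub_inv_mul_sub_nonpos ?_) (inv_sub_inv_mul_sub_nonpos ?_)
    · rcases lt_or_gt_of_ne hji with h | h
      · have a := (openChamberD_sub_add hy h).1
        have b := (openChamberD_sub_add hz h).1
        exact mul_pos_of_neg_of_neg (by linarith) (by linarith)
      · exact mul_pos (openChamberD_sub_add hy h).1 (openChamberD_sub_add hz h).1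
    · rcases lt_or_gt_of_ne hji with h | h
      · have a := (openChamberD_sub_add hy h).2
        have b := (openChamberD_sub_add hz h).2
        exact mul_pos (by linarith) (by linarith)
      · exact mul_pos (openChamberD_sub_add hy h).2 (openChamberD_sub_add hz h).2
  linarith

/-- The points of the chamber with distance of order at least `ε` from the walls. -/
def innerChamber (n : ℕ) (ε : ℝ) : Set (Vec n) := {y | ∀ i j, i < j → |y j| + ε ≤ y i}

lemma innerChamber_subset {n : ℕ} {ε : ℝ} (hε : 0 < ε) : innerChamber n ε ⊆ openChamberD n :=
  fun _ hy i j hij => by linarith [hy i j hij]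

lemma add_mem_innerChamber {n : ℕ} {ε : ℝ} {y h : Vec n} (hy : y ∈ innerChamber n ε)
    (hh : 4 * ‖h‖ ≤ ε) : y + h ∈ innerChamber n (ε / 2) := by
  intro i j hij
  have h1 := hy i j hij
  have h2 := abs_apply_le_norm h i
  have h3 := abs_apply_le_norm h j
  have h4 := abs_add_le (y j) (h j)
  have h5 := neg_abs_le (h i)
  simp only [PiLp.add_apply]
  linarith

lemma innerChamber_le_abs {n : ℕ} {ε : ℝ} {y : Vec n} (hy : y ∈ innerChamber n ε)
    {i j : Fin (n + 1)} (hij : j ≠ i) : ε ≤ |y i - y j| ∧ ε ≤ |y i + y j| := by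
  rcases lt_or_gt_of_ne hij with h | h
  · have h1 := hy _ _ h
    have h2 := le_abs_self (y i)
    have h3 := neg_abs_le (y i)
    exact ⟨by rw [abs_sub_comm]; exact le_trans (by linarith) (le_abs_self _),
      le_trans (by linarith) (le_abs_self _)⟩
  · have h1 := hy _ _ h
    have h2 := le_abs_self (y j)
    have h3 := neg_abs_le (y j)
    exact ⟨le_trans (by linarith) (le_abs_self _), le_trans (by linarith) (le_abs_self _)⟩

lemma card_erase_le_succ {n : ℕ} (i : Fin (n + 1)) :
    ((Finset.univ.erase i).card : ℝ) ≤ n + 1 := by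
  have : (Finset.univ.erase i).card ≤ (Finset.univ : Finset (Fin (n + 1))).card :=
    Finset.card_le_card (Finset.erase_subset _ _)
  simp only [Finset.card_univ, Fintype.card_fin] at this
  exact_mod_cast this

lemma norm_driftD_le {n : ℕ} {ε : ℝ} (hε : 0 < ε) {y : Vec n} (hy : y ∈ innerChamber n ε) :
    ‖driftD y‖ ≤ (n + 1) * ((n + 1) * (2 / ε)) := by
  have key : ∀ a : ℝ, ε ≤ |a| → |1 / a| ≤ 1 / ε := fun a ha => by
    rw [abs_div, abs_one]
    exact one_div_le_one_div_of_le hε ha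
  refine (norm_le_sum_abs _).trans ?_
  have h1 : ∀ i ∈ (Finset.univ : Finset (Fin (n + 1))), |driftD y i| ≤ (n + 1) * (2 / ε) := by
    intro i _
    rw [driftD_apply]
    refine (Finset.abs_sum_le_sum_abs _ _).trans ?_
    have h2 : ∀ j ∈ Finset.univ.erase i, |1 / (y i - y j) + 1 / (y i + y j)| ≤ 2 / ε := by
      intro j hj
      obtain ⟨ha, hb⟩ := innerChamber_le_abs hy (Finset.ne_of_mem_erase hj)
      refine (abs_add_le _ _).trans ?_
      have := key _ ha
      have := key _ hb
      have e : 2 / ε = 1 / ε + 1 / ε := by ring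
      linarith
    refine (Finset.sum_le_card_nsmul _ _ _ h2).trans ?_
    rw [nsmul_eq_mul]
    exact mul_le_mul_of_nonneg_right (card_erase_le_succ i) (by positivity)
  refine (Finset.sum_le_card_nsmul _ _ _ h1).trans ?_
  simp

lemma linMatrix_mul_apply {n : ℕ} (y h : Vec n) (i : Fin (n + 1)) :
    Matrix.toEuclideanLin (linMatrix y) h i = ∑ j ∈ Finset.univ.erase i,
      (-(h i - h j) / (y i - y j) ^ 2 + -(h i + h j) / (y i + y j) ^ 2) := by
  have h0 : Matrix.toEuclideanLin (linMatrix y) h i = ∑ j, linMatrix y i j * h j := by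
    simp [Matrix.toLpLin_apply, Matrix.mulVec, dotProduct]
  rw [h0, ← Finset.add_sum_erase _ _ (Finset.mem_univ i)]
  have h1 : linMatrix y i i
      = ∑ l ∈ Finset.univ.erase i, (-1 / (y i - y l) ^ 2 - 1 / (y i + y l) ^ 2) := by
    simp [linMatrix]
  rw [h1, Finset.sum_mul, ← Finset.sum_add_distrib]
  refine Finset.sum_congr rfl fun j hj => ?_
  have : i ≠ j := (Finset.ne_of_mem_erase hj).symm
  simp only [linMatrix, Matrix.of_apply, this, if_false]
  ring

lemma abs_inv_taylor_le {ε a η r : ℝ} (hε : 0 < ε) (ha : ε ≤ |a|) (ha' : ε / 2 ≤ |a + η|)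
    (hη : |η| ≤ 2 * r) : |1 / (a + η) - 1 / a - -η / a ^ 2| ≤ 8 / ε ^ 3 * r ^ 2 := by
  have h0 : 0 < |a| := hε.trans_le ha
  have h1 : 0 < |a + η| := (half_pos hε).trans_le ha'
  have a0 : a ≠ 0 := abs_pos.1 h0
  have b0 : a + η ≠ 0 := abs_pos.1 h1
  -- The remainder of the expansion of 1/(a + η) is explicit; the bounds on a, a + η and η turn it
  -- into (2r)²/(ε² · ε/2).
  have e : 1 / (a + η) - 1 / a - -η / a ^ 2 = η ^ 2 / (a ^ 2 * (a + η)) := by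
    field_simp
    ring
  rw [e, abs_div, abs_mul, abs_pow, abs_pow]
  have h2 : |η| ^ 2 ≤ (2 * r) ^ 2 := by gcongr
  have h3 : ε ^ 2 * (ε / 2) ≤ |a| ^ 2 * |a + η| := by gcongr
  calc |η| ^ 2 / (|a| ^ 2 * |a + η|) ≤ (2 * r) ^ 2 / (ε ^ 2 * (ε / 2)) := by
        gcongr
    _ = 8 / ε ^ 3 * r ^ 2 := by field_simp; ring

/-- Second order Taylor estimate for the drift, with its Jacobian `linMatrix`. -/
lemma norm_driftD_add_sub_le {n : ℕ} {ε : ℝ} (hε : 0 < ε) {y h : Vec n}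
    (hy : y ∈ innerChamber n ε) (hh : 4 * ‖h‖ ≤ ε) :
    ‖driftD (y + h) - driftD y - Matrix.toEuclideanLin (linMatrix y) h‖
      ≤ (n + 1) * ((n + 1) * (16 / ε ^ 3)) * ‖h‖ ^ 2 := by
  have hyh := add_mem_innerChamber hy hh
  refine (norm_le_sum_abs _).trans ?_
  have h1 : ∀ i ∈ (Finset.univ : Finset (Fin (n + 1))),
      |(driftD (y + h) - driftD y - Matrix.toEuclideanLin (linMatrix y) h) i|
        ≤ (n + 1) * (16 / ε ^ 3 * ‖h‖ ^ 2) := by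
    intro i _
    simp only [PiLp.sub_apply]
    rw [driftD_apply, driftD_apply, linMatrix_mul_apply, ← Finset.sum_sub_distrib,
      ← Finset.sum_sub_distrib]
    refine (Finset.abs_sum_le_sum_abs _ _).trans ?_
    have h2 : ∀ j ∈ Finset.univ.erase i,
        |1 / ((y + h) i - (y + h) j) + 1 / ((y + h) i + (y + h) j)
          - (1 / (y i - y j) + 1 / (y i + y j))
          - (-(h i - h j) / (y i - y j) ^ 2 + -(h i + h j) / (y i + y j) ^ 2)|
          ≤ 16 / ε ^ 3 * ‖h‖ ^ 2 := by
      intro j hj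
      obtain ⟨ha, hb⟩ := innerChamber_le_abs hy (Finset.ne_of_mem_erase hj)
      obtain ⟨ha', hb'⟩ := innerChamber_le_abs hyh (Finset.ne_of_mem_erase hj)
      simp only [PiLp.add_apply] at ha' hb' ⊢
      have hi := abs_apply_le_norm h i
      have hj := abs_apply_le_norm h j
      have k1 : |h i - h j| ≤ 2 * ‖h‖ := (abs_sub _ _).trans (by linarith)
      have k2 : |h i + h j| ≤ 2 * ‖h‖ := (abs_add_le _ _).trans (by linarith)
      rw [show y i + h i - (y j + h j) = (y i - y j) + (h i - h j) by ring] at ha' ⊢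
      rw [show y i + h i + (y j + h j) = (y i + y j) + (h i + h j) by ring] at hb' ⊢
      have t1 := abs_inv_taylor_le hε ha ha' k1
      have t2 := abs_inv_taylor_le hε hb hb' k2
      refine le_trans (le_of_eq_of_le (congrArg _ ?_) (abs_add_le _ _))
        ((add_le_add t1 t2).trans (le_of_eq (by ring)))
      ring
    refine (Finset.sum_le_card_nsmul _ _ _ h2).trans ?_
    rw [nsmul_eq_mul]
    exact mul_le_mul_of_nonneg_right (card_erase_le_succ i) (by positivity)
  refine (Finset.sum_le_card_nsmul _ _ _ h1).trans (le_of_eq ?_)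
  simp only [Finset.card_univ, Fintype.card_fin, nsmul_eq_mul]
  push_cast
  ring

lemma foldLast_apply_of_ne {n : ℕ} (y : Vec n) {i : Fin (n + 1)} (hi : i ≠ Fin.last n) :
    foldLast y i = y i := by
  simp [foldLast, hi]

@[simp]
lemma foldLast_last {n : ℕ} (y : Vec n) : foldLast y (Fin.last n) = |y (Fin.last n)| := by
  simp [foldLast]

lemma foldLast_eq_self {n : ℕ} {y : Vec n} (hy : 0 ≤ y (Fin.last n)) : foldLast y = y := by
  ext i
  by_cases hi : i = Fin.last n
  · subst hi; simp [abs_of_nonneg hy]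
  · exact foldLast_apply_of_ne y hi

lemma norm_le_of_abs_le {n : ℕ} {y z : Vec n} (h : ∀ i, |y i| ≤ |z i|) : ‖y‖ ≤ ‖z‖ := by
  rw [EuclideanSpace.norm_eq, EuclideanSpace.norm_eq]
  refine Real.sqrt_le_sqrt (Finset.sum_le_sum fun i _ => ?_)
  simp only [Real.norm_eq_abs]
  have := h i
  gcongr

/-- Only the last coordinate differs, and there the claim is the reverse triangle inequality ||y| -
|w|| ≤ |y - w|; this is why z must vanish in it. -/
lemma norm_foldLast_sub_le {n : ℕ} {y z w : Vec n} (hz : z (Fin.last n) = 0) :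
    ‖foldLast y - z - foldLast w‖ ≤ ‖y - z - w‖ := by
  refine norm_le_of_abs_le fun i => ?_
  simp only [PiLp.sub_apply]
  by_cases hi : i = Fin.last n
  · subst hi
    simp only [foldLast_last, hz, sub_zero]
    exact abs_abs_sub_abs_le_abs_sub _ _
  · rw [foldLast_apply_of_ne _ hi, foldLast_apply_of_ne _ hi]

lemma continuous_foldLast {n : ℕ} : Continuous (foldLast : Vec n → Vec n) := by
  unfold foldLast
  refine (PiLp.continuous_toLp 2 _).comp (continuous_pi fun i => ?_)
  split_ifs <;> fun_prop

lemma foldLast_mem_chamberB {n : ℕ} {y : Vec n} (hy : y ∈ chamberD n) :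
    foldLast y ∈ chamberB n := by
  refine ⟨fun i j hij => ?_, fun i => ?_⟩
  · have hi : i ≠ Fin.last n := (lt_of_lt_of_le hij (Fin.le_last j)).ne
    rw [foldLast_apply_of_ne _ hi]
    by_cases hj : j = Fin.last n
    · subst hj; simpa using hy _ _ hij
    · rw [foldLast_apply_of_ne _ hj]
      exact (le_abs_self _).trans (hy _ _ hij)
  · by_cases hi : i = Fin.last n
    · subst hi; simp
    · rw [foldLast_apply_of_ne _ hi]
      exact (abs_nonneg _).trans (hy i (Fin.last n) (Fin.lt_last_iff_ne_last.2 hi))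

lemma foldLast_apply_ne {n : ℕ} {y : Vec n} (hy : y ∈ openChamberD n) {i j : Fin (n + 1)}
    (hij : i ≠ j) : foldLast y i ≠ foldLast y j := by
  have key : ∀ i j : Fin (n + 1), i < j → foldLast y j < foldLast y i := by
    intro i j hij
    have hi : i ≠ Fin.last n := (lt_of_lt_of_le hij (Fin.le_last j)).ne
    rw [foldLast_apply_of_ne _ hi]
    by_cases hj : j = Fin.last n
    · subst hj; simpa using hy _ _ hij
    · rw [foldLast_apply_of_ne _ hj]
      exact (le_abs_self _).trans_lt (hy _ _ hij)
  rcases lt_or_gt_of_ne hij with h | h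
  · exact (key _ _ h).ne'
  · exact (key _ _ h).ne

/-- The drift pushes the last coordinate a towards 0: against another coordinate b > |a| the
contribution is -2a²/((b - a)(b + a)). -/
lemma mul_driftD_last_nonpos {n : ℕ} {y : Vec n} (hy : y ∈ openChamberD n) :
    y (Fin.last n) * driftD y (Fin.last n) ≤ 0 := by
  rw [driftD_apply, Finset.mul_sum]
  refine Finset.sum_nonpos fun j hj => ?_
  have hj' : j < Fin.last n := Fin.lt_last_iff_ne_last.2 (Finset.ne_of_mem_erase hj)
  obtain ⟨h1, h2⟩ := openChamberD_sub_add hy hj'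
  set a := y (Fin.last n)
  have h1' : a - y j ≠ 0 := by linarith
  have h2' : a + y j ≠ 0 := by linarith
  have e : a * (1 / (a - y j) + 1 / (a + y j)) = -(2 * a ^ 2 / ((y j - a) * (y j + a))) := by
    have h1'' : y j - a ≠ 0 := h1.ne'
    have h2'' : y j + a ≠ 0 := h2.ne'
    field_simp
    ring
  rw [e]
  have := div_nonneg (mul_nonneg zero_le_two (sq_nonneg a)) (mul_pos h1 h2).le
  linarith

variable {n : ℕ} {x : Vec n} {φ : ℝ → Vec n}

lemma IsFlowD.continuousOn (hφ : IsFlowD x φ) : ContinuousOn φ (Ici 0) :=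
  fun t ht => (hφ.deriv t ht).continuousWithinAt

/-- The flow stays in the hyperplane `y_N = 0`. -/
lemma IsFlowD.apply_last (hφ : IsFlowD x φ) (hx : x (Fin.last n) = 0) {t : ℝ} (ht : 0 ≤ t) :
    φ t (Fin.last n) = 0 := by
  have hd : ∀ s, 0 ≤ s → HasDerivWithinAt (fun s => φ s (Fin.last n) ^ 2)
      (2 * φ s (Fin.last n) * driftD (φ s) (Fin.last n)) (Ici 0) s := by
    intro s hs
    have h := (EuclideanSpace.proj (𝕜 := ℝ) (Fin.last n)).hasFDerivAt.comp_hasDerivWithinAt s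
      (hφ.deriv s hs)
    have h' := h.pow 2
    simp only [Nat.cast_ofNat, Nat.add_one_sub_one, pow_one] at h'
    exact h'
  -- The square of the last coordinate starts at 0 and cannot increase, so it stays 0; uniqueness
  -- for the differential equation is not needed.
  have hanti : AntitoneOn (fun s => φ s (Fin.last n) ^ 2) (Ici 0) := by
    refine antitoneOn_of_deriv_nonpos (convex_Ici 0)
      (fun s hs => (hd s hs).continuousWithinAt) (fun s hs => ?_) (fun s hs => ?_)
    · rw [interior_Ici] at hs
      exact ((hd s hs.le).hasDerivAt (Ici_mem_nhds hs)).differentiableAt.differentiableWithinAt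
    · rw [interior_Ici] at hs
      rw [((hd s hs.le).hasDerivAt (Ici_mem_nhds hs)).deriv]
      have := mul_driftD_last_nonpos (hφ.mem s hs.le)
      nlinarith
  have h := hanti (mem_Ici.2 le_rfl) (mem_Ici.2 ht) ht
  simp only [hφ.init, hx] at h
  nlinarith [sq_nonneg (φ t (Fin.last n))]

lemma IsFlowD.exists_innerChamber (hφ : IsFlowD x φ) (T : ℝ) :
    ∃ ε > 0, ∀ t ∈ Icc 0 T, φ t ∈ innerChamber n ε := by
  have key : ∀ i j : Fin (n + 1), ∃ ε > 0, ∀ t ∈ Icc 0 T, i < j → |φ t j| + ε ≤ φ t i := by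
    intro i j
    by_cases hij : i < j
    · have hc : ContinuousOn (fun t => φ t i - |φ t j|) (Icc 0 T) := by
        have := hφ.continuousOn.mono (Icc_subset_Ici_self : Icc 0 T ⊆ Ici 0)
        fun_prop
      rcases (Icc 0 T).eq_empty_or_nonempty with he | hne
      · exact ⟨1, one_pos, by simp [he]⟩
      · obtain ⟨s, hs, hmin⟩ := isCompact_Icc.exists_isMinOn hne hc
        refine ⟨φ s i - |φ s j|, by linarith [hφ.mem s hs.1 i j hij], fun t ht _ => ?_⟩
        have := hmin ht
        simp only [mem_ofPred_eq] at this
        linarith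
    · exact ⟨1, one_pos, fun _ _ h => absurd h hij⟩
  choose ε hε h using key
  refine ⟨Finset.univ.inf' Finset.univ_nonempty fun p : Fin (n + 1) × Fin (n + 1) => ε p.1 p.2,
    ?_, fun t ht i j hij => ?_⟩
  · simp only [gt_iff_lt, Finset.lt_inf'_iff]
    exact fun p _ => hε _ _
  · refine le_trans ?_ (h i j t ht hij)
    gcongr
    exact Finset.inf'_le (f := fun p : Fin (n + 1) × Fin (n + 1) => ε p.1 p.2)
      (Finset.mem_univ (i, j))

end

/-! ### Pathwise comparison of Bessel paths and the rate of convergence. -/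

section

/-- Chain rule for the square of an absolutely continuous function. The velocity is only integrable,
since the drift along a Bessel path may be unbounded near the walls. -/
lemma sq_add_integral {r₀ T : ℝ} {ρ : ℝ → ℝ} (hρ : IntervalIntegrable ρ volume 0 T) :
    (r₀ + ∫ s in (0 : ℝ)..T, ρ s) ^ 2
      = r₀ ^ 2 + ∫ s in (0 : ℝ)..T, 2 * ((r₀ + ∫ u in (0 : ℝ)..s, ρ u) * ρ s) := by
  set F : ℝ → ℝ := fun t => ∫ u in (0 : ℝ)..t, ρ u with hF
  have hac : AbsolutelyContinuousOnInterval F 0 T :=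
    hρ.absolutelyContinuousOnInterval_intervalIntegral left_mem_uIcc
  have hd : ∀ᵐ s, s ∈ uIcc 0 T → deriv F s = ρ s := by
    filter_upwards [hρ.ae_hasDerivAt_integral] with s hs hs'
    exact (hs hs' 0 left_mem_uIcc).deriv
  have h1 := hac.integral_deriv_mul_eq_sub hac
  have h2 : ∫ s in (0 : ℝ)..T, deriv F s * F s + F s * deriv F s
      = ∫ s in (0 : ℝ)..T, 2 * (F s * ρ s) := by
    refine intervalIntegral.integral_congr_ae ?_
    filter_upwards [hd] with s hs hs'
    rw [hs (uIoc_subset_uIcc hs')]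
    ring
  have hFρ : IntervalIntegrable (fun s => 2 * (F s * ρ s)) volume 0 T :=
    (hρ.continuousOn_mul hac.continuousOn).const_mul 2
  have h3 : ∫ s in (0 : ℝ)..T, 2 * ((r₀ + F s) * ρ s)
      = (∫ s in (0 : ℝ)..T, 2 * r₀ * ρ s) + ∫ s in (0 : ℝ)..T, 2 * (F s * ρ s) := by
    rw [← intervalIntegral.integral_add (hρ.const_mul _) hFρ]
    congr 1
    ext s
    ring
  have h4 : F 0 = 0 := by simp [hF]
  rw [h2] at h1
  rw [h3, intervalIntegral.integral_const_mul, h1, h4]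
  simp only [hF]
  ring

lemma intervalIntegrable_apply {n : ℕ} {ρ : ℝ → Vec n} {a b : ℝ}
    (hρ : IntervalIntegrable ρ volume a b) (i : Fin (n + 1)) :
    IntervalIntegrable (fun s => ρ s i) volume a b :=
  ⟨(EuclideanSpace.proj (𝕜 := ℝ) i).integrable_comp hρ.1,
    (EuclideanSpace.proj (𝕜 := ℝ) i).integrable_comp hρ.2⟩

lemma intervalIntegral_apply {n : ℕ} {ρ : ℝ → Vec n} {a b : ℝ}
    (hρ : IntervalIntegrable ρ volume a b) (i : Fin (n + 1)) :
    (∫ s in a..b, ρ s) i = ∫ s in a..b, ρ s i :=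
  ((EuclideanSpace.proj (𝕜 := ℝ) i).intervalIntegral_comp_comm hρ).symm

/-- A path whose velocity has radial part at most `C` grows at most linearly. -/
lemma norm_le_of_inner_le {n : ℕ} {R ρ : ℝ → Vec n} {R₀ : Vec n} {C T : ℝ} (hC : 0 ≤ C)
    (hT : 0 ≤ T) (hρ : IntervalIntegrable ρ volume 0 T)
    (hR : ∀ t ∈ Icc 0 T, R t = R₀ + ∫ s in (0 : ℝ)..t, ρ s)
    (h : ∀ᵐ s, s ∈ Icc 0 T → inner ℝ (R s) (ρ s) ≤ C * ‖R s‖) :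
    ∀ t ∈ Icc 0 T, ‖R t‖ ≤ ‖R₀‖ + 2 * C * T := by
  have hsub : ∀ t ∈ Icc 0 T, IntervalIntegrable ρ volume 0 t := fun t ht =>
    hρ.mono_set (by rw [uIcc_of_le hT, uIcc_of_le ht.1]; exact Icc_subset_Icc_right ht.2)
  have hcont : ContinuousOn R (Icc 0 T) := by
    have h1 : ContinuousOn (fun t => R₀ + ∫ s in (0 : ℝ)..t, ρ s) (Icc 0 T) := by
      have := intervalIntegral.continuousOn_primitive_interval' hρ left_mem_uIcc
      rw [uIcc_of_le hT] at this
      exact continuousOn_const.add this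
    exact h1.congr hR
  have hsq : ∀ t ∈ Icc 0 T, ‖R t‖ ^ 2 = ‖R₀‖ ^ 2 + ∫ s in (0 : ℝ)..t, 2 * inner ℝ (R s) (ρ s) := by
    intro t ht
    have hcoord : ∀ i, R t i ^ 2 = R₀ i ^ 2 + ∫ s in (0 : ℝ)..t, 2 * (R s i * ρ s i) := by
      intro i
      have hi := intervalIntegrable_apply (hsub t ht) i
      rw [hR t ht, PiLp.add_apply, intervalIntegral_apply (hsub t ht), sq_add_integral hi]
      congr 1
      refine intervalIntegral.integral_congr fun s hs => ?_
      rw [uIcc_of_le ht.1] at hs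
      have hs' : s ∈ Icc 0 T := ⟨hs.1, hs.2.trans ht.2⟩
      simp only
      rw [hR s hs', PiLp.add_apply, intervalIntegral_apply (hsub s hs')]
    rw [EuclideanSpace.real_norm_sq_eq, EuclideanSpace.real_norm_sq_eq,
      Finset.sum_congr rfl fun i _ => hcoord i, Finset.sum_add_distrib,
      ← intervalIntegral.integral_finsetSum]
    · congr 2
      ext s
      rw [PiLp.inner_apply, Finset.mul_sum]
      refine Finset.sum_congr rfl fun i _ => ?_
      simp [mul_comm]
    · intro i _
      refine IntervalIntegrable.const_mul ?_ 2
      refine (intervalIntegrable_apply (hsub t ht) i).continuousOn_mul ?_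
      rw [uIcc_of_le ht.1]
      have := hcont.mono (Icc_subset_Icc_right ht.2)
      fun_prop
  -- At a time s of maximal norm the energy identity gives ‖R s‖² ≤ ‖R₀‖² + 2CT‖R s‖. With ‖R₀‖ ≤ ‖R
  -- s‖ one factor ‖R s‖ can be cancelled.
  obtain ⟨s, hs, hmax⟩ := isCompact_Icc.exists_isMaxOn (nonempty_Icc.2 hT) hcont.norm
  have hmax' : ∀ t ∈ Icc 0 T, ‖R t‖ ≤ ‖R s‖ := fun t ht => hmax ht
  have h0 : ‖R₀‖ ≤ ‖R s‖ := by
    have := hmax' 0 ⟨le_rfl, hT⟩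
    rwa [hR 0 ⟨le_rfl, hT⟩, intervalIntegral.integral_same, add_zero] at this
  have hint : ∫ u in (0 : ℝ)..s, 2 * inner ℝ (R u) (ρ u) ≤ ∫ u in (0 : ℝ)..s, 2 * (C * ‖R s‖) := by
    refine intervalIntegral.integral_mono_ae_restrict hs.1 ?_ intervalIntegrable_const ?_
    · refine IntervalIntegrable.const_mul ?_ 2
      simp only [PiLp.inner_apply]
      have hsum : (fun u => ∑ i, inner ℝ (R u i) (ρ u i))
          = ∑ i, fun u => inner ℝ (R u i) (ρ u i) := by
        ext u
        simp
      rw [hsum]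
      refine IntervalIntegrable.sum _ fun i _ => ?_
      have hc : ContinuousOn (fun u => R u i) (uIcc 0 s) := by
        rw [uIcc_of_le hs.1]
        have := hcont.mono (Icc_subset_Icc_right hs.2)
        fun_prop
      simpa [mul_comm] using (intervalIntegrable_apply (hsub s hs) i).continuousOn_mul hc
    · rw [Filter.EventuallyLE, ae_restrict_iff' measurableSet_Icc]
      filter_upwards [h] with u hu hu'
      have hu'' : u ∈ Icc 0 T := ⟨hu'.1, hu'.2.trans hs.2⟩
      have h1 := hu hu''
      have h2 := mul_le_mul_of_nonneg_left (hmax' u hu'') hC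
      linarith
  rw [intervalIntegral.integral_const, smul_eq_mul, sub_zero] at hint
  have h1 := hsq s hs
  have h2 : s * (2 * (C * ‖R s‖)) ≤ T * (2 * (C * ‖R s‖)) := by
    have := hs.2
    gcongr
  have h3 : ‖R s‖ ^ 2 ≤ ‖R₀‖ * ‖R s‖ + 2 * C * T * ‖R s‖ := by
    nlinarith [norm_nonneg R₀, norm_nonneg (R s)]
  have h4 : ‖R s‖ ≤ ‖R₀‖ + 2 * C * T := by
    rcases (norm_nonneg (R s)).eq_or_lt with h5 | h5
    · rw [← h5]; positivity
    · nlinarith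
  exact fun t ht => (hmax' t ht).trans h4

variable {n : ℕ} {x : Vec n} {φ : ℝ → Vec n}

lemma continuousOn_driftD : ContinuousOn (driftD : Vec n → Vec n) (openChamberD n) := by
  unfold driftD
  refine (PiLp.continuous_toLp 2 _).comp_continuousOn (continuousOn_pi.2 fun i => ?_)
  refine continuousOn_finsetSum _ fun j hj => ?_
  have hji := Finset.ne_of_mem_erase hj
  have hne : ∀ y ∈ openChamberD n, y i - y j ≠ 0 ∧ y i + y j ≠ 0 := by
    intro y hy
    rcases lt_or_gt_of_ne hji with h | h
    · have := openChamberD_sub_add hy h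
      exact ⟨by linarith, by linarith⟩
    · have := openChamberD_sub_add hy h
      exact ⟨this.1.ne', this.2.ne'⟩
  refine ContinuousOn.add
    (ContinuousOn.div continuousOn_const (by fun_prop) fun y hy => (hne y hy).1)
    (ContinuousOn.div continuousOn_const (by fun_prop) fun y hy => (hne y hy).2)

lemma continuousOn_linMatrix : ContinuousOn (linMatrix : Vec n → _) (openChamberD n) := by
  have hne : ∀ i j, j ≠ i → ∀ y ∈ openChamberD n, y i - y j ≠ 0 ∧ y i + y j ≠ 0 := by
    intro i j hji y hy
    rcases lt_or_gt_of_ne hji with h | h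
    · have := openChamberD_sub_add hy h
      exact ⟨by linarith, by linarith⟩
    · have := openChamberD_sub_add hy h
      exact ⟨this.1.ne', this.2.ne'⟩
  have h1 : ∀ i j, j ≠ i → ∀ c : ℝ, ContinuousOn (fun y : Vec n => c / (y i - y j) ^ 2)
      (openChamberD n) := fun i j hij c =>
    ContinuousOn.div continuousOn_const (by fun_prop) fun y hy => pow_ne_zero 2 (hne i j hij y hy).1
  have h2 : ∀ i j, j ≠ i → ∀ c : ℝ, ContinuousOn (fun y : Vec n => c / (y i + y j) ^ 2)
      (openChamberD n) := fun i j hij c =>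
    ContinuousOn.div continuousOn_const (by fun_prop) fun y hy => pow_ne_zero 2 (hne i j hij y hy).2
  refine continuousOn_pi.2 fun i => continuousOn_pi.2 fun j => ?_
  by_cases hij : i = j
  · simp only [linMatrix, Matrix.of_apply, hij, if_true]
    refine continuousOn_finsetSum _ fun l hl => ?_
    have hl' := Finset.ne_of_mem_erase hl
    exact (h1 _ _ hl' _).sub (h2 _ _ hl' _)
  · simp only [linMatrix, Matrix.of_apply, hij, if_false]
    exact (h1 _ _ (Ne.symm hij) _).sub (h2 _ _ (Ne.symm hij) _)

/-- The Jacobian of the drift as a continuous linear map. -/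
def linCLM (y : Vec n) : Vec n →L[ℝ] Vec n :=
  LinearMap.toContinuousLinearMap (Matrix.toEuclideanLin (linMatrix y))

lemma IsFlowD.continuousOn_linCLM (hφ : IsFlowD x φ) :
    ContinuousOn (fun t => linCLM (φ t)) (Ici 0) := by
  have h1 : Continuous fun M : Matrix (Fin (n + 1)) (Fin (n + 1)) ℝ =>
      LinearMap.toContinuousLinearMap (Matrix.toEuclideanLin M) :=
    (LinearMap.continuous_of_finiteDimensional
      ((LinearMap.toContinuousLinearMap (𝕜 := ℝ) (E := Vec n) (F' := Vec n)).toLinearMap ∘ₗ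
        (Matrix.toEuclideanLin (𝕜 := ℝ) (m := Fin (n + 1)) (n := Fin (n + 1))).toLinearMap))
  exact h1.comp_continuousOn (continuousOn_linMatrix.comp hφ.continuousOn fun t ht => hφ.mem t ht)

lemma IsFlowD.continuousOn_driftD (hφ : IsFlowD x φ) :
    ContinuousOn (fun t => driftD (φ t)) (Ici 0) :=
  BesselLimit.continuousOn_driftD.comp hφ.continuousOn fun t ht => hφ.mem t ht

lemma IsFlowD.eq_integral (hφ : IsFlowD x φ) {t : ℝ} (ht : 0 ≤ t) :
    φ t = x + ∫ s in (0 : ℝ)..t, driftD (φ s) := by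
  have h := intervalIntegral.integral_eq_sub_of_hasDerivAt_of_le ht
    (hφ.continuousOn.mono Icc_subset_Ici_self)
    (fun s hs => (hφ.deriv s hs.1.le).hasDerivAt (Ici_mem_nhds hs.1))
    (hφ.continuousOn_driftD.mono
      (by rw [uIcc_of_le ht]; exact Icc_subset_Ici_self)).intervalIntegrable
  rw [h, hφ.init]
  abel

/-- Comparison of a rescaled Bessel path with a path `z` in the open chamber that has the same
martingale part. -/
lemma IsBesselDPath.norm_sub_le {k C T : ℝ} (hk : 0 < k) (hC : 0 ≤ C) (hT : 0 ≤ T)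
    {b p : ℝ≥0 → Vec n} (hp : IsBesselDPath k (√k • x) b p) {z g : ℝ → Vec n} {z₀ : Vec n}
    (hg : IntervalIntegrable g volume 0 T)
    (hz : ∀ t ∈ Icc 0 T, z t = z₀ + (√k)⁻¹ • b t.toNNReal + ∫ s in (0 : ℝ)..t, g s)
    (hz' : ∀ t ∈ Icc 0 T, z t ∈ openChamberD n)
    (hzg : ∀ t ∈ Icc 0 T, ‖driftD (z t) - g t‖ ≤ C) :
    ∀ t ∈ Icc 0 T, ‖(√k)⁻¹ • p t.toNNReal - z t‖ ≤ ‖x - z₀‖ + 2 * C * T := by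
  have hsk : 0 < √k := Real.sqrt_pos.2 hk
  have hint : ∀ t ∈ Icc 0 T,
      IntervalIntegrable (fun s => √k • driftD (p s.toNNReal)) volume 0 t := by
    intro t ht
    have := hp.integrable t.toNNReal
    rw [Real.coe_toNNReal _ ht.1] at this
    exact this.smul (√k)
  have hgt : ∀ t ∈ Icc 0 T, IntervalIntegrable g volume 0 t := fun t ht =>
    hg.mono_set (by rw [uIcc_of_le hT, uIcc_of_le ht.1]; exact Icc_subset_Icc_right ht.2)
  refine norm_le_of_inner_le (ρ := fun s => √k • driftD (p s.toNNReal) - g s) hC hT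
    ((hint T ⟨hT, le_rfl⟩).sub hg) (fun t ht => ?_) ?_
  · rw [intervalIntegral.integral_sub (hint t ht) (hgt t ht), hz t ht, hp.eq,
      intervalIntegral.integral_smul, Real.coe_toNNReal _ ht.1]
    simp only [smul_add, smul_smul]
    rw [inv_mul_cancel₀ hsk.ne', one_smul]
    have : (√k)⁻¹ * k = √k := by
      field_simp
      rw [Real.sq_sqrt hk.le]
    rw [this]
    abel
  -- Dissipativity is available only in the open chamber; the path is there at almost all times,
  -- which suffices for a bound on the radial velocity under the integral.
  · have hae := hp.ae_mem
    rw [ae_restrict_iff' measurableSet_Ici] at hae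
    filter_upwards [hae] with s hs hs'
    have h1 := hs hs'.1
    have h2 : √k • driftD (p s.toNNReal) = driftD ((√k)⁻¹ • p s.toNNReal) := by
      rw [driftD_smul, inv_inv]
    rw [h2]
    set q := (√k)⁻¹ • p s.toNNReal
    have hq : q ∈ openChamberD n := smul_mem_openChamberD (inv_pos.2 hsk) h1
    have h3 := inner_driftD_sub_le hq (hz' s hs')
    have h4 : inner ℝ (q - z s) (driftD (z s) - g s) ≤ ‖q - z s‖ * C :=
      (real_inner_le_norm _ _).trans (by gcongr; exact hzg s hs')
    have h5 : inner ℝ (q - z s) (driftD q - g s) = inner ℝ (q - z s) (driftD q - driftD (z s))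
        + inner ℝ (q - z s) (driftD (z s) - g s) := by
      rw [← inner_add_right]
      congr 1
      abel
    linarith

lemma exists_mem_innerChamber (n : ℕ) (L : ℝ) : ∃ y : Vec n, y ∈ innerChamber n L := by
  refine ⟨WithLp.toLp 2 fun i => |L| * ((n : ℝ) + 1 - i), fun i j hij => ?_⟩
  have h1 : ((i : ℕ) : ℝ) + 1 ≤ (j : ℕ) := by exact_mod_cast hij
  have h2 : ((j : ℕ) : ℝ) ≤ n := by exact_mod_cast Nat.lt_succ_iff.1 j.2
  have h3 := le_abs_self L
  have h4 := abs_nonneg L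
  simp only
  rw [abs_of_nonneg (by apply mul_nonneg h4; linarith)]
  nlinarith

/-- The pathwise rate of convergence, uniformly in the multiplicity. -/
lemma bddAbove_of_path (hφ : IsFlowD x φ) (hx : x (Fin.last n) = 0) {b w : ℝ≥0 → Vec n}
    (hb : Continuous b) (hw : Continuous w)
    (hwb : ∀ t : ℝ≥0, w t = b t
      + ∫ s in (0 : ℝ)..t, Matrix.toEuclideanLin (linMatrix (φ s)) (w s.toNNReal)) (T : ℝ≥0) :
    ∃ K, ∀ k : ℝ, 1 / 2 ≤ k → ∀ p, IsBesselDPath k (√k • x) b p → ∀ s ≤ T,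
      √k * ‖foldLast (p s) - √k • φ s - foldLast (w s)‖ ≤ K := by
  have hT : (0 : ℝ) ≤ T := T.2
  obtain ⟨ε, hε, hφε⟩ := hφ.exists_innerChamber (T : ℝ)
  have hbdd : ∀ f : ℝ → Vec n, ContinuousOn f (Icc 0 (T : ℝ)) →
      ∃ M, 0 ≤ M ∧ ∀ t ∈ Icc 0 (T : ℝ), ‖f t‖ ≤ M := by
    intro f hf
    obtain ⟨M, hM⟩ := isCompact_Icc.exists_bound_of_continuousOn hf
    exact ⟨M, (norm_nonneg _).trans (hM 0 ⟨le_rfl, hT⟩), hM⟩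
  have hw' : Continuous fun t : ℝ => w t.toNNReal := hw.comp continuous_real_toNNReal
  have hb' : Continuous fun t : ℝ => b t.toNNReal := hb.comp continuous_real_toNNReal
  obtain ⟨Mw, hMw0, hMw⟩ := hbdd _ hw'.continuousOn
  obtain ⟨Mb, hMb0, hMb⟩ := hbdd _ hb'.continuousOn
  obtain ⟨Mφ, hMφ0, hMφ⟩ := hbdd _ (hφ.continuousOn.mono Icc_subset_Ici_self)
  set C₁ : ℝ := (n + 1) * ((n + 1) * (16 / ε ^ 3)) with hC₁
  have hC₁0 : 0 ≤ C₁ := by positivity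
  -- For small k the noise is b/√k with 1/√k ≤ 2, so 4‖b/√k‖ ≤ 8 Mb < L, and w₀ + b/√k keeps half of
  -- the margin L of w₀.
  set L : ℝ := 8 * Mb + 1 with hL
  have hL0 : 0 < L := by positivity
  obtain ⟨w₀, hw₀⟩ := exists_mem_innerChamber n L
  set C₂ : ℝ := (n + 1) * ((n + 1) * (2 / (L / 2))) with hC₂
  have hC₂0 : 0 ≤ C₂ := by positivity
  set D : ℝ := ‖x - w₀‖ + 2 * C₂ * T with hD
  have hD0 : 0 ≤ D := by positivity
  -- The threshold for √k beyond which 4‖w/√k‖ ≤ ε, so that φ + w/√k stays in the inner chamber with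
  -- margin ε/2.
  set K₀ : ℝ := 4 * Mw / ε with hK₀
  have hK₀0 : 0 ≤ K₀ := by positivity
  set K₂ : ℝ := K₀ * (K₀ * (D + ‖w₀‖ + Mφ) + Mb + Mw) with hK₂
  refine ⟨max (2 * C₁ * Mw ^ 2 * T) K₂, fun k hk p hp s hs => ?_⟩
  have hk0 : 0 < k := by linarith
  have hsk : 0 < √k := Real.sqrt_pos.2 hk0
  have hsI : (s : ℝ) ∈ Icc 0 (T : ℝ) := ⟨s.2, hs⟩
  have hfold : ‖foldLast (p s) - √k • φ s - foldLast (w s)‖ ≤ ‖p s - √k • φ s - w s‖ := by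
    refine norm_foldLast_sub_le ?_
    have h0 : φ s (Fin.last n) = 0 := hφ.apply_last hx s.2
    simp [h0]
  refine (mul_le_mul_of_nonneg_left hfold hsk.le).trans ?_
  by_cases hcase : K₀ ≤ √k
  · refine le_trans ?_ (le_max_left _ _)
    set δ := (√k)⁻¹ with hδ
    have hδ0 : 0 < δ := inv_pos.2 hsk
    have hδM : 4 * (δ * Mw) ≤ ε := by
      rw [hK₀, div_le_iff₀ hε] at hcase
      rw [hδ, ← mul_assoc, mul_comm 4, mul_assoc, inv_mul_le_iff₀ hsk]
      exact hcase
    have hcA : ContinuousOn (fun t => Matrix.toEuclideanLin (linMatrix (φ t)) (w t.toNNReal))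
        (Ici 0) :=
      hφ.continuousOn_linCLM.clm_apply hw'.continuousOn
    have hiH : ∀ t : ℝ, 0 ≤ t → IntervalIntegrable (fun s => driftD (φ s)) volume 0 t :=
      fun t ht => (hφ.continuousOn_driftD.mono
        (by rw [uIcc_of_le ht]; exact Icc_subset_Ici_self)).intervalIntegrable
    have hiA : ∀ t : ℝ, 0 ≤ t → IntervalIntegrable
        (fun s => δ • Matrix.toEuclideanLin (linMatrix (φ s)) (w s.toNNReal)) volume 0 t :=
      fun t ht => ((hcA.mono
        (by rw [uIcc_of_le ht]; exact Icc_subset_Ici_self)).intervalIntegrable).smul δ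
    have hδw : ∀ t ∈ Icc 0 (T : ℝ), 4 * ‖δ • w t.toNNReal‖ ≤ ε := by
      intro t ht
      refine le_trans ?_ hδM
      rw [norm_smul, Real.norm_of_nonneg hδ0.le]
      have := hMw t ht
      gcongr
    -- The defect H(z) - g is the second order Taylor remainder, of size δ² = 1/k. The factor k = √k
    -- · √k, one from undoing the scaling and one from the rate, cancels it exactly.
    have hmain := hp.norm_sub_le (z := fun t => φ t + δ • w t.toNNReal)
      (g := fun t => driftD (φ t) + δ • Matrix.toEuclideanLin (linMatrix (φ t)) (w t.toNNReal))
      (z₀ := x) (C := C₁ * (δ * Mw) ^ 2) hk0 (by positivity) hT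
      ((hiH T hT).add (hiA T hT)) (fun t ht => ?_) (fun t ht => ?_) (fun t ht => ?_) s hsI
    · simp only [sub_self, norm_zero, zero_add, Real.toNNReal_coe] at hmain
      have e : p s - √k • φ s - w s = √k • (δ • p s - (φ s + δ • w s)) := by
        rw [smul_sub, smul_add, smul_smul, smul_smul, hδ, mul_inv_cancel₀ hsk.ne', one_smul,
          one_smul]
        abel
      rw [e, norm_smul, Real.norm_of_nonneg hsk.le]
      calc √k * (√k * ‖δ • p s - (φ s + δ • w s)‖)
          ≤ √k * (√k * (2 * (C₁ * (δ * Mw) ^ 2) * T)) := by gcongr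
        _ = 2 * C₁ * Mw ^ 2 * T * (√k * δ) ^ 2 := by ring
        _ = 2 * C₁ * Mw ^ 2 * T := by rw [hδ, mul_inv_cancel₀ hsk.ne']; ring
    · rw [intervalIntegral.integral_add (hiH t ht.1) (hiA t ht.1), intervalIntegral.integral_smul]
      have := hwb t.toNNReal
      rw [Real.coe_toNNReal _ ht.1] at this
      rw [this, hφ.eq_integral ht.1, smul_add]
      abel
    · exact innerChamber_subset (half_pos hε) (add_mem_innerChamber (hφε t ht) (hδw t ht))
    · have h1 := norm_driftD_add_sub_le hε (hφε t ht) (hδw t ht)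
      have h2 : ‖δ • w t.toNNReal‖ ≤ δ * Mw := by
        rw [norm_smul, Real.norm_of_nonneg hδ0.le]
        have := hMw t ht
        gcongr
      rw [map_smul, sub_sub] at h1
      exact h1.trans (by gcongr)
  -- Here √k < K₀, so any bound on the error that is uniform in k will do. The comparison path w₀ +
  -- b/√k has g = 0, and its defect is the bounded drift along it.
  · refine le_trans ?_ (le_max_right _ _)
    rw [not_le] at hcase
    have hδ2 : (√k)⁻¹ ≤ 2 := by
      rw [inv_le_comm₀ hsk two_pos, Real.le_sqrt (by norm_num) hk0.le]
      norm_num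
      linarith
    set δ := (√k)⁻¹ with hδ
    have hδ0 : 0 < δ := inv_pos.2 hsk
    have hin : ∀ t ∈ Icc 0 (T : ℝ), w₀ + δ • b t.toNNReal ∈ innerChamber n (L / 2) := by
      intro t ht
      refine add_mem_innerChamber hw₀ ?_
      rw [norm_smul, Real.norm_of_nonneg hδ0.le]
      have : δ * ‖b t.toNNReal‖ ≤ 2 * Mb := by
        have := hMb t ht
        gcongr
      linarith
    have hmain := hp.norm_sub_le (z := fun t => w₀ + δ • b t.toNNReal) (g := fun _ => 0)
      (z₀ := w₀) (C := C₂) hk0 hC₂0 hT intervalIntegrable_const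
      (fun t ht => by simp [hδ])
      (fun t ht => innerChamber_subset (half_pos hL0) (hin t ht))
      (fun t ht => by rw [sub_zero]; exact norm_driftD_le (half_pos hL0) (hin t ht)) s hsI
    simp only [Real.toNNReal_coe] at hmain
    have e : p s - √k • φ s - w s = √k • (δ • p s - (w₀ + δ • b s)) + √k • (w₀ - φ s)
        + (b s - w s) := by
      simp only [smul_sub, smul_add, smul_smul]
      rw [hδ, mul_inv_cancel₀ hsk.ne', one_smul, one_smul]
      abel
    have n1 : ‖√k • (δ • p s - (w₀ + δ • b s))‖ ≤ K₀ * D := by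
      rw [norm_smul, Real.norm_of_nonneg hsk.le]
      gcongr
    have n2 : ‖√k • (w₀ - φ s)‖ ≤ K₀ * (‖w₀‖ + Mφ) := by
      rw [norm_smul, Real.norm_of_nonneg hsk.le]
      have := hMφ s hsI
      have := norm_sub_le w₀ (φ s)
      gcongr
      linarith
    have n3 : ‖b s - w s‖ ≤ Mb + Mw := by
      have h1 := hMb s hsI
      have h2 := hMw s hsI
      rw [Real.toNNReal_coe] at h1 h2
      exact (norm_sub_le _ _).trans (add_le_add h1 h2)
    have n4 : ‖p s - √k • φ s - w s‖ ≤ K₀ * (D + ‖w₀‖ + Mφ) + Mb + Mw := by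
      rw [e]
      refine (norm_add_le _ _).trans ((add_le_add ((norm_add_le _ _).trans (add_le_add n1 n2))
        n3).trans (le_of_eq ?_))
      ring
    rw [hK₂]
    gcongr

end

/-! ### Gaussian variables as limits, and the Euler scheme. -/

section

section Gaussian

variable {P : Measure Ω}

lemma integral_cexp_eq_charFun {Y : Ω → ℝ} (hY : AEMeasurable Y P) (t : ℝ) :
    charFun (P.map Y) t = ∫ ω, Complex.exp (t * Y ω * Complex.I) ∂P := by
  rw [charFun_apply_real, integral_map hY (by fun_prop)]

/-- An almost sure limit of centred Gaussian random variables is a centred Gaussian random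
variable, and the variances converge. -/
lemma exists_hasLaw_gaussianReal_of_tendsto [IsProbabilityMeasure P] {Y : ℕ → Ω → ℝ} {Z : Ω → ℝ}
    {v : ℕ → ℝ≥0}
    (hY : ∀ m, HasLaw (Y m) (gaussianReal 0 (v m)) P)
    (h : ∀ᵐ ω ∂P, Tendsto (fun m => Y m ω) atTop (𝓝 (Z ω))) :
    ∃ v' : ℝ≥0, HasLaw Z (gaussianReal 0 v') P ∧ Tendsto v atTop (𝓝 v') := by
  have hZ : AEMeasurable Z P := aemeasurable_of_tendsto_metrizable_ae _
    (fun m => (hY m).aemeasurable) h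
  set ψ : ℝ → ℂ := fun t => ∫ ω, Complex.exp (t * Z ω * Complex.I) ∂P with hψ
  have hlim : ∀ t : ℝ, Tendsto (fun m => Complex.exp (((-(v m : ℝ) * t ^ 2 / 2 : ℝ)) : ℂ)) atTop
      (𝓝 (ψ t)) := by
    intro t
    have h1 : ∀ m, Complex.exp (((-(v m : ℝ) * t ^ 2 / 2 : ℝ)) : ℂ)
        = ∫ ω, Complex.exp (t * Y m ω * Complex.I) ∂P := by
      intro m
      rw [← integral_cexp_eq_charFun (hY m).aemeasurable, (hY m).map_eq, charFun_gaussianReal]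
      congr 1
      push_cast
      ring
    simp only [h1]
    refine tendsto_integral_of_dominated_convergence (fun _ => 1) (fun m => ?_)
      (integrable_const _) (fun m => ?_) ?_
    · have := (hY m).aemeasurable
      exact AEMeasurable.aestronglyMeasurable (by fun_prop)
    · filter_upwards with ω
      rw [← Complex.ofReal_mul, Complex.norm_exp_ofReal_mul_I]
    · filter_upwards [h] with ω hω
      have hc : Continuous fun y : ℝ => Complex.exp (t * y * Complex.I) := by fun_prop
      exact (hc.tendsto _).comp hω
  -- This excludes that the variances tend to infinity: ψ is nonzero at some τ ≠ 0, and taking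
  -- logarithms of exp(-v_m τ²/2) → ψ(τ) forces v_m to converge.
  have hψ0 : Tendsto (fun m : ℕ => ψ (1 / ((m : ℝ) + 1))) atTop (𝓝 1) := by
    have h1 : (1 : ℂ) = ∫ ω, (1 : ℂ) ∂P := by simp
    rw [h1]
    refine tendsto_integral_of_dominated_convergence (fun _ => 1) (fun m => ?_)
      (integrable_const _) (fun m => ?_) ?_
    · exact AEMeasurable.aestronglyMeasurable (by fun_prop)
    · filter_upwards with ω
      rw [← Complex.ofReal_mul, Complex.norm_exp_ofReal_mul_I]
    · filter_upwards with ω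
      have hc : Continuous fun s : ℝ => Complex.exp (s * Z ω * Complex.I) := by fun_prop
      have := (hc.tendsto 0).comp (tendsto_one_div_add_atTop_nhds_zero_nat (𝕜 := ℝ))
      simpa [Function.comp_def] using this
  obtain ⟨m₀, hm₀⟩ : ∃ m : ℕ, ψ (1 / ((m : ℝ) + 1)) ≠ 0 :=
    (hψ0.eventually_ne one_ne_zero).exists
  set τ : ℝ := 1 / ((m₀ : ℝ) + 1) with hτ
  have hτ0 : τ ≠ 0 := by positivity
  have hv : Tendsto (fun m => (v m : ℝ)) atTop (𝓝 (-(2 / τ ^ 2) * Real.log ‖ψ τ‖)) := by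
    have h1 := ((hlim τ).norm.log (norm_ne_zero_iff.2 hm₀)).const_mul (-(2 / τ ^ 2))
    refine h1.congr fun m => ?_
    rw [Complex.norm_exp, Complex.ofReal_re, Real.log_exp]
    field_simp
  set V : ℝ := -(2 / τ ^ 2) * Real.log ‖ψ τ‖ with hV
  have hV0 : 0 ≤ V := ge_of_tendsto' hv fun m => (v m).2
  obtain ⟨V', hV'⟩ : ∃ V' : ℝ≥0, (V' : ℝ) = V := ⟨⟨V, hV0⟩, rfl⟩
  rw [← hV'] at hv
  refine ⟨V', ⟨hZ, ?_⟩, NNReal.tendsto_coe.1 hv⟩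
  · have : IsProbabilityMeasure (P.map Z) := Measure.isProbabilityMeasure_map hZ
    refine Measure.ext_of_charFun (funext fun t => ?_)
    rw [integral_cexp_eq_charFun hZ, charFun_gaussianReal]
    refine tendsto_nhds_unique (hlim t) ?_
    have hc : Continuous fun s : ℝ => Complex.exp (((-s * t ^ 2 / 2 : ℝ)) : ℂ) := by fun_prop
    have h2 := (hc.tendsto (V' : ℝ)).comp hv
    convert! h2 using 2
    congr 1
    push_cast
    ring

variable {𝓕 : Filtration ℝ≥0 mΩ} {n : ℕ} {B : ℝ≥0 → Ω → Vec n}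

/-- Independent Gaussian vectors are jointly Gaussian. A finite set of pairs (time, coordinate) is
enlarged to all coordinates at the times that occur, and the law is then projected back. -/
lemma IsBrownianVec.isGaussianProcess (hB : IsBrownianVec B 𝓕 P) :
    IsGaussianProcess (fun (p : ℝ≥0 × Fin (n + 1)) ω => B p.1 ω p.2) P where
  hasGaussianLaw I := by
    set J : Finset ℝ≥0 := I.image Prod.fst with hJ
    have h1 : ∀ i, HasGaussianLaw (fun ω => J.restrict fun t => B t ω i) P :=
      fun i => (IsPreBrownianReal.isGaussianProcess
        (hB.coord i).toIsPreBrownianReal).hasGaussianLaw J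
    have h2 : iIndepFun (fun i ω => J.restrict fun t => B t ω i) P :=
      hB.indep_coord.comp (fun _ g => J.restrict g) (fun _ => by fun_prop)
    have h3 := h2.hasGaussianLaw h1
    have hmem : ∀ p : I, p.1.1 ∈ J := fun p => Finset.mem_image_of_mem _ p.2
    exact h3.map (ContinuousLinearMap.pi fun p : I =>
      (ContinuousLinearMap.proj (R := ℝ) (φ := fun _ : J => ℝ) ⟨p.1.1, hmem p⟩).comp
        (ContinuousLinearMap.proj (R := ℝ) (φ := fun _ : Fin (n + 1) => J → ℝ) p.1.2))

/-- The linear span of the values of the coordinates of a process. -/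
def valueSpan (B : ℝ≥0 → Ω → Vec n) : Submodule ℝ (Ω → ℝ) :=
  Submodule.span ℝ (range fun (p : ℝ≥0 × Fin (n + 1)) ω => B p.1 ω p.2)

/-- The point of `valueSpan`: it reduces Gaussianity of the Euler approximations to closure of a
subspace under linear operations. -/
lemma IsBrownianVec.exists_hasLaw_of_mem_valueSpan (hB : IsBrownianVec B 𝓕 P) {Y : Ω → ℝ}
    (hY : Y ∈ valueSpan B) : ∃ v : ℝ≥0, HasLaw Y (gaussianReal 0 v) P := by
  obtain ⟨c, rfl⟩ := Finsupp.mem_span_range_iff_exists_finsupp.1 hY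
  have hG : HasGaussianLaw (c.sum fun p a => a • fun ω => B p.1 ω p.2) P :=
    (hB.isGaussianProcess.smul fun p => c p).hasGaussianLaw_sum (I := c.support)
  have hint : ∀ p : ℝ≥0 × Fin (n + 1), Integrable (fun ω => B p.1 ω p.2) P :=
    fun p => (hB.coord p.2).integrable_eval p.1
  have h0 : P[c.sum fun p a => a • fun ω => B p.1 ω p.2] = 0 := by
    have e : (c.sum fun p a => a • fun ω => B p.1 ω p.2)
        = fun ω => ∑ p ∈ c.support, c p * B p.1 ω p.2 := by
      ext ω
      simp [Finsupp.sum, Finset.sum_apply]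
    rw [e, integral_finsetSum _ fun p _ => (hint p).const_mul _]
    refine Finset.sum_eq_zero fun p _ => ?_
    rw [integral_const_mul, (hB.coord p.2).integral_eval, mul_zero]
  have hm := hG.map_eq_gaussianReal
  rw [h0] at hm
  exact ⟨_, hG.aemeasurable, hm⟩

lemma clm_mem_valueSpan {Y : Ω → Vec n} (hY : ∀ i, (fun ω => Y ω i) ∈ valueSpan B)
    (L : Vec n →ₗ[ℝ] ℝ) :
    (fun ω => L (Y ω)) ∈ valueSpan B := by
  have e : (fun ω => L (Y ω)) = ∑ i, L (EuclideanSpace.single i 1) • fun ω => Y ω i := by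
    ext ω
    have h : Y ω = ∑ i, Y ω i • EuclideanSpace.single i (1 : ℝ) := by
      ext j
      simp [Finset.sum_apply, Pi.single_apply]
    conv_lhs => rw [h]
    simp [Finset.sum_apply, mul_comm]
  rw [e]
  exact Submodule.sum_mem _ fun i _ => Submodule.smul_mem _ _ (hY i)

end Gaussian

section Euler

variable {E : Type*} [NormedAddCommGroup E] [NormedSpace ℝ E]

/-- The explicit Euler scheme with step `h` for `dw = db + A w dt`. -/
def euler (A : ℝ → E →L[ℝ] E) (b : ℝ≥0 → E) (h : ℝ≥0) : ℕ → E
  | 0 => b 0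
  | j + 1 => euler A b h j + (b ((j + 1 : ℕ) * h) - b (j * h)) + (h : ℝ) • A (j * h) (euler A b h j)

/-- Discrete Gronwall argument. The increments of b cancel exactly, so only the oscillation η of s ↦
A_s w_s over one step enters, and no regularity of b is required beyond continuity of w. -/
lemma norm_sub_euler_le [CompleteSpace E] {A : ℝ → E →L[ℝ] E} {b w : ℝ≥0 → E} {C η : ℝ} {h t : ℝ≥0}
    (hA : ContinuousOn A (Ici 0)) (hw : Continuous w) (hη : 0 ≤ η) (hC : 0 ≤ C)
    (hAC : ∀ s ∈ Icc 0 (t : ℝ), ‖A s‖ ≤ C)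
    (heq : ∀ t : ℝ≥0, w t = b t + ∫ s in (0 : ℝ)..t, A s (w s.toNNReal))
    (hosc : ∀ s ∈ Icc 0 (t : ℝ), ∀ u ∈ Icc 0 (t : ℝ), |s - u| ≤ h →
      ‖A s (w s.toNNReal) - A u (w u.toNNReal)‖ ≤ η) (j : ℕ) (hj : j * h ≤ t) :
    ‖w (j * h) - euler A b h j‖ ≤ j * h * η * Real.exp (C * (j * h)) := by
  have hcF : ContinuousOn (fun s => A s (w s.toNNReal)) (Ici 0) :=
    hA.clm_apply (hw.comp continuous_real_toNNReal).continuousOn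
  have hiF : ∀ a b : ℝ, 0 ≤ a → 0 ≤ b →
      IntervalIntegrable (fun s => A s (w s.toNNReal)) volume a b := by
    intro a b ha hb
    refine (hcF.mono ?_).intervalIntegrable
    intro s hs
    exact (le_min ha hb).trans hs.1
  induction j with
  | zero => simp [euler, heq 0]
  | succ j ih =>
    have hh : (0 : ℝ) ≤ h := h.2
    have hjj : (j : ℝ≥0) * h ≤ ((j + 1 : ℕ) : ℝ≥0) * h := by gcongr; simp
    have hj' := hjj.trans hj
    have ih := ih hj'
    set e := w (j * h) - euler A b h j with he
    have hjt : (j : ℝ) * h ≤ t := by exact_mod_cast hj'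
    have hjt1 : ((j + 1 : ℕ) : ℝ) * h ≤ t := by exact_mod_cast hj
    have hle : (j : ℝ) * h ≤ ((j + 1 : ℕ) : ℝ) * h := by exact_mod_cast hjj
    have hj0 : (0 : ℝ) ≤ j * h := by positivity
    have hjmem : (j : ℝ) * h ∈ Icc 0 (t : ℝ) := ⟨hj0, hjt⟩
    have hincr : w ((j + 1 : ℕ) * h) - w (j * h) = b ((j + 1 : ℕ) * h) - b (j * h)
        + ∫ s in ((j : ℝ) * h)..((j + 1 : ℕ) * h), A s (w s.toNNReal) := by
      rw [heq ((j + 1 : ℕ) * h), heq (j * h)]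
      have := intervalIntegral.integral_add_adjacent_intervals
        (hiF 0 _ le_rfl hj0) (hiF _ _ hj0 (hj0.trans hle))
      simp only [NNReal.coe_mul, NNReal.coe_natCast]
      rw [← this]
      abel
    have hwj : w ((j : ℝ) * h).toNNReal = w (j * h) := by
      congr 1
      rw [← NNReal.coe_natCast, ← NNReal.coe_mul, Real.toNNReal_coe]
    have hI : ‖(∫ s in ((j : ℝ) * h)..((j + 1 : ℕ) * h), A s (w s.toNNReal))
        - (h : ℝ) • A (j * h) (w (j * h))‖ ≤ η * h := by
      have e1 : (h : ℝ) • A (j * h) (w (j * h))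
          = ∫ s in ((j : ℝ) * h)..((j + 1 : ℕ) * h), A (j * h) (w (j * h)) := by
        rw [intervalIntegral.integral_const]
        congr 1
        push_cast
        ring
      rw [e1, ← intervalIntegral.integral_sub (hiF _ _ hj0 (hj0.trans hle))
        intervalIntegrable_const]
      refine (intervalIntegral.norm_integral_le_of_norm_le_const (C := η) fun s hs => ?_).trans
        (le_of_eq ?_)
      · rw [uIoc_of_le hle] at hs
        have hsm : s ∈ Icc 0 (t : ℝ) := ⟨hj0.trans hs.1.le, hs.2.trans hjt1⟩
        have := hosc s hsm _ hjmem (by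
          rw [abs_of_nonneg (by linarith [hs.1])]
          have := hs.2
          push_cast at this
          linarith)
        rwa [hwj] at this
      · rw [abs_of_nonneg (by linarith)]
        push_cast
        ring
    -- New error = old error + local error of freezing the integrand + propagation of the old error
    -- by hA, of norms at most ‖e‖, ηh and Ch‖e‖.
    have hstep : w ((j + 1 : ℕ) * h) - euler A b h (j + 1)
        = e + ((∫ s in ((j : ℝ) * h)..((j + 1 : ℕ) * h), A s (w s.toNNReal))
          - (h : ℝ) • A (j * h) (w (j * h))) + (h : ℝ) • A (j * h) e := by
      have : w ((j + 1 : ℕ) * h) = w (j * h) + (w ((j + 1 : ℕ) * h) - w (j * h)) := by abel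
      rw [this, hincr, euler, he, map_sub, smul_sub]
      abel
    have h3 : ‖(h : ℝ) • A (j * h) e‖ ≤ h * (C * ‖e‖) := by
      rw [norm_smul, Real.norm_of_nonneg hh]
      gcongr
      exact (ContinuousLinearMap.le_opNorm _ _).trans (by gcongr; exact hAC _ hjmem)
    have h4 : ‖w ((j + 1 : ℕ) * h) - euler A b h (j + 1)‖ ≤ (1 + C * h) * ‖e‖ + η * h := by
      rw [hstep]
      refine (norm_add_le _ _).trans ((add_le_add ((norm_add_le _ _).trans
        (add_le_add le_rfl hI)) h3).trans (le_of_eq ?_))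
      ring
    refine h4.trans ?_
    have h5 : 1 + C * h ≤ Real.exp (C * h) := by
      have := Real.add_one_le_exp (C * h)
      linarith
    have h6 : (1 : ℝ) ≤ Real.exp (C * (((j + 1 : ℕ) : ℝ) * h)) :=
      Real.one_le_exp (by positivity)
    have h7 : Real.exp (C * (((j + 1 : ℕ) : ℝ) * h))
        = Real.exp (C * h) * Real.exp (C * (j * h)) := by
      rw [← Real.exp_add]
      congr 1
      push_cast
      ring
    calc (1 + C * h) * ‖e‖ + η * h
        ≤ Real.exp (C * h) * (j * h * η * Real.exp (C * (j * h)))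
          + η * h * Real.exp (C * (((j + 1 : ℕ) : ℝ) * h)) := by
          have h8 := le_mul_of_one_le_right (by positivity : 0 ≤ η * h) h6
          gcongr
      _ = ((j + 1 : ℕ) : ℝ) * h * η * Real.exp (C * (((j + 1 : ℕ) : ℝ) * h)) := by
          rw [h7]
          push_cast
          ring

lemma tendsto_euler [CompleteSpace E] {A : ℝ → E →L[ℝ] E} {b w : ℝ≥0 → E}
    (hA : ContinuousOn A (Ici 0)) (hw : Continuous w)
    (heq : ∀ t : ℝ≥0, w t = b t + ∫ s in (0 : ℝ)..t, A s (w s.toNNReal)) (t : ℝ≥0) :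
    Tendsto (fun m : ℕ => euler A b (t / (m + 1)) (m + 1)) atTop (𝓝 (w t)) := by
  have hcF : ContinuousOn (fun s => A s (w s.toNNReal)) (Icc 0 (t : ℝ)) :=
    (hA.clm_apply (hw.comp continuous_real_toNNReal).continuousOn).mono Icc_subset_Ici_self
  obtain ⟨C, hC⟩ := isCompact_Icc.exists_bound_of_continuousOn
    (hA.mono (Icc_subset_Ici_self : Icc 0 (t : ℝ) ⊆ Ici 0))
  have hC0 : 0 ≤ C := (norm_nonneg _).trans (hC 0 ⟨le_rfl, t.2⟩)
  have huc := isCompact_Icc.uniformContinuousOn_of_continuous hcF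
  rw [Metric.uniformContinuousOn_iff_le] at huc
  rw [Metric.tendsto_atTop]
  intro ε hε
  set η : ℝ := ε / (2 * (t + 1) * Real.exp (C * t)) with hη
  have hη0 : 0 < η := by positivity
  obtain ⟨δ, hδ, hδ'⟩ := huc η hη0
  obtain ⟨m₀, hm₀⟩ := exists_nat_gt ((t : ℝ) / δ)
  refine ⟨m₀, fun m hm => ?_⟩
  have hcoe : ((t / (m + 1) : ℝ≥0) : ℝ) = t / (m + 1) := by push_cast; rfl
  have hmt : ((m + 1 : ℕ) : ℝ≥0) * (t / (m + 1)) = t := by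
    push_cast
    field_simp
  have hδm : ((t / (m + 1) : ℝ≥0) : ℝ) ≤ δ := by
    rw [hcoe, div_le_iff₀ (by positivity)]
    rw [div_lt_iff₀ hδ] at hm₀
    have : (m₀ : ℝ) ≤ m := by exact_mod_cast hm
    nlinarith
  have h1 := norm_sub_euler_le (h := t / (m + 1)) (t := t) hA hw hη0.le hC0 hC heq
    (fun s hs u hu hsu => by
      have := hδ' s hs u hu (by rw [Real.dist_eq]; exact hsu.trans hδm)
      rwa [dist_eq_norm] at this) (m + 1) hmt.le
  rw [hmt] at h1
  have hmt' : ((m + 1 : ℕ) : ℝ) * ((t / (m + 1) : ℝ≥0) : ℝ) = t := by exact_mod_cast hmt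
  rw [hmt'] at h1
  rw [dist_comm, dist_eq_norm]
  refine h1.trans_lt ?_
  have ht : (0 : ℝ) ≤ t := t.2
  have : (t : ℝ) * η * Real.exp (C * t) = ε * (t / (2 * (t + 1))) := by
    rw [hη]
    field_simp
  rw [this]
  have h2 : (t : ℝ) / (2 * (t + 1)) < 1 := by
    rw [div_lt_one (by positivity)]
    linarith
  nlinarith

end Euler

end

/-! ### Gaussianity of the limit process and the law of its last coordinate. -/

section

variable {P : Measure Ω} {𝓕 : Filtration ℝ≥0 mΩ} {n : ℕ} {B : ℝ≥0 → Ω → Vec n}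

lemma euler_mem_valueSpan (A : ℝ → Vec n →L[ℝ] Vec n) (h : ℝ≥0) (j : ℕ) (i : Fin (n + 1)) :
    (fun ω => euler A (fun t => B t ω) h j i) ∈ valueSpan B := by
  have hB : ∀ t i, (fun ω => B t ω i) ∈ valueSpan B :=
    fun t i => Submodule.subset_span ⟨(t, i), rfl⟩
  induction j generalizing i with
  | zero => exact hB 0 i
  | succ j ih =>
    refine Submodule.add_mem _ (Submodule.add_mem _ (ih i)
      (Submodule.sub_mem _ (hB _ i) (hB _ i))) (Submodule.smul_mem _ (h : ℝ) ?_)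
    exact clm_mem_valueSpan ih
      ((EuclideanSpace.proj (𝕜 := ℝ) i).toLinearMap ∘ₗ (A (j * h)).toLinearMap)

/-- Adaptedness at the exact grid time jh makes the scheme independent of the next Brownian
increment. -/
lemma measurable_euler {E : Type*} [NormedAddCommGroup E] [NormedSpace ℝ E] [MeasurableSpace E]
    [BorelSpace E] [SecondCountableTopology E] {b : ℝ≥0 → Ω → E}
    (hb : ∀ t, Measurable[𝓕 t] (b t)) (A : ℝ → E →L[ℝ] E) (h : ℝ≥0) (j : ℕ) :
    Measurable[𝓕 (j * h)] fun ω => euler A (fun t => b t ω) h j := by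
  induction j with
  | zero => exact (hb 0).mono (𝓕.mono (by simp)) le_rfl
  | succ j ih =>
    have hle : (j : ℝ≥0) * h ≤ ((j + 1 : ℕ) : ℝ≥0) * h := by gcongr; simp
    have h1 : Measurable[𝓕 ((j + 1 : ℕ) * h)] fun ω => euler A (fun t => b t ω) h j :=
      ih.mono (𝓕.mono hle) le_rfl
    have h2 : Measurable[𝓕 ((j + 1 : ℕ) * h)] (b (j * h)) := (hb _).mono (𝓕.mono hle) le_rfl
    have h3 := hb ((j + 1 : ℕ) * h)
    exact (h1.add (h3.sub h2)).add (((A (j * h)).measurable.comp h1).const_smul (h : ℝ))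

variable {φ : ℝ → Vec n} {x : Vec n} {W : ℝ≥0 → Ω → Vec n}

lemma IsLimitW.ae_tendsto_euler (hφ : IsFlowD x φ) (hW : IsLimitW φ B P W) :
    ∀ᵐ ω ∂P, ∀ t : ℝ≥0, Tendsto (fun m : ℕ =>
      euler (fun s => linCLM (φ s)) (fun s => B s ω) (t / (m + 1)) (m + 1)) atTop (𝓝 (W t ω)) := by
  filter_upwards [hW] with ω hω t
  exact tendsto_euler hφ.continuousOn_linCLM hω.1 hω.2 t

lemma IsLimitW.isGaussianProcess [IsProbabilityMeasure P] (hB : IsBrownianVec B 𝓕 P)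
    (hφ : IsFlowD x φ)
    (hW : IsLimitW φ B P W) : IsGaussianProcess W P where
  hasGaussianLaw I := by
    have hlim := hW.ae_tendsto_euler hφ
    have hmeas : AEMeasurable (fun ω => I.restrict (W · ω)) P := by
      refine aemeasurable_pi_lambda _ fun t => ?_
      refine aemeasurable_of_tendsto_metrizable_ae atTop (fun m => ?_)
        (hlim.mono fun ω hω => hω t)
      exact ((measurable_euler hB.adapted _ _ _).mono (𝓕.le _) le_rfl).aemeasurable
    -- It suffices to treat one linear functional of finitely many values of W at a time. Each is an
    -- almost sure limit of elements of `valueSpan`, hence centred Gaussian.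
    refine ⟨isGaussian_of_map_eq_gaussianReal fun L => ?_⟩
    set U : ℕ → ℝ≥0 → Ω → Vec n := fun m t ω =>
      euler (fun s => linCLM (φ s)) (fun s => B s ω) (t / (m + 1)) (m + 1) with hU
    have hmem : ∀ m, (fun ω => L (I.restrict (U m · ω))) ∈ valueSpan B := by
      intro m
      have e : (fun ω => L (I.restrict (U m · ω)))
          = ∑ t : I, fun ω => (L.comp (ContinuousLinearMap.single ℝ (fun _ : I => Vec n) t))
              (U m t ω) := by
        ext ω
        rw [Finset.sum_apply, ← L.sum_comp_single]
        rfl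
      rw [e]
      exact Submodule.sum_mem _ fun t _ => clm_mem_valueSpan
        (fun i => euler_mem_valueSpan _ _ _ i)
        (L.comp (ContinuousLinearMap.single ℝ (fun _ : I => Vec n) t)).toLinearMap
    choose v hv using fun m => hB.exists_hasLaw_of_mem_valueSpan (hmem m)
    obtain ⟨v', hv', -⟩ := exists_hasLaw_gaussianReal_of_tendsto
      (Z := fun ω => L (I.restrict (W · ω))) hv (by
        filter_upwards [hlim] with ω hω
        exact (L.continuous.tendsto _).comp (tendsto_pi_nhds.2 fun t => hω t))
    refine ⟨0, v', ?_⟩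
    rw [AEMeasurable.map_map_of_aemeasurable L.continuous.aemeasurable hmeas]
    exact hv'.map_eq

/-- The variances of the Euler scheme for the scalar equation `dw = db - a w dt`. -/
def eulerVar (a : ℝ → ℝ) (h : ℝ≥0) : ℕ → ℝ≥0
  | 0 => 0
  | j + 1 => .mk ((1 - h * a (j * h)) ^ 2) (sq_nonneg _) * eulerVar a h j + h

/-- One step multiplies the current value by 1 - ha and adds an independent N(0, h) increment, so
the variances follow the recursion of `eulerVar`. -/
lemma hasLaw_euler_last (hB : IsBrownianVec B 𝓕 P) (i : Fin (n + 1)) (a : ℝ → ℝ) (h : ℝ≥0)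
    (j : ℕ) : HasLaw (fun ω => euler (fun s => (-a s) • ContinuousLinearMap.id ℝ ℝ)
      (fun t => B t ω i) h j) (gaussianReal 0 (eulerVar a h j)) P := by
  have hb : ∀ t, Measurable[𝓕 t] fun ω => B t ω i := fun t =>
    (EuclideanSpace.proj (𝕜 := ℝ) i).measurable.comp (hB.adapted t)
  induction j with
  | zero => exact (hB.coord i).hasLaw_eval 0
  | succ j ih =>
    set A : ℝ → ℝ →L[ℝ] ℝ := fun s => (-a s) • ContinuousLinearMap.id ℝ ℝ with hA
    set Y : Ω → ℝ := fun ω => euler A (fun t => B t ω i) h j with hY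
    have hle : (j : ℝ≥0) * h ≤ ((j + 1 : ℕ) : ℝ≥0) * h := by gcongr; simp
    have hYm : Measurable[𝓕 (j * h)] Y := measurable_euler hb A h j
    set D : Ω → ℝ := fun ω => B ((j + 1 : ℕ) * h) ω i - B (j * h) ω i with hD
    have h1 : HasLaw (fun ω => (1 - h * a (j * h)) * Y ω) (gaussianReal 0
        (.mk ((1 - h * a (j * h)) ^ 2) (sq_nonneg _) * eulerVar a h j)) P := by
      simpa using gaussianReal_const_mul ih (1 - h * a (j * h))
    have h2 : HasLaw D (gaussianReal 0 h) P := by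
      have := (hB.coord i).hasLaw_sub ((j + 1 : ℕ) * h) (j * h)
      have e : nndist ((((j + 1 : ℕ) : ℝ≥0) * h : ℝ≥0) : ℝ) (((j : ℝ≥0) * h : ℝ≥0) : ℝ) = h := by
        rw [← NNReal.coe_inj, coe_nndist, Real.dist_eq, ← NNReal.coe_sub hle, NNReal.abs_eq,
          NNReal.coe_sub hle]
        push_cast
        ring
      rw [← e]
      exact this
    have hind : IndepFun (fun ω => (1 - h * a (j * h)) * Y ω) D P := by
      have hi := (hB.indep_incr _ _ hle).symm
      refine indep_of_indep_of_le_left (indep_of_indep_of_le_right hi ?_) ?_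
      · rintro s ⟨u, hu, rfl⟩
        exact ⟨(EuclideanSpace.proj (𝕜 := ℝ) i) ⁻¹' u,
          (EuclideanSpace.proj (𝕜 := ℝ) i).measurable hu, rfl⟩
      · exact (hYm.const_mul _).comap_le
    have h3 := gaussianReal_add_gaussianReal_of_indepFun hind h1.map_eq h2.map_eq
    rw [add_zero] at h3
    have e : (fun ω => euler A (fun t => B t ω i) h (j + 1))
        = (fun ω => (1 - h * a (j * h)) * Y ω) + D := by
      ext ω
      simp only [euler, Pi.add_apply, hD, hY, hA, _root_.smul_apply,
        ContinuousLinearMap.id_apply, smul_eq_mul]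
      ring
    rw [e]
    exact ⟨h1.aemeasurable.add h2.aemeasurable, h3⟩

/-- A lower bound free of the step size, so that it survives the limit and makes the limit variance
positive. The induction uses (1 - ha)² ≥ 1 - 2hC, and the denominator 1 + 2Ct absorbs the loss 2hC ·
jh in each step because jh ≤ t. -/
lemma le_eulerVar {a : ℝ → ℝ} {h t : ℝ≥0} {C : ℝ} (hC : 0 ≤ C)
    (haC : ∀ s ∈ Icc 0 (t : ℝ), a s ≤ C) (j : ℕ) (hj : j * h ≤ t) :
    (j * h : ℝ) / (1 + 2 * C * t) ≤ eulerVar a h j := by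
  induction j with
  | zero => simp [eulerVar]
  | succ j ih =>
    have hle : (j : ℝ≥0) * h ≤ ((j + 1 : ℕ) : ℝ≥0) * h := by gcongr; simp
    have ih := ih (hle.trans hj)
    have hh : (0 : ℝ) ≤ h := h.2
    have ht : (0 : ℝ) ≤ t := t.2
    have hj1 : ((j : ℝ) + 1) * h ≤ t := by exact_mod_cast hj
    have hj0 : (0 : ℝ) ≤ j * h := by positivity
    have haj := haC (j * h) ⟨hj0, by linarith⟩
    have hv : (0 : ℝ) ≤ eulerVar a h j := (eulerVar a h j).2
    have e : ((eulerVar a h (j + 1) : ℝ≥0) : ℝ)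
        = (1 - h * a (j * h)) ^ 2 * eulerVar a h j + h := by
      simp [eulerVar]
    rw [e]
    set v : ℝ := (eulerVar a h j : ℝ)
    have hD : (0 : ℝ) < 1 + 2 * C * t := by positivity
    have h1 : (1 - 2 * h * C) * v ≤ (1 - h * a (j * h)) ^ 2 * v := by
      have : 1 - 2 * h * C ≤ (1 - h * a (j * h)) ^ 2 := by
        nlinarith [mul_le_mul_of_nonneg_left haj hh, sq_nonneg (h * a (j * h))]
      gcongr
    rw [div_le_iff₀ hD] at ih ⊢
    push_cast
    have h2 : (j * h : ℝ) * (1 - 2 * h * C) + h * (1 + 2 * C * t) ≥ (j + 1) * h := by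
      nlinarith [mul_nonneg (mul_nonneg hC hh) (by linarith : (0 : ℝ) ≤ t - j * h)]
    -- If the factor is nonpositive the induction hypothesis cannot be multiplied by it, but then
    -- the fresh noise h alone exceeds the bound.
    rcases le_total 0 (1 - 2 * h * C) with h3 | h3
    · nlinarith [mul_le_mul_of_nonneg_left ih h3, mul_le_mul_of_nonneg_right h1 hD.le]
    · have h4 : (0 : ℝ) ≤ (1 - h * a (j * h)) ^ 2 * v := by positivity
      have h5 : (j * h : ℝ) * (1 - 2 * h * C) ≤ 0 := mul_nonpos_of_nonneg_of_nonpos hj0 h3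
      nlinarith [mul_nonneg h4 hD.le]

/-- The rate of the scalar equation of the last coordinate. -/
def lastRate (y : Vec n) : ℝ := ∑ j ∈ Finset.univ.erase (Fin.last n), 2 / y j ^ 2

/-- With y_N = 0 the two singular terms have equal denominators y_j², so the coefficients of h_j for
j ≠ N cancel and the last coordinate decouples. -/
lemma linMatrix_mul_last {y : Vec n} (hy : y (Fin.last n) = 0) (h : Vec n) :
    Matrix.toEuclideanLin (linMatrix y) h (Fin.last n) = -lastRate y * h (Fin.last n) := by
  rw [linMatrix_mul_apply, lastRate, ← Finset.sum_neg_distrib, Finset.sum_mul]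
  refine Finset.sum_congr rfl fun j _ => ?_
  rw [hy]
  ring

lemma IsFlowD.continuousOn_lastRate (hφ : IsFlowD x φ) (hx : x (Fin.last n) = 0) :
    ContinuousOn (fun t => lastRate (φ t)) (Ici 0) := by
  refine continuousOn_finsetSum _ fun j hj => ?_
  have hj' : j < Fin.last n := Fin.lt_last_iff_ne_last.2 (Finset.ne_of_mem_erase hj)
  have := hφ.continuousOn
  refine ContinuousOn.div continuousOn_const (by fun_prop) fun t ht => pow_ne_zero 2 ?_
  have h1 := hφ.mem t ht _ _ hj'
  rw [hφ.apply_last hx ht, abs_zero] at h1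
  exact h1.ne'

lemma IsLimitW.exists_hasLaw_last [IsProbabilityMeasure P] (hB : IsBrownianVec B 𝓕 P)
    (hφ : IsFlowD x φ)
    (hx : x (Fin.last n) = 0) (hW : IsLimitW φ B P W) {t : ℝ≥0} (ht : 0 < t) :
    ∃ v : ℝ≥0, v ≠ 0 ∧ HasLaw (fun ω => W t ω (Fin.last n)) (gaussianReal 0 v) P := by
  set a : ℝ → ℝ := fun s => lastRate (φ s) with ha
  have hac : ContinuousOn a (Ici 0) := hφ.continuousOn_lastRate hx
  set A : ℝ → ℝ →L[ℝ] ℝ := fun s => (-a s) • ContinuousLinearMap.id ℝ ℝ with hA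
  have hAc : ContinuousOn A (Ici 0) := hac.neg.smul continuousOn_const
  have hlim : ∀ᵐ ω ∂P, Tendsto (fun m : ℕ => euler A (fun s => B s ω (Fin.last n))
      (t / (m + 1)) (m + 1)) atTop (𝓝 (W t ω (Fin.last n))) := by
    filter_upwards [hW] with ω hω
    have hwc : Continuous fun s => W s ω (Fin.last n) :=
      (EuclideanSpace.proj (𝕜 := ℝ) (Fin.last n)).continuous.comp hω.1
    refine tendsto_euler (w := fun s => W s ω (Fin.last n)) hAc hwc (fun s => ?_) t
    have hint : IntervalIntegrable
        (fun u => Matrix.toEuclideanLin (linMatrix (φ u)) (W u.toNNReal ω)) volume 0 s := by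
      have hc : ContinuousOn (fun u => linCLM (φ u) (W u.toNNReal ω)) (Ici 0) :=
        hφ.continuousOn_linCLM.clm_apply (hω.1.comp continuous_real_toNNReal).continuousOn
      refine (hc.mono ?_).intervalIntegrable
      rw [uIcc_of_le s.coe_nonneg]
      exact Icc_subset_Ici_self
    have h1 := congrArg (fun y : Vec n => y (Fin.last n)) (hω.2 s)
    simp only [PiLp.add_apply] at h1
    rw [intervalIntegral_apply hint] at h1
    rw [h1]
    congr 1
    refine intervalIntegral.integral_congr fun u hu => ?_
    rw [uIcc_of_le s.coe_nonneg] at hu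
    simp only
    rw [linMatrix_mul_last (hφ.apply_last hx hu.1)]
    simp [hA, ha]
  obtain ⟨v, hv, hvl⟩ := exists_hasLaw_gaussianReal_of_tendsto
    (fun m : ℕ => hasLaw_euler_last hB (Fin.last n) a (t / (m + 1)) (m + 1)) hlim
  refine ⟨v, ?_, hv⟩
  obtain ⟨C, hC⟩ := isCompact_Icc.exists_bound_of_continuousOn
    (hac.mono (Icc_subset_Ici_self : Icc 0 (t : ℝ) ⊆ Ici 0))
  have hC0 : 0 ≤ C := (norm_nonneg _).trans (hC 0 ⟨le_rfl, t.2⟩)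
  have hlow : (t : ℝ) / (1 + 2 * C * t) ≤ v := by
    refine ge_of_tendsto' (NNReal.tendsto_coe.2 hvl) fun m => ?_
    have hmt : ((m + 1 : ℕ) : ℝ≥0) * (t / (m + 1)) = t := by
      push_cast
      field_simp
    have hmt' : ((m + 1 : ℕ) : ℝ) * ((t / (m + 1) : ℝ≥0) : ℝ) = t := by exact_mod_cast hmt
    have := le_eulerVar (h := t / (m + 1)) hC0
      (fun s hs => (le_abs_self _).trans (hC s hs)) (m + 1) hmt.le
    rwa [hmt'] at this
  have ht' : (0 : ℝ) < t := ht
  have : (0 : ℝ) < v := lt_of_lt_of_le (by positivity) hlow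
  exact (NNReal.coe_pos.1 this).ne'

lemma hasLaw_abs_halfNormal {Z : Ω → ℝ} {v : ℝ≥0} (hZ : HasLaw Z (gaussianReal 0 v) P) :
    HasLaw (fun ω => |Z ω|) (halfNormal v) P :=
  HasLaw.comp (X := Z) (Y := fun z : ℝ => |z|) ⟨by fun_prop, rfl⟩ hZ

/-- A degenerate Gaussian law would confine Z to two points, contradicting that its law has no
atoms. A non-degenerate one charges the negative half-line, which |Z| avoids. -/
lemma not_hasGaussianLaw_abs [IsProbabilityMeasure P] {Z : Ω → ℝ} {v : ℝ≥0} (hv : v ≠ 0)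
    (hZ : HasLaw Z (gaussianReal 0 v) P) : ¬ HasGaussianLaw (fun ω => |Z ω|) P := by
  intro h
  have hm := h.map_eq_gaussianReal
  set m := P[fun ω => |Z ω|]
  set u := Var[fun ω => |Z ω|; P].toNNReal
  by_cases hu : u = 0
  · rw [hu, gaussianReal_zero_var] at hm
    have hae : ∀ᵐ ω ∂P, |Z ω| = m := HasLaw.ae_eq_of_dirac ⟨h.aemeasurable, hm⟩
    have hae' : ∀ᵐ ω ∂P, Z ω ∈ ({m, -m} : Set ℝ) := by
      filter_upwards [hae] with ω hω
      rcases abs_choice (Z ω) with h1 | h1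
      · left; rw [← h1, hω]
      · right; rw [mem_singleton_iff, ← hω, h1, neg_neg]
    have := nullSingletonClass_gaussianReal (μ := 0) hv
    have h0 : gaussianReal 0 v ({m, -m} : Set ℝ) = 0 := by
      rw [show ({m, -m} : Set ℝ) = {m} ∪ {-m} from rfl]
      exact measure_union_null (measure_singleton _) (measure_singleton _)
    rw [← hZ.map_eq, Measure.map_apply_of_aemeasurable hZ.aemeasurable
      (Set.toFinite _).measurableSet] at h0
    obtain ⟨ω, h1, h2⟩ := (hae'.and (measure_eq_zero_iff_ae_notMem.1 h0)).exists
    exact h2 h1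
  · have h1 : P.map (fun ω => |Z ω|) (Iio 0) = 0 := by
      rw [Measure.map_apply_of_aemeasurable h.aemeasurable measurableSet_Iio]
      have : (fun ω => |Z ω|) ⁻¹' Iio 0 = ∅ := by
        ext ω
        simp
      rw [this, measure_empty]
    rw [hm] at h1
    have h2 := gaussianReal_absolutelyContinuous' m hu h1
    simp at h2

lemma not_hasGaussianLaw_foldLast [IsProbabilityMeasure P] {Y : Ω → Vec n} {v : ℝ≥0} (hv : v ≠ 0)
    (hY : HasLaw (fun ω => Y ω (Fin.last n)) (gaussianReal 0 v) P) :
    ¬ HasGaussianLaw (fun ω => foldLast (Y ω)) P := by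
  intro h
  refine not_hasGaussianLaw_abs hv hY ?_
  have h' := h.map_fun (EuclideanSpace.proj (𝕜 := ℝ) (Fin.last n))
  simpa using h'

end

/-! ### Taylor estimates and the Laplacian for compactly supported functions of class C². -/

section

section Taylor

variable {E : Type*} [NormedAddCommGroup E] [NormedSpace ℝ E] {f : E → ℝ}

lemma hasDerivAt_comp_line (hf : ContDiff ℝ 2 f) (y z : E) (s : ℝ) :
    HasDerivAt (fun s : ℝ => f (y + s • z)) (fderiv ℝ f (y + s • z) z) s := by
  have h1 : HasDerivAt (fun s : ℝ => y + s • z) z s := by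
    simpa using ((hasDerivAt_id s).smul_const z).const_add y
  exact ((hf.differentiable (by norm_num)).differentiableAt.hasFDerivAt).comp_hasDerivAt s h1

lemma hasDerivAt_fderiv_comp_line (hf : ContDiff ℝ 2 f) (y z : E) (s : ℝ) :
    HasDerivAt (fun s : ℝ => fderiv ℝ f (y + s • z) z)
      (fderiv ℝ (fderiv ℝ f) (y + s • z) z z) s := by
  have h1 : HasDerivAt (fun s : ℝ => y + s • z) z s := by
    simpa using ((hasDerivAt_id s).smul_const z).const_add y
  have h2 : ContDiff ℝ 1 (fderiv ℝ f) := hf.fderiv_right (by norm_num)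
  have h3 := ((h2.differentiable (by norm_num)).differentiableAt.hasFDerivAt).comp_hasDerivAt s h1
  exact h3.clm_apply (hasDerivAt_const s z) |>.congr_deriv (by simp)

/-- Taylor's formula of order two, with a bound of the remainder by the oscillation of the second
derivative along the segment. -/
lemma abs_taylor_two_le (hf : ContDiff ℝ 2 f) {y z : E} {K : ℝ}
    (hK : ∀ s ∈ Icc (0 : ℝ) 1,
      ‖fderiv ℝ (fderiv ℝ f) (y + s • z) - fderiv ℝ (fderiv ℝ f) y‖ ≤ K) :
    |f (y + z) - f y - fderiv ℝ f y z - 1 / 2 * fderiv ℝ (fderiv ℝ f) y z z| ≤ K * ‖z‖ ^ 2 := by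
  set c := fderiv ℝ (fderiv ℝ f) y z z with hc
  have hK0 : 0 ≤ K := (norm_nonneg (_ : E →L[ℝ] E →L[ℝ] ℝ)).trans (hK 0 ⟨le_rfl, zero_le_one⟩)
  -- The mean value inequality is applied twice: to q, whose derivative is the oscillation of the
  -- second derivative, and then to r, whose derivative is q - q(0).
  set q : ℝ → ℝ := fun s => fderiv ℝ f (y + s • z) z - s * c with hq
  have hqd : ∀ s, HasDerivAt q (fderiv ℝ (fderiv ℝ f) (y + s • z) z z - c) s := fun s =>
    ((hasDerivAt_fderiv_comp_line hf y z s).sub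
      ((hasDerivAt_id s).mul_const c)).congr_deriv (by simp)
  have hq1 : ∀ s ∈ Icc (0 : ℝ) 1, ‖q s - q 0‖ ≤ K * ‖z‖ ^ 2 := by
    intro s hs
    have h1 := norm_image_sub_le_of_norm_deriv_le_segment' (f := q) (a := 0) (b := 1)
      (C := K * ‖z‖ ^ 2) (fun s _ => (hqd s).hasDerivWithinAt) (fun s hs => by
        rw [hc, ← _root_.sub_apply, ← _root_.sub_apply, Real.norm_eq_abs]
        have h2 := ContinuousLinearMap.le_opNorm₂
          (fderiv ℝ (fderiv ℝ f) (y + s • z) - fderiv ℝ (fderiv ℝ f) y) z z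
        rw [Real.norm_eq_abs] at h2
        refine h2.trans ?_
        have := hK s ⟨hs.1, hs.2.le⟩
        rw [mul_assoc, ← sq]
        gcongr) s hs
    refine h1.trans ?_
    rw [sub_zero]
    exact mul_le_of_le_one_right (by positivity) hs.2
  set r : ℝ → ℝ := fun s => f (y + s • z) - s * fderiv ℝ f y z - s ^ 2 * (1 / 2 * c) with hr
  have hrd : ∀ s, HasDerivAt r (q s - q 0) s := fun s => by
    have h := ((hasDerivAt_comp_line hf y z s).sub ((hasDerivAt_id s).mul_const
      (fderiv ℝ f y z))).sub ((hasDerivAt_pow 2 s).mul_const (1 / 2 * c))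
    refine h.congr_deriv ?_
    simp only [hq, zero_smul, add_zero]
    push_cast
    ring
  have h := norm_image_sub_le_of_norm_deriv_le_segment_01' (f := r) (C := K * ‖z‖ ^ 2)
    (fun s _ => (hrd s).hasDerivWithinAt) (fun s hs => hq1 s ⟨hs.1, hs.2.le⟩)
  rw [Real.norm_eq_abs] at h
  refine le_of_eq_of_le (congrArg _ ?_) h
  simp only [hr, one_smul, zero_smul, add_zero]
  ring

lemma exists_bound_of_compactSupport {E F : Type*} [NormedAddCommGroup E] [NormedAddCommGroup F]
    {g : E → F} (hg : Continuous g) (hc : HasCompactSupport g) : ∃ C, ∀ y, ‖g y‖ ≤ C :=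
  hc.exists_bound_of_continuous hg

lemma exists_modulus_of_compactSupport {E F : Type*} [NormedAddCommGroup E] [NormedSpace ℝ E]
    [NormedAddCommGroup F] [NormedSpace ℝ F] {g : E → E →L[ℝ] F} (hg : Continuous g)
    (hc : HasCompactSupport g) {ε : ℝ}
    (hε : 0 < ε) : ∃ δ > 0, ∀ y z, ‖z‖ < δ → ‖g (y + z) - g y‖ < ε := by
  obtain ⟨δ, hδ, h⟩ := Metric.uniformContinuous_iff.1 (hc.uniformContinuous_of_continuous hg) ε hε
  refine ⟨δ, hδ, fun y z hz => ?_⟩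
  rw [← dist_eq_norm]
  exact h (by simpa [dist_eq_norm] using hz)

lemma continuous_fderiv_fderiv (hf : ContDiff ℝ 2 f) : Continuous (fderiv ℝ (fderiv ℝ f)) := by
  have h1 : ContDiff ℝ 1 (fderiv ℝ f) := hf.fderiv_right (by norm_num)
  exact h1.continuous_fderiv one_ne_zero

lemma hasCompactSupport_fderiv_fderiv (hc : HasCompactSupport f) :
    HasCompactSupport (fderiv ℝ (fderiv ℝ f)) := by
  have k1 : HasCompactSupport (fderiv ℝ f) := hc.fderiv (𝕜 := ℝ)
  exact k1.fderiv (𝕜 := ℝ)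

lemma exists_bound_derivatives (hf : ContDiff ℝ 2 f) (hc : HasCompactSupport f) :
    ∃ C, 0 ≤ C ∧ (∀ y, |f y| ≤ C) ∧ (∀ y, ‖fderiv ℝ f y‖ ≤ C)
      ∧ (∀ y, ‖fderiv ℝ (fderiv ℝ f) y‖ ≤ C) := by
  have e₀ : ∃ C, ∀ y, ‖f y‖ ≤ C := exists_bound_of_compactSupport hf.continuous hc
  have e₁ : ∃ C, ∀ y, ‖fderiv ℝ f y‖ ≤ C := exists_bound_of_compactSupport
    (F := E →L[ℝ] ℝ) (hf.continuous_fderiv two_ne_zero) (hc.fderiv (𝕜 := ℝ))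
  have e₂ : ∃ C, ∀ y, ‖fderiv ℝ (fderiv ℝ f) y‖ ≤ C := exists_bound_of_compactSupport
    (F := E →L[ℝ] E →L[ℝ] ℝ) (continuous_fderiv_fderiv hf) (hasCompactSupport_fderiv_fderiv hc)
  obtain ⟨C₀, h₀⟩ := e₀
  obtain ⟨C₁, h₁⟩ := e₁
  obtain ⟨C₂, h₂⟩ := e₂
  refine ⟨max C₀ (max C₁ C₂), ((norm_nonneg _).trans (h₀ 0)).trans (le_max_left _ _),
    fun y => (h₀ y).trans (le_max_left _ _),
    fun y => (h₁ y).trans ((le_max_left _ _).trans (le_max_right _ _)),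
    fun y => (h₂ y).trans ((le_max_right _ _).trans (le_max_right _ _))⟩

/-- The second order Taylor remainder, for all increments. -/
lemma exists_taylor_two_bound (hf : ContDiff ℝ 2 f) (hc : HasCompactSupport f) {ε : ℝ}
    (hε : 0 < ε) : ∃ D, 0 ≤ D ∧ ∀ y z : E,
      |f (y + z) - f y - fderiv ℝ f y z - 1 / 2 * fderiv ℝ (fderiv ℝ f) y z z|
        ≤ ε * ‖z‖ ^ 2 + D * ‖z‖ ^ 4 := by
  obtain ⟨C, hC, -, -, hC₂⟩ := exists_bound_derivatives hf hc
  have hmod : ∃ δ > 0, ∀ y z : E, ‖z‖ < δ →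
      ‖fderiv ℝ (fderiv ℝ f) (y + z) - fderiv ℝ (fderiv ℝ f) y‖ < ε :=
    exists_modulus_of_compactSupport (F := E →L[ℝ] ℝ) (continuous_fderiv_fderiv hf)
      (hasCompactSupport_fderiv_fderiv hc) hε
  obtain ⟨δ, hδ, hδ'⟩ := hmod
  refine ⟨2 * C / δ ^ 2, by positivity, fun y z => ?_⟩
  by_cases hz : ‖z‖ < δ
  · have h := abs_taylor_two_le hf (y := y) (z := z) (K := ε) fun s hs => by
      refine (hδ' _ _ ?_).le
      rw [norm_smul, Real.norm_of_nonneg hs.1]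
      exact (mul_le_of_le_one_left (norm_nonneg _) hs.2).trans_lt hz
    have : 0 ≤ 2 * C / δ ^ 2 * ‖z‖ ^ 4 := by positivity
    linarith
  -- Large increments: the crude bound 2C‖z‖² is traded for ‖z‖⁴/δ². The fourth moment of a Brownian
  -- increment over time h is O(h²), so this part vanishes when summed over a grid.
  · have h := abs_taylor_two_le hf (y := y) (z := z) (K := 2 * C) fun s _ =>
      (norm_sub_le (_ : E →L[ℝ] E →L[ℝ] ℝ) _).trans
        ((add_le_add (hC₂ _) (hC₂ _)).trans_eq (two_mul C).symm)
    have h2 : 2 * C * ‖z‖ ^ 2 ≤ 2 * C / δ ^ 2 * ‖z‖ ^ 4 := by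
      have h3 : δ ^ 2 ≤ ‖z‖ ^ 2 := by
        have := not_lt.1 hz
        gcongr
      rw [div_mul_eq_mul_div, le_div_iff₀ (by positivity)]
      have : 2 * C * ‖z‖ ^ 4 = 2 * C * ‖z‖ ^ 2 * ‖z‖ ^ 2 := by ring
      rw [this]
      gcongr
    have : 0 ≤ ε * ‖z‖ ^ 2 := by positivity
    linarith

/-- The derivative is taken at v instead of y because in the application y is v plus a Brownian
increment; the Lipschitz bound of Df pays for the difference. -/
lemma abs_sub_sub_fderiv_le (hf : ContDiff ℝ 2 f) {C : ℝ} (hC : 0 ≤ C)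
    (hC₂ : ∀ y, ‖fderiv ℝ (fderiv ℝ f) y‖ ≤ C) (y v a : E) :
    |f (y + a) - f y - fderiv ℝ f v a| ≤ C * (‖y - v‖ + ‖a‖) * ‖a‖ := by
  have h1 : ContDiff ℝ 1 (fderiv ℝ f) := hf.fderiv_right (by norm_num)
  have hlip : ∀ p q, ‖fderiv ℝ f p - fderiv ℝ f q‖ ≤ C * ‖p - q‖ := fun p q =>
    convex_univ.norm_image_sub_le_of_norm_fderiv_le (𝕜 := ℝ)
      (fun x _ => (h1.differentiable (by norm_num)).differentiableAt) (fun x _ => hC₂ x)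
      (mem_univ q) (mem_univ p)
  set r : ℝ → ℝ := fun s => f (y + s • a) - s * fderiv ℝ f v a with hr
  have hrd : ∀ s, HasDerivAt r (fderiv ℝ f (y + s • a) a - fderiv ℝ f v a) s := fun s =>
    ((hasDerivAt_comp_line hf y a s).sub
      ((hasDerivAt_id s).mul_const (fderiv ℝ f v a))).congr_deriv (by simp)
  have h := norm_image_sub_le_of_norm_deriv_le_segment_01' (f := r)
    (C := C * (‖y - v‖ + ‖a‖) * ‖a‖) (fun s _ => (hrd s).hasDerivWithinAt) (fun s hs => by
      rw [← _root_.sub_apply]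
      refine (ContinuousLinearMap.le_opNorm _ _).trans ?_
      gcongr
      refine (hlip _ _).trans ?_
      gcongr
      rw [add_sub_right_comm]
      refine (norm_add_le _ _).trans ?_
      gcongr
      rw [norm_smul, Real.norm_of_nonneg hs.1]
      exact mul_le_of_le_one_left (norm_nonneg _) hs.2.le)
  rw [Real.norm_eq_abs] at h
  refine le_of_eq_of_le (congrArg _ ?_) h
  simp only [hr, one_smul, zero_smul, add_zero]
  ring

/-- Cruder than `abs_sub_sub_fderiv_le`, but linear in ‖a‖ and free of y - v; this provides the
dominating function. -/
lemma abs_sub_sub_fderiv_le' (hf : ContDiff ℝ 2 f) {C : ℝ}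
    (hC₁ : ∀ y, ‖fderiv ℝ f y‖ ≤ C) (y v a : E) :
    |f (y + a) - f y - fderiv ℝ f v a| ≤ 2 * C * ‖a‖ := by
  have h1 : ‖f (y + a) - f y‖ ≤ C * ‖y + a - y‖ :=
    convex_univ.norm_image_sub_le_of_norm_fderiv_le (𝕜 := ℝ)
      (fun x _ => (hf.differentiable (by norm_num)).differentiableAt) (fun x _ => hC₁ x)
      (mem_univ y) (mem_univ (y + a))
  rw [add_sub_cancel_left, Real.norm_eq_abs] at h1
  have h2 : |fderiv ℝ f v a| ≤ C * ‖a‖ :=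
    (ContinuousLinearMap.le_opNorm (fderiv ℝ f v) a).trans (by gcongr; exact hC₁ v)
  have := abs_sub (f (y + a) - f y) (fderiv ℝ f v a)
  linarith

end Taylor

variable {n : ℕ} {f : Vec n → ℝ}

lemma laplacian_eq_sum (y : Vec n) : Laplacian.laplacian f y = ∑ i,
    fderiv ℝ (fderiv ℝ f) y (EuclideanSpace.single i 1) (EuclideanSpace.single i 1) := by
  have h := congrFun (InnerProductSpace.laplacian_eq_iteratedFDeriv_orthonormalBasis f
    (EuclideanSpace.basisFun (Fin (n + 1)) ℝ)) y
  refine h.trans (Finset.sum_congr rfl fun i _ => ?_)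
  rw [iteratedFDeriv_two_apply]
  simp

lemma abs_laplacian_le {C : ℝ} (hC₂ : ∀ y, ‖fderiv ℝ (fderiv ℝ f) y‖ ≤ C) (y : Vec n) :
    |Laplacian.laplacian f y| ≤ (n + 1) * C := by
  rw [laplacian_eq_sum]
  refine (Finset.abs_sum_le_sum_abs _ _).trans
    ((Finset.sum_le_card_nsmul _ _ C fun i _ => ?_).trans (by simp))
  refine (ContinuousLinearMap.le_opNorm₂ (fderiv ℝ (fderiv ℝ f) y) _ _).trans ?_
  simpa using hC₂ y

lemma continuous_laplacian (hf : ContDiff ℝ 2 f) :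
    Continuous (Laplacian.laplacian f : Vec n → ℝ) := by
  have h1 : ContDiff ℝ 1 (fderiv ℝ f) := hf.fderiv_right (by norm_num)
  have h2 := h1.continuous_fderiv (by norm_num)
  have : (Laplacian.laplacian f : Vec n → ℝ) = fun y => ∑ i,
      fderiv ℝ (fderiv ℝ f) y (EuclideanSpace.single i 1) (EuclideanSpace.single i 1) :=
    funext laplacian_eq_sum
  rw [this]
  fun_prop

end

/-! ### Grids and Riemann sums along absolutely continuous paths. -/

section

section Grid

/-- The points of the equidistant grid on `[s, s + d]` with `m + 1` intervals. -/
def grid (s d : ℝ≥0) (m j : ℕ) : ℝ≥0 := s + j * (d / (m + 1))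

variable {s d : ℝ≥0}

@[simp]
lemma grid_zero (m : ℕ) : grid s d m 0 = s := by simp [grid]

@[simp]
lemma grid_last (m : ℕ) : grid s d m (m + 1) = s + d := by
  simp only [grid]
  push_cast
  field_simp

lemma grid_succ (m j : ℕ) : grid s d m (j + 1) = grid s d m j + d / (m + 1) := by
  simp only [grid]
  push_cast
  ring

lemma grid_mono (m : ℕ) : Monotone (grid s d m) := by
  refine monotone_nat_of_le_succ fun j => ?_
  rw [grid_succ]
  exact le_self_add

lemma le_grid (m j : ℕ) : s ≤ grid s d m j := le_self_add

lemma grid_le {m j : ℕ} (hj : j ≤ m + 1) : grid s d m j ≤ s + d := by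
  rw [← grid_last m]
  exact grid_mono m hj

lemma grid_mem_Icc {m j : ℕ} (hj : j ≤ m + 1) :
    (grid s d m j : ℝ) ∈ Icc (s : ℝ) ((s + d : ℝ≥0) : ℝ) :=
  ⟨by exact_mod_cast le_grid m j, by exact_mod_cast grid_le hj⟩

lemma Icc_grid_subset {m j : ℕ} (hj : j < m + 1) :
    Icc (grid s d m j : ℝ) (grid s d m (j + 1)) ⊆ Icc (s : ℝ) ((s + d : ℝ≥0) : ℝ) :=
  Icc_subset_Icc (grid_mem_Icc hj.le).1 (grid_mem_Icc (Nat.succ_le_of_lt hj)).2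

lemma coe_grid_le_succ (m j : ℕ) : (grid s d m j : ℝ) ≤ grid s d m (j + 1) := by
  exact_mod_cast grid_mono m j.le_succ

lemma exists_grid_osc {E : Type*} [SeminormedAddCommGroup E] {q : ℝ → E}
    (hq : ContinuousOn q (Icc (s : ℝ) ((s + d : ℝ≥0) : ℝ))) {η : ℝ} (hη : 0 < η) :
    ∃ m₀ : ℕ, ∀ m ≥ m₀, ∀ j < m + 1, ∀ u ∈ Icc (grid s d m j : ℝ) (grid s d m (j + 1)),
      ‖q u - q (grid s d m j)‖ ≤ η := by
  have huc := isCompact_Icc.uniformContinuousOn_of_continuous hq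
  rw [Metric.uniformContinuousOn_iff_le] at huc
  obtain ⟨δ, hδ, h⟩ := huc η hη
  obtain ⟨m₀, hm₀⟩ := exists_nat_gt ((d : ℝ) / δ)
  refine ⟨m₀, fun m hm j hj u hu => ?_⟩
  rw [← dist_eq_norm]
  refine h _ (Icc_grid_subset hj hu) _ (grid_mem_Icc hj.le) ?_
  rw [Real.dist_eq, abs_of_nonneg (by linarith [hu.1])]
  have h1 : (grid s d m (j + 1) : ℝ) = grid s d m j + d / (m + 1) := by
    rw [grid_succ]
    push_cast
    rfl
  have h2 : (d : ℝ) / (m + 1) ≤ δ := by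
    rw [div_le_iff₀ (by positivity)]
    rw [div_lt_iff₀ hδ] at hm₀
    have : (m₀ : ℝ) ≤ m := by exact_mod_cast hm
    nlinarith
  have := hu.2
  linarith

variable {F : Type*} [NormedAddCommGroup F]

lemma intervalIntegrable_grid {a : ℝ → F}
    (ha : IntervalIntegrable a volume s ((s + d : ℝ≥0) : ℝ)) {m j : ℕ} (hj : j < m + 1) :
    IntervalIntegrable a volume (grid s d m j) (grid s d m (j + 1)) := by
  refine ha.mono_set ?_
  rw [uIcc_of_le (coe_grid_le_succ m j), uIcc_of_le (by simp)]
  exact Icc_grid_subset hj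

variable [NormedSpace ℝ F]

lemma sum_integral_grid {a : ℝ → F} (ha : IntervalIntegrable a volume s ((s + d : ℝ≥0) : ℝ))
    (m : ℕ) : ∑ j ∈ Finset.range (m + 1), ∫ u in (grid s d m j : ℝ)..(grid s d m (j + 1)), a u
      = ∫ u in (s : ℝ)..((s + d : ℝ≥0) : ℝ), a u := by
  have h := intervalIntegral.sum_integral_adjacent_intervals (f := a) (μ := volume)
    (a := fun j => (grid s d m j : ℝ)) (n := m + 1) fun j hj => intervalIntegrable_grid ha hj
  simpa using h

lemma sum_norm_integral_grid_le {a : ℝ → F}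
    (ha : IntervalIntegrable a volume s ((s + d : ℝ≥0) : ℝ)) (m : ℕ) :
    ∑ j ∈ Finset.range (m + 1), ‖∫ u in (grid s d m j : ℝ)..(grid s d m (j + 1)), a u‖
      ≤ ∫ u in (s : ℝ)..((s + d : ℝ≥0) : ℝ), ‖a u‖ := by
  rw [← sum_integral_grid ha.norm m]
  exact Finset.sum_le_sum fun j _ =>
    intervalIntegral.norm_integral_le_integral_norm (coe_grid_le_succ m j)

lemma intervalIntegrable_clm_apply {a : ℝ → F} {b c : ℝ} (hbc : b ≤ c)
    (ha : IntervalIntegrable a volume b c) {g : ℝ → F →L[ℝ] ℝ}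
    (hg : ContinuousOn g (Icc b c)) : IntervalIntegrable (fun u => g u (a u)) volume b c := by
  obtain ⟨C, hC⟩ := isCompact_Icc.exists_bound_of_continuousOn hg
  rw [intervalIntegrable_iff_integrableOn_Icc_of_le hbc] at ha ⊢
  refine (ha.norm.const_mul C).mono' ?_ ?_
  · exact (ContinuousLinearMap.id ℝ (F →L[ℝ] ℝ)).aestronglyMeasurable_comp₂
      (hg.aestronglyMeasurable measurableSet_Icc) ha.aestronglyMeasurable
  · filter_upwards [ae_restrict_mem measurableSet_Icc] with u hu
    refine (ContinuousLinearMap.le_opNorm _ _).trans ?_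
    gcongr
    exact hC u hu

/-- Riemann sums with respect to an absolutely continuous integrator. -/
lemma tendsto_sum_grid [CompleteSpace F] {a : ℝ → F}
    (ha : IntervalIntegrable a volume s ((s + d : ℝ≥0) : ℝ)) {g : ℝ → F →L[ℝ] ℝ}
    (hg : ContinuousOn g (Icc (s : ℝ) ((s + d : ℝ≥0) : ℝ))) :
    Tendsto (fun m : ℕ => ∑ j ∈ Finset.range (m + 1),
      g (grid s d m j) (∫ u in (grid s d m j : ℝ)..(grid s d m (j + 1)), a u)) atTop
      (𝓝 (∫ u in (s : ℝ)..((s + d : ℝ≥0) : ℝ), g u (a u))) := by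
  have hsd : (s : ℝ) ≤ ((s + d : ℝ≥0) : ℝ) := by simp
  have hga := intervalIntegrable_clm_apply hsd ha hg
  set I : ℝ := ∫ u in (s : ℝ)..((s + d : ℝ≥0) : ℝ), ‖a u‖ with hI
  have hI0 : 0 ≤ I := intervalIntegral.integral_nonneg hsd fun _ _ => norm_nonneg _
  rw [Metric.tendsto_atTop]
  intro ε hε
  obtain ⟨m₀, hm₀⟩ := exists_grid_osc hg (η := ε / (I + 1)) (by positivity)
  refine ⟨m₀, fun m hm => ?_⟩
  rw [dist_eq_norm, ← sum_integral_grid hga m, ← Finset.sum_sub_distrib]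
  have hle : ∀ j ∈ Finset.range (m + 1),
      ‖g (grid s d m j) (∫ u in (grid s d m j : ℝ)..(grid s d m (j + 1)), a u)
        - ∫ u in (grid s d m j : ℝ)..(grid s d m (j + 1)), g u (a u)‖
      ≤ ∫ u in (grid s d m j : ℝ)..(grid s d m (j + 1)), ε / (I + 1) * ‖a u‖ := by
    intro j hj
    have hj := Finset.mem_range.1 hj
    have haj := intervalIntegrable_grid ha hj
    rw [← ContinuousLinearMap.intervalIntegral_comp_comm _ haj, ← intervalIntegral.integral_sub
      (intervalIntegrable_clm_apply (coe_grid_le_succ m j) haj continuousOn_const)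
      (intervalIntegrable_grid hga hj)]
    refine intervalIntegral.norm_integral_le_of_norm_le (coe_grid_le_succ m j) ?_
      (haj.norm.const_mul _)
    filter_upwards with u hu
    rw [← _root_.sub_apply]
    refine (ContinuousLinearMap.le_opNorm _ _).trans ?_
    gcongr
    rw [norm_sub_rev]
    exact hm₀ m hm j hj u ⟨hu.1.le, hu.2⟩
  refine (norm_sum_le_of_le _ hle).trans_lt ?_
  rw [sum_integral_grid (ha.norm.const_mul _), intervalIntegral.integral_const_mul, ← hI]
  rw [div_mul_eq_mul_div, div_lt_iff₀ (by positivity)]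
  nlinarith

variable {f : F → ℝ}

/-- Along a path `p = b + ∫ a`, the first order effect of the absolutely continuous part. -/
lemma abs_sum_drift_remainder_le (hf : ContDiff ℝ 2 f) {C : ℝ}
    (hC₁ : ∀ y, ‖fderiv ℝ f y‖ ≤ C) {a b p : ℝ → F}
    (ha : IntervalIntegrable a volume s ((s + d : ℝ≥0) : ℝ))
    (hp : ∀ m, ∀ j < m + 1, p (grid s d m (j + 1)) = p (grid s d m j)
      + (b (grid s d m (j + 1)) - b (grid s d m j))
      + ∫ u in (grid s d m j : ℝ)..(grid s d m (j + 1)), a u) (m : ℕ) (hC : 0 ≤ C) :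
    |∑ j ∈ Finset.range (m + 1), (f (p (grid s d m (j + 1)))
      - f (p (grid s d m j) + (b (grid s d m (j + 1)) - b (grid s d m j)))
      - fderiv ℝ f (p (grid s d m j)) (∫ u in (grid s d m j : ℝ)..(grid s d m (j + 1)), a u))|
      ≤ 2 * C * ∫ u in (s : ℝ)..((s + d : ℝ≥0) : ℝ), ‖a u‖ := by
  refine (Finset.abs_sum_le_sum_abs _ _).trans ?_
  refine le_trans ?_ (mul_le_mul_of_nonneg_left (sum_norm_integral_grid_le ha m)
    (by positivity : 0 ≤ 2 * C))
  rw [Finset.mul_sum]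
  refine Finset.sum_le_sum fun j hj => ?_
  rw [hp m j (Finset.mem_range.1 hj)]
  exact abs_sub_sub_fderiv_le' hf hC₁ _ _ _

/-- Each term is at most C · 2η times the norm of the drift increment, with η bounding the
oscillation of b and of ∫ a on the grid intervals. The sum of these norms is at most ∫ ‖a‖, so
continuity of b and integrability of a suffice. -/
lemma tendsto_sum_drift_remainder [CompleteSpace F] (hf : ContDiff ℝ 2 f) {C : ℝ} (hC : 0 ≤ C)
    (hC₂ : ∀ y, ‖fderiv ℝ (fderiv ℝ f) y‖ ≤ C) {a b p : ℝ → F}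
    (ha : IntervalIntegrable a volume s ((s + d : ℝ≥0) : ℝ))
    (hb : ContinuousOn b (Icc (s : ℝ) ((s + d : ℝ≥0) : ℝ)))
    (hp : ∀ m, ∀ j < m + 1, p (grid s d m (j + 1)) = p (grid s d m j)
      + (b (grid s d m (j + 1)) - b (grid s d m j))
      + ∫ u in (grid s d m j : ℝ)..(grid s d m (j + 1)), a u) :
    Tendsto (fun m : ℕ => ∑ j ∈ Finset.range (m + 1), (f (p (grid s d m (j + 1)))
      - f (p (grid s d m j) + (b (grid s d m (j + 1)) - b (grid s d m j)))
      - fderiv ℝ f (p (grid s d m j)) (∫ u in (grid s d m j : ℝ)..(grid s d m (j + 1)), a u)))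
      atTop (𝓝 0) := by
  have hsd : (s : ℝ) ≤ ((s + d : ℝ≥0) : ℝ) := by simp
  set I : ℝ := ∫ u in (s : ℝ)..((s + d : ℝ≥0) : ℝ), ‖a u‖ with hI
  have hI0 : 0 ≤ I := intervalIntegral.integral_nonneg hsd fun _ _ => norm_nonneg _
  have hca : ContinuousOn (fun t => ∫ u in (s : ℝ)..t, a u)
      (Icc (s : ℝ) ((s + d : ℝ≥0) : ℝ)) := by
    have := intervalIntegral.continuousOn_primitive_interval' ha left_mem_uIcc
    rwa [uIcc_of_le hsd] at this
  rw [Metric.tendsto_atTop]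
  intro ε hε
  set η : ℝ := ε / (2 * C * I + 1) with hη
  have hη0 : 0 < η := by positivity
  obtain ⟨m₁, hm₁⟩ := exists_grid_osc hb hη0
  obtain ⟨m₂, hm₂⟩ := exists_grid_osc hca hη0
  refine ⟨max m₁ m₂, fun m hm => ?_⟩
  rw [Real.dist_eq, sub_zero]
  refine (Finset.abs_sum_le_sum_abs _ _).trans_lt ?_
  have hle : ∀ j ∈ Finset.range (m + 1), |f (p (grid s d m (j + 1)))
      - f (p (grid s d m j) + (b (grid s d m (j + 1)) - b (grid s d m j)))
      - fderiv ℝ f (p (grid s d m j)) (∫ u in (grid s d m j : ℝ)..(grid s d m (j + 1)), a u)|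
      ≤ C * (2 * η) * ‖∫ u in (grid s d m j : ℝ)..(grid s d m (j + 1)), a u‖ := by
    intro j hj
    have hj := Finset.mem_range.1 hj
    have hmem : (grid s d m (j + 1) : ℝ) ∈ Icc (grid s d m j : ℝ) (grid s d m (j + 1)) :=
      right_mem_Icc.2 (coe_grid_le_succ m j)
    have h1 := hm₁ m ((le_max_left _ _).trans hm) j hj _ hmem
    have h2 := hm₂ m ((le_max_right _ _).trans hm) j hj _ hmem
    have hs0 : IntervalIntegrable a volume s (grid s d m j) := by
      refine ha.mono_set ?_
      rw [uIcc_of_le hsd, uIcc_of_le (grid_mem_Icc hj.le).1]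
      exact Icc_subset_Icc_right (grid_mem_Icc hj.le).2
    have h3 := intervalIntegral.integral_add_adjacent_intervals hs0 (intervalIntegrable_grid ha hj)
    rw [← h3, add_sub_cancel_left] at h2
    rw [hp m j hj]
    refine (abs_sub_sub_fderiv_le hf hC hC₂ _ _ _).trans ?_
    gcongr
    rw [add_sub_cancel_left]
    linarith
  refine (Finset.sum_le_sum hle).trans_lt ?_
  rw [← Finset.mul_sum]
  have h4 := sum_norm_integral_grid_le ha m
  calc C * (2 * η) * ∑ j ∈ Finset.range (m + 1),
        ‖∫ u in (grid s d m j : ℝ)..(grid s d m (j + 1)), a u‖ ≤ C * (2 * η) * I := by gcongr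
    _ = ε * (2 * C * I / (2 * C * I + 1)) := by rw [hη]; ring
    _ < ε * 1 := by
      gcongr
      rw [div_lt_one (by positivity)]
      linarith
    _ = ε := mul_one ε

end Grid

/-! ### Moments and independence of Brownian increments. -/

section Increments

variable {P : Measure Ω} {𝓕 : Filtration ℝ≥0 mΩ} {n : ℕ} {B : ℝ≥0 → Ω → Vec n}

lemma IsBrownianVec.hasLaw_increment (hB : IsBrownianVec B 𝓕 P) (i : Fin (n + 1)) (u h : ℝ≥0) :
    HasLaw (fun ω => (B (u + h) ω - B u ω) i) (gaussianReal 0 h) P := by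
  have := (hB.coord i).hasLaw_sub (u + h) u
  have e : nndist ((u + h : ℝ≥0) : ℝ) (u : ℝ) = h := by
    rw [← NNReal.coe_inj, coe_nndist, Real.dist_eq]
    simp
  have e' : gaussianReal 0 h = gaussianReal 0 (nndist ((u + h : ℝ≥0) : ℝ) (u : ℝ)) := by rw [e]
  exact e' ▸ this

lemma IsBrownianVec.indepFun_increment (hB : IsBrownianVec B 𝓕 P) {u v : ℝ≥0} (huv : u ≤ v)
    {G : Ω → ℝ} (hG : Measurable[𝓕 u] G) {g : Vec n → ℝ} (hg : Measurable g) :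
    IndepFun G (fun ω => g (B v ω - B u ω)) P := by
  have hi := (hB.indep_incr _ _ huv).symm
  refine indep_of_indep_of_le_left (indep_of_indep_of_le_right hi ?_) hG.comap_le
  rintro s ⟨w, hw, rfl⟩
  exact ⟨g ⁻¹' w, hg hw, rfl⟩

lemma IsBrownianVec.memLp_increment (hB : IsBrownianVec B 𝓕 P) (i : Fin (n + 1)) (u h : ℝ≥0) :
    MemLp (fun ω => (B (u + h) ω - B u ω) i) 4 P :=
  (hB.hasLaw_increment i u h).hasGaussianLaw.memLp (by norm_num)

lemma IsBrownianVec.integral_increment (hB : IsBrownianVec B 𝓕 P) (i : Fin (n + 1)) (u h : ℝ≥0) :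
    ∫ ω, (B (u + h) ω - B u ω) i ∂P = 0 := by
  rw [(hB.hasLaw_increment i u h).integral_eq, integral_id_gaussianReal]

lemma IsBrownianVec.integral_increment_mul [IsProbabilityMeasure P] (hB : IsBrownianVec B 𝓕 P)
    (i j : Fin (n + 1))
    (u h : ℝ≥0) : ∫ ω, (B (u + h) ω - B u ω) i * (B (u + h) ω - B u ω) j ∂P
      = if i = j then (h : ℝ) else 0 := by
  have hL := fun i => hB.hasLaw_increment i u h
  split_ifs with hij
  · subst hij
    have h1 := (hL i).variance_eq
    rw [variance_id_gaussianReal, variance_of_integral_eq_zero (hL i).aemeasurable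
      (hB.integral_increment i u h)] at h1
    rw [← h1]
    simp only [sq]
  · have hind : IndepFun (fun ω => (B (u + h) ω - B u ω) i) (fun ω => (B (u + h) ω - B u ω) j) P :=
      (hB.indep_coord.indepFun hij).comp (φ := fun g : ℝ≥0 → ℝ => g (u + h) - g u)
        (ψ := fun g : ℝ≥0 → ℝ => g (u + h) - g u) (by fun_prop) (by fun_prop)
    rw [hind.integral_fun_mul_eq_mul_integral (hL i).aemeasurable.aestronglyMeasurable
      (hL j).aemeasurable.aestronglyMeasurable]
    rw [hB.integral_increment i u h, zero_mul]

/-- The fourth moment of the standard normal distribution. -/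
def fourthMoment : ℝ := ∫ x, x ^ 4 ∂(gaussianReal 0 1)

/-- By scaling with √h; only the order h² matters, not the value of the constant. -/
lemma IsBrownianVec.integral_increment_pow_four (hB : IsBrownianVec B 𝓕 P) (i : Fin (n + 1))
    (u h : ℝ≥0) : ∫ ω, (B (u + h) ω - B u ω) i ^ 4 ∂P = h ^ 2 * fourthMoment := by
  have h1 := (hB.hasLaw_increment i u h).integral_comp (f := fun x : ℝ => x ^ 4) (by fun_prop)
  have h2 : gaussianReal 0 h = (gaussianReal 0 1).map (√h * ·) := by
    rw [gaussianReal_map_const_mul]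
    congr 1
    · simp
    · rw [← NNReal.coe_inj]
      simp
  rw [h2, integral_map (by fun_prop) (by fun_prop)] at h1
  refine h1.trans ?_
  simp only [mul_pow]
  rw [integral_const_mul, fourthMoment]
  congr 1
  rw [show √(h : ℝ) ^ 4 = (√(h : ℝ) ^ 2) ^ 2 by ring, Real.sq_sqrt h.coe_nonneg]

lemma norm_pow_four_le (z : Vec n) : ‖z‖ ^ 4 ≤ (n + 1) * ∑ i, z i ^ 4 := by
  have h := sq_sum_le_card_mul_sum_sq (s := Finset.univ) (f := fun i => z i ^ 2)
  rw [← EuclideanSpace.real_norm_sq_eq] at h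
  calc ‖z‖ ^ 4 = (‖z‖ ^ 2) ^ 2 := by ring
    _ ≤ _ := h
    _ = _ := by simp [← pow_mul]

lemma IsBrownianVec.integrable_increment_pow_four [IsProbabilityMeasure P]
    (hB : IsBrownianVec B 𝓕 P) (i : Fin (n + 1))
    (u h : ℝ≥0) : Integrable (fun ω => (B (u + h) ω - B u ω) i ^ 4) P := by
  have h1 := (hB.memLp_increment i u h).integrable_norm_pow (by norm_num : (4 : ℕ) ≠ 0)
  refine h1.congr (Filter.Eventually.of_forall fun ω => ?_)
  simp only [Real.norm_eq_abs]
  exact Even.pow_abs (by decide) _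

lemma IsBrownianVec.integrable_increment_mul (hB : IsBrownianVec B 𝓕 P) (i j : Fin (n + 1))
    (u h : ℝ≥0) :
    Integrable (fun ω => (B (u + h) ω - B u ω) i * (B (u + h) ω - B u ω) j) P :=
  MemLp.integrable_mul (p := 2) (q := 2)
    ((hB.hasLaw_increment i u h).hasGaussianLaw.memLp (by norm_num))
    ((hB.hasLaw_increment j u h).hasGaussianLaw.memLp (by norm_num))

lemma IsBrownianVec.integral_taylor_bound_le [IsProbabilityMeasure P] (hB : IsBrownianVec B 𝓕 P)
    (u h : ℝ≥0) (ε D : ℝ) :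
    Integrable (fun ω => ε * ‖B (u + h) ω - B u ω‖ ^ 2 + D * ((n + 1) *
      ∑ i, (B (u + h) ω - B u ω) i ^ 4)) P ∧
    ∫ ω, (ε * ‖B (u + h) ω - B u ω‖ ^ 2 + D * ((n + 1) * ∑ i, (B (u + h) ω - B u ω) i ^ 4)) ∂P
      = ε * (n + 1) * h + D * (n + 1) ^ 2 * fourthMoment * h ^ 2 := by
  have e2 : ∀ ω, ‖B (u + h) ω - B u ω‖ ^ 2
      = ∑ i, (B (u + h) ω - B u ω) i * (B (u + h) ω - B u ω) i := fun ω => by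
    rw [EuclideanSpace.real_norm_sq_eq]
    simp only [sq]
  have i2 : Integrable (fun ω => ε * ‖B (u + h) ω - B u ω‖ ^ 2) P := by
    simp only [e2]
    exact (integrable_finsetSum _ fun i _ => hB.integrable_increment_mul i i u h).const_mul _
  have i4 : Integrable (fun ω => D * ((n + 1) * ∑ i, (B (u + h) ω - B u ω) i ^ 4)) P :=
    ((integrable_finsetSum _ fun i _ => hB.integrable_increment_pow_four i u h).const_mul
      _).const_mul _
  refine ⟨i2.add i4, ?_⟩
  rw [integral_add i2 i4, integral_const_mul, integral_const_mul, integral_const_mul,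
    integral_finsetSum _ fun i _ => hB.integrable_increment_pow_four i u h]
  simp only [e2]
  rw [integral_finsetSum _ fun i _ => hB.integrable_increment_mul i i u h]
  simp only [hB.integral_increment_mul, hB.integral_increment_pow_four, if_true,
    Finset.sum_const, Finset.card_univ, Fintype.card_fin, nsmul_eq_mul]
  push_cast
  ring

end Increments

end

/-! ### One Brownian step of Itô's formula. -/

section

section Step

variable {P : Measure Ω} {𝓕 : Filtration ℝ≥0 mΩ} {n : ℕ} {B : ℝ≥0 → Ω → Vec n}

lemma sum_smul_single (z : Vec n) : ∑ i, z i • EuclideanSpace.single i (1 : ℝ) = z := by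
  simpa using (EuclideanSpace.basisFun (Fin (n + 1)) ℝ).sum_repr z

lemma clm_apply_eq_sum (L : Vec n →L[ℝ] ℝ) (z : Vec n) :
    L z = ∑ i, L (EuclideanSpace.single i 1) * z i := by
  conv_lhs => rw [← sum_smul_single z]
  rw [map_sum]
  exact Finset.sum_congr rfl fun i _ => by rw [map_smul, smul_eq_mul, mul_comm]

lemma clm_apply_apply_eq_sum (L : Vec n →L[ℝ] Vec n →L[ℝ] ℝ) (z : Vec n) :
    L z z = ∑ i, ∑ j, L (EuclideanSpace.single j 1) (EuclideanSpace.single i 1) * (z j * z i) := by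
  rw [clm_apply_eq_sum (L z)]
  refine Finset.sum_congr rfl fun i _ => ?_
  have h := clm_apply_eq_sum (L.flip (EuclideanSpace.single i 1)) z
  simp only [ContinuousLinearMap.flip_apply] at h
  rw [h, Finset.sum_mul]
  exact Finset.sum_congr rfl fun j _ => mul_assoc _ _ _

lemma IsBrownianVec.measurable_increment (hB : IsBrownianVec B 𝓕 P) (u v : ℝ≥0) :
    Measurable fun ω => B v ω - B u ω :=
  (((hB.adapted v).mono (𝓕.le v) le_rfl)).sub (((hB.adapted u).mono (𝓕.le u) le_rfl))

/-- The indicator of F is absorbed into G, which stays measurable at time u and therefore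
independent of the increment. -/
lemma IsBrownianVec.setIntegral_mul_increment (hB : IsBrownianVec B 𝓕 P) {u v : ℝ≥0} (huv : u ≤ v)
    {F : Set Ω} (hF : MeasurableSet[𝓕 u] F) {G : Ω → ℝ} (hG : Measurable[𝓕 u] G)
    {g : Vec n → ℝ} (hg : Measurable g) :
    ∫ ω in F, G ω * g (B v ω - B u ω) ∂P
      = (∫ ω in F, G ω ∂P) * ∫ ω, g (B v ω - B u ω) ∂P := by
  have hFm := 𝓕.le u F hF
  have hI : Measurable[𝓕 u] (F.indicator G) := hG.indicator hF
  rw [← integral_indicator hFm, ← integral_indicator hFm,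
    ← (hB.indepFun_increment huv hI hg).integral_fun_mul_eq_mul_integral
      (hI.mono (𝓕.le u) le_rfl).aestronglyMeasurable
      (hg.comp (hB.measurable_increment u v)).aestronglyMeasurable]
  refine integral_congr_ae (Eventually.of_forall fun ω => ?_)
  by_cases h : ω ∈ F <;> simp [h]

/-- One step of Itô's formula. -/
lemma IsBrownianVec.abs_setIntegral_step_le [IsProbabilityMeasure P] (hB : IsBrownianVec B 𝓕 P)
    {f : Vec n → ℝ}
    (hf : ContDiff ℝ 2 f) {C : ℝ} (hC₁ : ∀ y, ‖fderiv ℝ f y‖ ≤ C)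
    (hC₂ : ∀ y, ‖fderiv ℝ (fderiv ℝ f) y‖ ≤ C) {ε D : ℝ} (hD : 0 ≤ D)
    (hT : ∀ y z : Vec n,
      |f (y + z) - f y - fderiv ℝ f y z - 1 / 2 * fderiv ℝ (fderiv ℝ f) y z z|
        ≤ ε * ‖z‖ ^ 2 + D * ‖z‖ ^ 4) {u h : ℝ≥0} {F : Set Ω} (hF : MeasurableSet[𝓕 u] F)
    {Y : Ω → Vec n} (hY : Measurable[𝓕 u] Y) :
    |∫ ω in F, (f (Y ω + (B (u + h) ω - B u ω)) - f (Y ω)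
        - 1 / 2 * h * Laplacian.laplacian f (Y ω)) ∂P|
      ≤ ε * (n + 1) * h + D * (n + 1) ^ 2 * fourthMoment * h ^ 2 := by
  have huh : u ≤ u + h := le_self_add
  have hFm := 𝓕.le u F hF
  have hYm : Measurable Y := hY.mono (𝓕.le u) le_rfl
  have hZm := hB.measurable_increment u (u + h)
  set Z : Ω → Vec n := fun ω => B (u + h) ω - B u ω with hZ
  set e : Fin (n + 1) → Vec n := fun i => EuclideanSpace.single i 1 with he
  have hen : ∀ i, ‖e i‖ = 1 := fun i => by simp [he]
  have hd1 : Continuous (fderiv ℝ f) := hf.continuous_fderiv two_ne_zero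
  have hd2 := continuous_fderiv_fderiv hf
  -- first order
  have hc1 : ∀ i, Continuous fun y => fderiv ℝ f y (e i) := fun i => hd1.clm_apply continuous_const
  have hG1 : ∀ i, Measurable[𝓕 u] fun ω => fderiv ℝ f (Y ω) (e i) := fun i =>
    (hc1 i).measurable.comp hY
  have hb1 : ∀ i ω, |fderiv ℝ f (Y ω) (e i)| ≤ C := fun i ω =>
    (ContinuousLinearMap.le_opNorm (fderiv ℝ f (Y ω)) _).trans (by simpa [hen] using hC₁ (Y ω))
  have hi1 : ∀ i, Integrable (fun ω => Z ω i) P := fun i =>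
    (hB.memLp_increment i u h).integrable (by norm_num)
  have hint1 : ∀ i, Integrable (fun ω => fderiv ℝ f (Y ω) (e i) * Z ω i) P := fun i =>
    (hi1 i).bdd_mul (c := C) ((hG1 i).mono (𝓕.le u) le_rfl).aestronglyMeasurable
      (Eventually.of_forall (hb1 i))
  have hI1 : Integrable (fun ω => fderiv ℝ f (Y ω) (Z ω)) P := by
    simp only [fun ω => clm_apply_eq_sum (fderiv ℝ f (Y ω)) (Z ω)]
    exact integrable_finsetSum _ fun i _ => hint1 i
  have hv1 : ∫ ω in F, fderiv ℝ f (Y ω) (Z ω) ∂P = 0 := by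
    simp only [fun ω => clm_apply_eq_sum (fderiv ℝ f (Y ω)) (Z ω)]
    rw [integral_finsetSum _ fun i _ => (hint1 i).integrableOn]
    refine Finset.sum_eq_zero fun i _ => ?_
    rw [hB.setIntegral_mul_increment huh hF (hG1 i) (g := fun z => z i) (by fun_prop),
      hB.integral_increment, mul_zero]
  -- second order
  have hc2 : ∀ i j, Continuous fun y => fderiv ℝ (fderiv ℝ f) y (e j) (e i) := fun i j =>
    (hd2.clm_apply continuous_const).clm_apply continuous_const
  have hG2 : ∀ i j, Measurable[𝓕 u] fun ω => fderiv ℝ (fderiv ℝ f) (Y ω) (e j) (e i) :=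
    fun i j => (hc2 i j).measurable.comp hY
  have hb2 : ∀ i j ω, |fderiv ℝ (fderiv ℝ f) (Y ω) (e j) (e i)| ≤ C := fun i j ω =>
    (ContinuousLinearMap.le_opNorm₂ (fderiv ℝ (fderiv ℝ f) (Y ω)) _ _).trans
      (by simpa [hen] using hC₂ (Y ω))
  have hint2 : ∀ i j, Integrable
      (fun ω => fderiv ℝ (fderiv ℝ f) (Y ω) (e j) (e i) * (Z ω j * Z ω i)) P := fun i j =>
    (hB.integrable_increment_mul j i u h).bdd_mul (c := C)
      ((hG2 i j).mono (𝓕.le u) le_rfl).aestronglyMeasurable (Eventually.of_forall (hb2 i j))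
  have hI2 : Integrable (fun ω => fderiv ℝ (fderiv ℝ f) (Y ω) (Z ω) (Z ω)) P := by
    simp only [fun ω => clm_apply_apply_eq_sum (fderiv ℝ (fderiv ℝ f) (Y ω)) (Z ω)]
    exact integrable_finsetSum _ fun i _ => integrable_finsetSum _ fun j _ => hint2 i j
  have hcL := continuous_laplacian hf
  have hIL : Integrable (fun ω => Laplacian.laplacian f (Y ω)) P :=
    Integrable.of_bound (hcL.measurable.comp hYm).aestronglyMeasurable ((n + 1) * C)
      (Eventually.of_forall fun ω => abs_laplacian_le hC₂ (Y ω))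
  have hv2 : ∫ ω in F, fderiv ℝ (fderiv ℝ f) (Y ω) (Z ω) (Z ω) ∂P
      = h * ∫ ω in F, Laplacian.laplacian f (Y ω) ∂P := by
    have hr : ∀ i j, Integrable (fun ω => fderiv ℝ (fderiv ℝ f) (Y ω) (e j) (e i)) P := fun i j =>
      Integrable.of_bound ((hG2 i j).mono (𝓕.le u) le_rfl).aestronglyMeasurable C
        (Eventually.of_forall (hb2 i j))
    simp only [fun ω => clm_apply_apply_eq_sum (fderiv ℝ (fderiv ℝ f) (Y ω)) (Z ω),
      laplacian_eq_sum]
    rw [integral_finsetSum _ fun i _ =>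
        (integrable_finsetSum _ fun j _ => hint2 i j).integrableOn,
      integral_finsetSum _ fun i _ => (hr i i).integrableOn, Finset.mul_sum]
    refine Finset.sum_congr rfl fun i _ => ?_
    rw [integral_finsetSum _ fun j _ => (hint2 i j).integrableOn]
    -- Since E[Z_j Z_i] is h on the diagonal and 0 off it, only the trace of the second derivative
    -- remains, which is the Laplacian.
    have : ∀ j, ∫ ω in F, fderiv ℝ (fderiv ℝ f) (Y ω) (e j) (e i) * (Z ω j * Z ω i) ∂P
        = if j = i then h * ∫ ω in F, fderiv ℝ (fderiv ℝ f) (Y ω) (e j) (e i) ∂P else 0 := by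
      intro j
      rw [hB.setIntegral_mul_increment huh hF (hG2 i j) (g := fun z => z j * z i) (by fun_prop),
        hB.integral_increment_mul]
      split_ifs
      · rw [mul_comm]
      · rw [mul_zero]
    rw [Finset.sum_congr rfl fun j _ => this j, Finset.sum_ite_eq' Finset.univ i]
    simp [he]
  -- remainder
  obtain ⟨hgi, hgv⟩ := hB.integral_taylor_bound_le u h ε D
  set T : Ω → ℝ := fun ω => f (Y ω + Z ω) - f (Y ω) - fderiv ℝ f (Y ω) (Z ω)
    - 1 / 2 * fderiv ℝ (fderiv ℝ f) (Y ω) (Z ω) (Z ω) with hTd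
  have hTle : ∀ ω, ‖T ω‖ ≤ ε * ‖Z ω‖ ^ 2 + D * ((n + 1) * ∑ i, Z ω i ^ 4) := fun ω =>
    (hT _ _).trans (by gcongr; exact norm_pow_four_le _)
  have hTm : AEStronglyMeasurable T P :=
    (((hf.continuous.measurable.comp (hYm.add hZm)).sub
      (hf.continuous.measurable.comp hYm)).aestronglyMeasurable.sub hI1.aestronglyMeasurable).sub
      (hI2.aestronglyMeasurable.const_mul _)
  have hTi : Integrable T P := hgi.mono' hTm (Eventually.of_forall hTle)
  have hdec : ∀ ω, f (Y ω + (B (u + h) ω - B u ω)) - f (Y ω)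
        - 1 / 2 * h * Laplacian.laplacian f (Y ω)
      = T ω + (fderiv ℝ f (Y ω) (Z ω) + (1 / 2 * fderiv ℝ (fderiv ℝ f) (Y ω) (Z ω) (Z ω)
        - 1 / 2 * h * Laplacian.laplacian f (Y ω))) := fun ω => by
    simp only [hTd, hZ]
    ring
  simp only [hdec]
  have hI2' := hI2.const_mul (1 / 2)
  have hIL' := hIL.const_mul (1 / 2 * (h : ℝ))
  have hq : Integrable (fun ω => 1 / 2 * fderiv ℝ (fderiv ℝ f) (Y ω) (Z ω) (Z ω)
      - 1 / 2 * h * Laplacian.laplacian f (Y ω)) P := hI2'.sub hIL'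
  have hp : Integrable (fun ω => fderiv ℝ f (Y ω) (Z ω)
      + (1 / 2 * fderiv ℝ (fderiv ℝ f) (Y ω) (Z ω) (Z ω)
        - 1 / 2 * h * Laplacian.laplacian f (Y ω))) P := hI1.add hq
  rw [integral_add hTi.integrableOn hp.integrableOn, integral_add hI1.integrableOn hq.integrableOn,
    integral_sub hI2'.integrableOn hIL'.integrableOn, integral_const_mul, integral_const_mul,
    hv1, hv2]
  rw [show ∀ p q : ℝ, p + (0 + (1 / 2 * (h * q) - 1 / 2 * h * q)) = p from fun p q => by ring]
  calc |∫ ω in F, T ω ∂P| ≤ ∫ ω in F, ‖T ω‖ ∂P := by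
        rw [← Real.norm_eq_abs]
        exact norm_integral_le_integral_norm _
    _ ≤ ∫ ω, ‖T ω‖ ∂P :=
        setIntegral_le_integral hTi.norm (Eventually.of_forall fun ω => norm_nonneg _)
    _ ≤ _ := (integral_mono hTi.norm hgi hTle).trans hgv.le

end Step

end

/-! ### Processes with drift: Riemann sums for the finite variation part of Itô's formula. -/

section

section Dynkin

variable {P : Measure Ω} {𝓕 : Filtration ℝ≥0 mΩ} {n : ℕ} {B X : ℝ≥0 → Ω → Vec n}

lemma IsBrownianVec.ae_continuous (hB : IsBrownianVec B 𝓕 P) :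
    ∀ᵐ ω ∂P, Continuous fun t => B t ω := by
  filter_upwards [ae_all_iff.2 fun i => (hB.coord i).cont] with ω hω
  exact (PiLp.continuous_toLp 2 _).comp (continuous_pi hω)

/-- `X` is an adapted continuous process with `dX = dB + a dt`, the drift being dominated on every
compact time interval by an integrable random variable. -/
structure HasDrift (B : ℝ≥0 → Ω → Vec n) (𝓕 : Filtration ℝ≥0 mΩ) (P : Measure Ω)
    (a : ℝ → Ω → Vec n) (X : ℝ≥0 → Ω → Vec n) : Prop where
  adapted : ∀ t, Measurable[𝓕 t] (X t)
  cont : ∀ᵐ ω ∂P, Continuous fun t => X t ω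
  integrable : ∀ᵐ ω ∂P, ∀ t : ℝ≥0, IntervalIntegrable (fun u => a u ω) volume 0 t
  eq : ∀ᵐ ω ∂P, ∀ s t : ℝ≥0, s ≤ t →
    X t ω = X s ω + (B t ω - B s ω) + ∫ u in (s : ℝ)..t, a u ω
  dominated : ∀ t : ℝ≥0, ∃ V : Ω → ℝ, Integrable V P ∧
    ∀ᵐ ω ∂P, ∫ u in (0 : ℝ)..t, ‖a u ω‖ ≤ V ω

/-- The Riemann sum for `∫ (½ Δf(X_u) du + Df(X_u) d(X - B)_u)` on `[s, s + d]`. -/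
def itoSum (f : Vec n → ℝ) (B X : ℝ≥0 → Ω → Vec n) (s d : ℝ≥0) (m : ℕ) (ω : Ω) : ℝ :=
  ∑ j ∈ Finset.range (m + 1),
    (1 / 2 * ((d / (m + 1) : ℝ≥0) : ℝ) * Laplacian.laplacian f (X (grid s d m j) ω)
      + fderiv ℝ f (X (grid s d m j) ω) (X (grid s d m (j + 1)) ω - X (grid s d m j) ω
        - (B (grid s d m (j + 1)) ω - B (grid s d m j) ω)))

variable {f : Vec n → ℝ} {a : ℝ → Ω → Vec n} {s d : ℝ≥0}

/-- `itoSum` is written with increments of X - B rather than with integrals of a precisely for this: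
adaptedness then needs no measurability of a in ω. -/
lemma measurable_itoSum (hf : ContDiff ℝ 2 f) (hB : ∀ t, Measurable[𝓕 t] (B t))
    (hX : ∀ t, Measurable[𝓕 t] (X t)) (m : ℕ) :
    Measurable[𝓕 (s + d)] (itoSum f B X s d m) := by
  have hBm : ∀ j ≤ m + 1, Measurable[𝓕 (s + d)] (B (grid s d m j)) := fun j hj =>
    (hB _).mono (𝓕.mono (grid_le hj)) le_rfl
  have hXm : ∀ j ≤ m + 1, Measurable[𝓕 (s + d)] (X (grid s d m j)) := fun j hj =>
    (hX _).mono (𝓕.mono (grid_le hj)) le_rfl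
  have hc : Continuous fun p : Vec n × Vec n => fderiv ℝ f p.1 p.2 :=
    ((hf.continuous_fderiv two_ne_zero).comp continuous_fst).clm_apply continuous_snd
  refine Finset.measurable_fun_sum _ fun j hj => ?_
  have hj := Finset.mem_range.1 hj
  have h1 := hXm j hj.le
  have h2 := hXm (j + 1) hj
  have h3 := hBm j hj.le
  have h4 := hBm (j + 1) hj
  refine ((((continuous_laplacian hf).measurable.comp h1)).const_mul _).add ?_
  exact hc.measurable.comp (h1.prodMk ((h2.sub h1).sub (h4.sub h3)))

lemma itoSum_eq {ω : Ω} {α : ℝ → Vec n}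
    (hp : ∀ s t : ℝ≥0, s ≤ t → X t ω = X s ω + (B t ω - B s ω) + ∫ u in (s : ℝ)..t, α u) (m : ℕ) :
    itoSum f B X s d m ω = ∑ j ∈ Finset.range (m + 1),
        1 / 2 * ((d / (m + 1) : ℝ≥0) : ℝ) * Laplacian.laplacian f (X (grid s d m j) ω)
      + ∑ j ∈ Finset.range (m + 1), fderiv ℝ f (X (grid s d m j) ω)
          (∫ u in (grid s d m j : ℝ)..(grid s d m (j + 1)), α u) := by
  rw [itoSum, Finset.sum_add_distrib]
  congr 1
  refine Finset.sum_congr rfl fun j _ => ?_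
  rw [hp _ _ (grid_mono m j.le_succ)]
  congr 1
  abel

lemma abs_itoSum_le {C : ℝ} (hC₁ : ∀ y, ‖fderiv ℝ f y‖ ≤ C)
    (hC₂ : ∀ y, ‖fderiv ℝ (fderiv ℝ f) y‖ ≤ C) (hC : 0 ≤ C) {ω : Ω} {α : ℝ → Vec n}
    (hα : IntervalIntegrable α volume s ((s + d : ℝ≥0) : ℝ))
    (hp : ∀ s t : ℝ≥0, s ≤ t → X t ω = X s ω + (B t ω - B s ω) + ∫ u in (s : ℝ)..t, α u) (m : ℕ) :
    |itoSum f B X s d m ω|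
      ≤ 1 / 2 * d * ((n + 1) * C) + C * ∫ u in (s : ℝ)..((s + d : ℝ≥0) : ℝ), ‖α u‖ := by
  rw [itoSum_eq hp]
  refine (abs_add_le _ _).trans (add_le_add ?_ ?_)
  · refine (Finset.abs_sum_le_sum_abs _ _).trans ?_
    calc ∑ j ∈ Finset.range (m + 1),
          |1 / 2 * ((d / (m + 1) : ℝ≥0) : ℝ) * Laplacian.laplacian f (X (grid s d m j) ω)|
        ≤ ∑ j ∈ Finset.range (m + 1), 1 / 2 * ((d / (m + 1) : ℝ≥0) : ℝ) * ((n + 1) * C) := by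
          refine Finset.sum_le_sum fun j _ => ?_
          rw [abs_mul, abs_of_nonneg (by positivity)]
          gcongr
          exact abs_laplacian_le hC₂ _
      _ = 1 / 2 * d * ((n + 1) * C) := by
          rw [Finset.sum_const, Finset.card_range, nsmul_eq_mul]
          push_cast
          field_simp
  · refine (Finset.abs_sum_le_sum_abs _ _).trans ?_
    refine le_trans ?_ (mul_le_mul_of_nonneg_left (sum_norm_integral_grid_le hα m) hC)
    rw [Finset.mul_sum]
    refine Finset.sum_le_sum fun j _ => ?_
    refine (ContinuousLinearMap.le_opNorm (fderiv ℝ f (X (grid s d m j) ω)) _).trans ?_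
    gcongr
    exact hC₁ _

lemma tendsto_itoSum (hf : ContDiff ℝ 2 f) {ω : Ω} {α : ℝ → Vec n}
    (hα : IntervalIntegrable α volume s ((s + d : ℝ≥0) : ℝ)) (hc : Continuous fun t => X t ω)
    (hp : ∀ s t : ℝ≥0, s ≤ t → X t ω = X s ω + (B t ω - B s ω) + ∫ u in (s : ℝ)..t, α u) :
    Tendsto (fun m => itoSum f B X s d m ω) atTop
      (𝓝 (∫ u in (s : ℝ)..((s + d : ℝ≥0) : ℝ), (1 / 2 * Laplacian.laplacian f (X u.toNNReal ω)
        + fderiv ℝ f (X u.toNNReal ω) (α u)))) := by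
  have hsd : (s : ℝ) ≤ ((s + d : ℝ≥0) : ℝ) := by simp
  have hc' : Continuous fun u : ℝ => X u.toNNReal ω := hc.comp continuous_real_toNNReal
  have hL : Continuous fun u : ℝ => 1 / 2 * Laplacian.laplacian f (X u.toNNReal ω) :=
    ((continuous_laplacian hf).comp hc').const_mul _
  have hD : Continuous fun u : ℝ => fderiv ℝ f (X u.toNNReal ω) :=
    (hf.continuous_fderiv two_ne_zero).comp hc'
  have hg : Continuous fun u : ℝ =>
      (1 / 2 * Laplacian.laplacian f (X u.toNNReal ω)) • ContinuousLinearMap.id ℝ ℝ :=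
    hL.smul continuous_const
  -- The Lebesgue part is the same kind of sum, with the constant velocity 1 as integrator.
  have h1 := tendsto_sum_grid (s := s) (d := d) (a := fun _ => (1 : ℝ))
    intervalIntegrable_const hg.continuousOn
  have h2 := tendsto_sum_grid hα hD.continuousOn
  have h3 := h1.add h2
  rw [intervalIntegral.integral_add (hL.intervalIntegrable _ _)
    (intervalIntegrable_clm_apply hsd hα hD.continuousOn)]
  simp only [_root_.smul_apply, ContinuousLinearMap.id_apply, smul_eq_mul, mul_one,
    Real.toNNReal_coe] at h3
  refine h3.congr fun m => ?_
  rw [itoSum_eq hp]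
  congr 1
  refine Finset.sum_congr rfl fun j _ => ?_
  rw [intervalIntegral.integral_const, grid_succ, smul_eq_mul, mul_one, NNReal.coe_add,
    add_sub_cancel_left]
  ring

lemma HasDrift.ae_intervalIntegrable (hX : HasDrift B 𝓕 P a X) :
    ∀ᵐ ω ∂P, ∀ s t : ℝ≥0, IntervalIntegrable (fun u => a u ω) volume s t := by
  filter_upwards [hX.integrable] with ω h s t
  exact (h s).symm.trans (h t)

lemma HasDrift.exists_bound (hX : HasDrift B 𝓕 P a X) (s d : ℝ≥0) :
    ∃ V : Ω → ℝ, Integrable V P ∧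
      ∀ᵐ ω ∂P, ∫ u in (s : ℝ)..((s + d : ℝ≥0) : ℝ), ‖a u ω‖ ≤ V ω := by
  obtain ⟨V, hV, h⟩ := hX.dominated (s + d)
  refine ⟨V, hV, ?_⟩
  filter_upwards [h, hX.ae_intervalIntegrable] with ω h hi
  refine le_trans ?_ h
  have hi0 : IntervalIntegrable (fun u => a u ω) volume 0 s := by simpa using hi 0 s
  rw [← intervalIntegral.integral_add_adjacent_intervals hi0.norm (hi s (s + d)).norm]
  refine le_add_of_nonneg_left ?_
  exact intervalIntegral.integral_nonneg s.2 fun _ _ => norm_nonneg _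

/-- The integral is almost surely the limit of the adapted sums `itoSum`; their limsup is an adapted
version of it. -/
lemma HasDrift.aestronglyMeasurable_integral (hB : IsBrownianVec B 𝓕 P)
    (hX : HasDrift B 𝓕 P a X) (hf : ContDiff ℝ 2 f) (s d : ℝ≥0) :
    AEStronglyMeasurable[𝓕 (s + d)] (fun ω => ∫ u in (s : ℝ)..((s + d : ℝ≥0) : ℝ),
      (1 / 2 * Laplacian.laplacian f (X u.toNNReal ω)
        + fderiv ℝ f (X u.toNNReal ω) (a u ω))) P := by
  have hm := measurable_itoSum (s := s) (d := d) hf hB.adapted hX.adapted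
  refine ⟨fun ω => limsup (fun m => itoSum f B X s d m ω) atTop,
    (Measurable.limsup hm).stronglyMeasurable, ?_⟩
  filter_upwards [hX.ae_intervalIntegrable, hX.cont, hX.eq] with ω hi hc hp
  exact (tendsto_itoSum hf (hi s (s + d)) hc hp).limsup_eq.symm

lemma HasDrift.integrable_integral [IsProbabilityMeasure P] (hB : IsBrownianVec B 𝓕 P)
    (hX : HasDrift B 𝓕 P a X) (hf : ContDiff ℝ 2 f) (hc : HasCompactSupport f) (s d : ℝ≥0) :
    Integrable (fun ω => ∫ u in (s : ℝ)..((s + d : ℝ≥0) : ℝ),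
      (1 / 2 * Laplacian.laplacian f (X u.toNNReal ω)
        + fderiv ℝ f (X u.toNNReal ω) (a u ω))) P := by
  obtain ⟨C, hC, -, hC₁, hC₂⟩ := exists_bound_derivatives hf hc
  obtain ⟨V, hV, hVb⟩ := hX.exists_bound s d
  refine ((integrable_const (1 / 2 * (d : ℝ) * ((n + 1) * C))).add (hV.const_mul C)).mono'
    ((hX.aestronglyMeasurable_integral hB hf s d).mono (𝓕.le _)) ?_
  filter_upwards [hX.ae_intervalIntegrable, hX.cont, hX.eq, hVb] with ω hi hc hp hv
  refine le_of_tendsto (tendsto_itoSum hf (hi s (s + d)) hc hp).norm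
    (Eventually.of_forall fun m => ?_)
  refine (abs_itoSum_le hC₁ hC₂ hC (hi s (s + d)) hp m).trans ?_
  simp only [Pi.add_apply]
  gcongr

end Dynkin

end

/-! ### Dynkin's formula and the martingale problem. -/

section

section Dynkin

variable {P : Measure Ω} {𝓕 : Filtration ℝ≥0 mΩ} {n : ℕ} {B X : ℝ≥0 → Ω → Vec n}
  {f : Vec n → ℝ} {a : ℝ → Ω → Vec n}

/-- The remainder of Itô's formula along a partition that is due to the Brownian motion. -/
def itoRem (f : Vec n → ℝ) (B X : ℝ≥0 → Ω → Vec n) (s d : ℝ≥0) (m : ℕ) (ω : Ω) : ℝ :=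
  ∑ j ∈ Finset.range (m + 1),
    (f (X (grid s d m j) ω + (B (grid s d m (j + 1)) ω - B (grid s d m j) ω))
      - f (X (grid s d m j) ω)
      - 1 / 2 * ((d / (m + 1) : ℝ≥0) : ℝ) * Laplacian.laplacian f (X (grid s d m j) ω))

lemma integrable_itoRem_term [IsProbabilityMeasure P] (hf : ContDiff ℝ 2 f)
    (hc : HasCompactSupport f) {Y Z : Ω → Vec n} (hY : Measurable Y) (hZ : Measurable Z) (c : ℝ) :
    Integrable (fun ω => f (Y ω + Z ω) - f (Y ω) - c * Laplacian.laplacian f (Y ω)) P := by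
  obtain ⟨C, hC, hC₀, hC₁, hC₂⟩ := exists_bound_derivatives hf hc
  have h (Y' : Ω → Vec n) (h' : Measurable Y') : Integrable (fun ω => f (Y' ω)) P :=
    Integrable.of_bound (hf.continuous.measurable.comp h').aestronglyMeasurable C
      (Eventually.of_forall fun ω => hC₀ _)
  refine ((h _ (hY.add hZ)).sub (h _ hY)).sub (Integrable.const_mul ?_ _)
  exact Integrable.of_bound ((continuous_laplacian hf).measurable.comp hY).aestronglyMeasurable
    ((n + 1) * C) (Eventually.of_forall fun ω => abs_laplacian_le hC₂ (Y ω))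

/-- A step of length h = d/(m + 1) costs at most ε(n + 1)h plus a multiple of h². Over m + 1 steps
this is ε(n + 1)d + K/(m + 1), and ε is arbitrary. -/
lemma tendsto_setIntegral_itoRem [IsProbabilityMeasure P] (hB : IsBrownianVec B 𝓕 P)
    (hX : ∀ t, Measurable[𝓕 t] (X t)) (hf : ContDiff ℝ 2 f) (hc : HasCompactSupport f)
    {s d : ℝ≥0} {F : Set Ω} (hF : MeasurableSet[𝓕 s] F) :
    Tendsto (fun m => ∫ ω in F, itoRem f B X s d m ω ∂P) atTop (𝓝 0) := by
  obtain ⟨C, hC, hC₀, hC₁, hC₂⟩ := exists_bound_derivatives hf hc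
  have hbound : ∀ ε > 0, ∃ K, ∀ m : ℕ, |∫ ω in F, itoRem f B X s d m ω ∂P|
      ≤ ε * ((n + 1) * d) + K / (m + 1) := by
    intro ε hε
    obtain ⟨D, hD, hT⟩ := exists_taylor_two_bound hf hc hε
    refine ⟨D * (n + 1) ^ 2 * fourthMoment * d ^ 2, fun m => ?_⟩
    simp only [itoRem]
    rw [integral_finsetSum _ fun j _ => (integrable_itoRem_term hf hc
      ((hX _).mono (𝓕.le _) le_rfl) (hB.measurable_increment _ _) _).integrableOn]
    refine (Finset.abs_sum_le_sum_abs _ _).trans ?_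
    calc _ ≤ ∑ j ∈ Finset.range (m + 1), (ε * (n + 1) * ((d / (m + 1) : ℝ≥0) : ℝ)
          + D * (n + 1) ^ 2 * fourthMoment * ((d / (m + 1) : ℝ≥0) : ℝ) ^ 2) := by
          refine Finset.sum_le_sum fun j _ => ?_
          rw [grid_succ]
          exact hB.abs_setIntegral_step_le hf hC₁ hC₂ hD hT (𝓕.mono (le_grid m j) F hF) (hX _)
      _ = _ := by
          rw [Finset.sum_const, Finset.card_range, nsmul_eq_mul]
          push_cast
          field_simp
  rw [Metric.tendsto_atTop]
  intro η hη
  obtain ⟨K, hK⟩ := hbound (η / (2 * ((n + 1) * d + 1))) (by positivity)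
  obtain ⟨m₀, hm₀⟩ := exists_nat_gt (2 * K / η)
  refine ⟨m₀, fun m hm => ?_⟩
  rw [dist_zero_right, Real.norm_eq_abs]
  refine (hK m).trans_lt ?_
  have h1 : η / (2 * ((n + 1) * d + 1)) * ((n + 1) * d) ≤ η / 2 := by
    rw [div_mul_eq_mul_div, div_le_div_iff₀ (by positivity) two_pos]
    nlinarith
  have h2 : K / (m + 1) < η / 2 := by
    rw [div_lt_div_iff₀ (by positivity) two_pos]
    rw [div_lt_iff₀ hη] at hm₀
    have : (m₀ : ℝ) ≤ m := by exact_mod_cast hm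
    nlinarith
  linarith

/-- Dynkin's formula. -/
lemma HasDrift.setIntegral_eq_zero [IsProbabilityMeasure P] (hB : IsBrownianVec B 𝓕 P)
    (hX : HasDrift B 𝓕 P a X) (hf : ContDiff ℝ 2 f) (hc : HasCompactSupport f) (s d : ℝ≥0)
    {F : Set Ω} (hF : MeasurableSet[𝓕 s] F) :
    ∫ ω in F, (f (X (s + d) ω) - f (X s ω) - ∫ u in (s : ℝ)..((s + d : ℝ≥0) : ℝ),
      (1 / 2 * Laplacian.laplacian f (X u.toNNReal ω)
        + fderiv ℝ f (X u.toNNReal ω) (a u ω))) ∂P = 0 := by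
  obtain ⟨C, hC, hC₀, hC₁, hC₂⟩ := exists_bound_derivatives hf hc
  obtain ⟨V, hV, hVb⟩ := hX.exists_bound s d
  have hXm : ∀ t, Measurable (X t) := fun t => (hX.adapted t).mono (𝓕.le _) le_rfl
  have hfX : ∀ t, Measurable fun ω => f (X t ω) := fun t => hf.continuous.measurable.comp (hXm t)
  set I : Ω → ℝ := fun ω => ∫ u in (s : ℝ)..((s + d : ℝ≥0) : ℝ),
    (1 / 2 * Laplacian.laplacian f (X u.toNNReal ω) + fderiv ℝ f (X u.toNNReal ω) (a u ω)) with hI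
  have hSm : ∀ m, Measurable (itoSum f B X s d m) := fun m =>
    (measurable_itoSum hf hB.adapted hX.adapted m).mono (𝓕.le _) le_rfl
  have hRi : ∀ m, Integrable (itoRem f B X s d m) P := fun m =>
    integrable_finsetSum _ fun j _ => integrable_itoRem_term hf hc (hXm _)
      (hB.measurable_increment _ _) _
  -- On each grid interval the drift is applied after the Brownian increment. Telescoping f(X) then
  -- splits into `itoRem` (Brownian, small in mean), `itoSum` (converging to the integral) and G
  -- (drift remainder, small pathwise).
  set G : ℕ → Ω → ℝ := fun m ω =>
    f (X (s + d) ω) - f (X s ω) - itoSum f B X s d m ω - itoRem f B X s d m ω with hG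
  have hfi : ∀ t, Integrable (fun ω => f (X t ω)) P := fun t =>
    Integrable.of_bound (hfX t).aestronglyMeasurable C (Eventually.of_forall fun ω => hC₀ _)
  have hSi : ∀ m, Integrable (itoSum f B X s d m) P := fun m => by
    refine ((integrable_const (1 / 2 * (d : ℝ) * ((n + 1) * C))).add (hV.const_mul C)).mono'
      (hSm m).aestronglyMeasurable ?_
    filter_upwards [hX.ae_intervalIntegrable, hX.eq, hVb] with ω hi hp hv
    refine (abs_itoSum_le hC₁ hC₂ hC (hi s (s + d)) hp m).trans ?_
    simp only [Pi.add_apply]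
    gcongr
  have hGi : ∀ m, Integrable (G m) P := fun m =>
    (((hfi _).sub (hfi _)).sub (hSi m)).sub (hRi m)
  -- the remainder due to the drift
  have hpath : ∀ᵐ ω ∂P, Tendsto (fun m => G m ω) atTop (𝓝 0) ∧ ∀ m, ‖G m ω‖ ≤ 2 * C * V ω := by
    filter_upwards [hX.ae_intervalIntegrable, hX.eq, hX.cont, hB.ae_continuous, hVb]
      with ω hi hp hXc hBc hv
    have hα := hi s (s + d)
    have hstep : ∀ m, ∀ j < m + 1, (fun u : ℝ => X u.toNNReal ω) (grid s d m (j + 1))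
        = (fun u : ℝ => X u.toNNReal ω) (grid s d m j)
          + ((fun u : ℝ => B u.toNNReal ω) (grid s d m (j + 1))
            - (fun u : ℝ => B u.toNNReal ω) (grid s d m j))
          + ∫ u in (grid s d m j : ℝ)..(grid s d m (j + 1)), a u ω := fun m j _ => by
      simp only [Real.toNNReal_coe]
      exact hp _ _ (grid_mono m j.le_succ)
    have hGe : ∀ m, G m ω = ∑ j ∈ Finset.range (m + 1), (f (X (grid s d m (j + 1)) ω)
        - f (X (grid s d m j) ω + (B (grid s d m (j + 1)) ω - B (grid s d m j) ω))
        - fderiv ℝ f (X (grid s d m j) ω)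
          (∫ u in (grid s d m j : ℝ)..(grid s d m (j + 1)), a u ω)) := fun m => by
      have htel := Finset.sum_range_sub (fun j => f (X (grid s d m j) ω)) (m + 1)
      simp only [grid_zero, grid_last] at htel
      simp only [hG]
      rw [itoSum_eq hp, ← htel, itoRem, sub_sub, ← Finset.sum_add_distrib,
        ← Finset.sum_add_distrib, ← Finset.sum_sub_distrib]
      exact Finset.sum_congr rfl fun j _ => by ring
    constructor
    · have := tendsto_sum_drift_remainder hf hC hC₂ hα
        (b := fun u : ℝ => B u.toNNReal ω) (p := fun u : ℝ => X u.toNNReal ω)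
        (hBc.comp continuous_real_toNNReal).continuousOn hstep
      simp only [Real.toNNReal_coe] at this
      exact this.congr fun m => (hGe m).symm
    · intro m
      have := abs_sum_drift_remainder_le hf hC₁ hα
        (b := fun u : ℝ => B u.toNNReal ω) (p := fun u : ℝ => X u.toNNReal ω) hstep m hC
      simp only [Real.toNNReal_coe] at this
      rw [Real.norm_eq_abs, hGe m]
      exact this.trans (by gcongr)
  have hlimG : Tendsto (fun m => ∫ ω in F, G m ω ∂P) atTop (𝓝 0) := by
    have := tendsto_integral_of_dominated_convergence (μ := P.restrict F) (F := G)
      (f := fun _ => 0) (fun ω => 2 * C * V ω) (fun m => (hGi m).aestronglyMeasurable.restrict)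
      (hV.const_mul _).integrableOn (fun m => ae_restrict_of_ae (hpath.mono fun ω h => h.2 m))
      (ae_restrict_of_ae (hpath.mono fun ω h => h.1))
    simpa using this
  have hlimS : Tendsto (fun m => ∫ ω in F, itoSum f B X s d m ω ∂P) atTop
      (𝓝 (∫ ω in F, I ω ∂P)) := by
    refine tendsto_integral_of_dominated_convergence (μ := P.restrict F)
      (fun ω => 1 / 2 * (d : ℝ) * ((n + 1) * C) + C * V ω)
      (fun m => (hSm m).aestronglyMeasurable)
      ((integrable_const _).add (hV.const_mul C)).integrableOn (fun m => ae_restrict_of_ae ?_)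
      (ae_restrict_of_ae ?_)
    · filter_upwards [hX.ae_intervalIntegrable, hX.eq, hVb] with ω hi hp hv
      exact (abs_itoSum_le hC₁ hC₂ hC (hi s (s + d)) hp m).trans (by gcongr)
    · filter_upwards [hX.ae_intervalIntegrable, hX.cont, hX.eq] with ω hi hc hp
      exact tendsto_itoSum hf (hi s (s + d)) hc hp
  have hlimR := tendsto_setIntegral_itoRem (d := d) hB hX.adapted hf hc hF
  have hsum : ∀ m, ∫ ω in F, (f (X (s + d) ω) - f (X s ω)) ∂P
      = (∫ ω in F, G m ω ∂P) + (∫ ω in F, itoSum f B X s d m ω ∂P)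
        + ∫ ω in F, itoRem f B X s d m ω ∂P := fun m => by
    have hGS : Integrable (fun ω => G m ω + itoSum f B X s d m ω) P := (hGi m).add (hSi m)
    rw [← integral_add (hGi m).integrableOn (hSi m).integrableOn,
      ← integral_add hGS.integrableOn (hRi m).integrableOn]
    refine integral_congr_ae (Eventually.of_forall fun ω => ?_)
    simp only [hG]
    ring
  have hlim := (hlimG.add hlimS).add hlimR
  rw [zero_add, add_zero] at hlim
  have heq := tendsto_nhds_unique (tendsto_const_nhds.congr hsum) hlim
  have hII := hX.integrable_integral hB hf hc s d
  have hff : Integrable (fun ω => f (X (s + d) ω) - f (X s ω)) P := (hfi _).sub (hfi _)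
  rw [integral_sub hff.integrableOn hII.integrableOn, heq, sub_self]

/-- The martingale problem for Brownian motion with drift. -/
lemma HasDrift.martingale [IsProbabilityMeasure P] (hB : IsBrownianVec B 𝓕 P)
    (hX : HasDrift B 𝓕 P a X) (hf : ContDiff ℝ 2 f) (hc : HasCompactSupport f)
    {M : ℝ≥0 → Ω → ℝ} (hM : ∀ t, M t =ᵐ[P] fun ω => f (X t ω) - ∫ u in (0 : ℝ)..t,
      (1 / 2 * Laplacian.laplacian f (X u.toNNReal ω) + fderiv ℝ f (X u.toNNReal ω) (a u ω))) :
    (∀ t, Integrable (M t) P) ∧ ∀ s t, s ≤ t → P[M t | 𝓕 s] =ᵐ[P] M s := by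
  obtain ⟨C, hC, hC₀, hC₁, hC₂⟩ := exists_bound_derivatives hf hc
  have hfi : ∀ t, Integrable (fun ω => f (X t ω)) P := fun t =>
    Integrable.of_bound (hf.continuous.measurable.comp
      ((hX.adapted t).mono (𝓕.le _) le_rfl)).aestronglyMeasurable C
      (Eventually.of_forall fun ω => hC₀ _)
  have hIi : ∀ t : ℝ≥0, Integrable (fun ω => ∫ u in (0 : ℝ)..t,
      (1 / 2 * Laplacian.laplacian f (X u.toNNReal ω)
        + fderiv ℝ f (X u.toNNReal ω) (a u ω))) P := fun t => by
    simpa using hX.integrable_integral hB hf hc 0 t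
  have hMi : ∀ t, Integrable (M t) P := fun t => ((hfi t).sub (hIi t)).congr (hM t).symm
  refine ⟨hMi, fun s t hst => (ae_eq_condExp_of_forall_setIntegral_eq (𝓕.le s) (hMi t)
    (fun F _ _ => (hMi s).integrableOn) (fun F hF _ => ?_) ?_).symm⟩
  · obtain ⟨d, rfl⟩ := exists_add_of_le hst
    have h0 := hX.setIntegral_eq_zero hB hf hc s d hF
    have h1 : ∫ ω in F, (M (s + d) ω - M s ω) ∂P = 0 := by
      rw [← h0]
      refine integral_congr_ae (ae_restrict_of_ae ?_)
      filter_upwards [hM s, hM (s + d), hX.ae_intervalIntegrable, hX.cont] with ω h1 h2 hi hXc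
      have hc' : Continuous fun u : ℝ => X u.toNNReal ω := hXc.comp continuous_real_toNNReal
      have hint : ∀ p q : ℝ≥0, p ≤ q → IntervalIntegrable (fun u =>
          1 / 2 * Laplacian.laplacian f (X u.toNNReal ω)
            + fderiv ℝ f (X u.toNNReal ω) (a u ω)) volume p q := fun p q hpq =>
        ((((continuous_laplacian hf).comp hc').const_mul (1 / 2)).intervalIntegrable _ _).add
          (intervalIntegrable_clm_apply (NNReal.coe_le_coe.2 hpq) (hi p q)
            ((hf.continuous_fderiv two_ne_zero).comp hc').continuousOn)
      have h3 := intervalIntegral.integral_add_adjacent_intervals (hint 0 s bot_le)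
        (hint s (s + d) le_self_add)
      rw [NNReal.coe_zero] at h3
      rw [h1, h2, ← h3]
      ring
    rw [integral_sub (hMi _).integrableOn (hMi _).integrableOn] at h1
    linarith
  · have h1 := hX.aestronglyMeasurable_integral hB hf 0 s
    rw [zero_add] at h1
    have h2 : AEStronglyMeasurable[𝓕 s] (fun ω => f (X s ω)) P :=
      (hf.continuous.measurable.comp (hX.adapted s)).stronglyMeasurable.aestronglyMeasurable
    exact (h2.sub h1).congr (hM s).symm

end Dynkin

end

/-! ### Bessel processes of type D as processes with drift. -/

section

section BesselD

variable {P : Measure Ω} {𝓕 : Filtration ℝ≥0 mΩ} {n : ℕ} {B X : ℝ≥0 → Ω → Vec n}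
  {k : ℝ} {y₀ : Vec n}

lemma measurable_driftD : Measurable (driftD : Vec n → Vec n) := by
  refine (WithLp.measurable_toLp 2 _).comp (measurable_pi_lambda _ fun i => ?_)
  refine Finset.measurable_fun_sum _ fun j _ => ?_
  have h : ∀ l, Measurable fun y : Vec n => y l := fun l =>
    (EuclideanSpace.proj (𝕜 := ℝ) l).measurable
  exact (((h i).sub (h j)).const_div 1).add (((h i).add (h j)).const_div 1)

/-- For an a.s. continuous process, integrals along the path are a.e. measurable. -/
lemma aemeasurable_lintegral_path (hX : ∀ t, Measurable (X t))
    (hc : ∀ᵐ ω ∂P, Continuous fun t => X t ω) {g : Vec n → ℝ≥0∞} (hg : Measurable g) (S : Set ℝ) :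
    AEMeasurable (fun ω => ∫⁻ s in S, g (X s.toNNReal ω)) P := by
  -- Paths are continuous only almost surely. Setting the process to 0 on a measurable null set
  -- makes all of them continuous, hence the process jointly measurable.
  obtain ⟨A, hAsub, hA, hA0⟩ := exists_measurable_superset_of_null (ae_iff.1 hc)
  set X' : ℝ≥0 → Ω → Vec n := fun t => Aᶜ.indicator (X t) with hX'
  have hcont : ∀ ω, Continuous fun t => X' t ω := fun ω => by
    by_cases hω : ω ∈ A
    · simp [hX', hω, continuous_const]
    · have h1 : Continuous fun t => X t ω := by
        by_contra h
        exact hω (hAsub h)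
      simpa [hX', hω] using h1
  have hmeas := measurable_uncurry_of_continuous_of_measurable hcont
    fun t => (hX t).indicator hA.compl
  have h2 : Measurable fun p : ℝ × Ω => g (X' p.1.toNNReal p.2) :=
    hg.comp (hmeas.comp ((measurable_real_toNNReal.comp measurable_fst).prodMk measurable_snd))
  refine ⟨_, h2.lintegral_prod_left' (μ := volume.restrict S), ?_⟩
  have h3 : ∀ᵐ ω ∂P, ω ∉ A := by
    rw [ae_iff]
    simpa using hA0
  filter_upwards [h3] with ω hω
  simp [hX', hω]

lemma IsBesselD.ae_continuous (h : IsBesselD k y₀ B 𝓕 P X) : ∀ᵐ ω ∂P, Continuous fun t => X t ω :=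
  h.path.mono fun _ hω => hω.cont

lemma IsBesselD.hasDrift (h : IsBesselD k y₀ B 𝓕 P X) :
    HasDrift B 𝓕 P (fun s ω => k • driftD (X s.toNNReal ω)) X where
  adapted := h.adapted
  cont := h.ae_continuous
  integrable := h.path.mono fun ω hω t => (hω.integrable t).smul k
  eq := by
    filter_upwards [h.path] with ω hω s t _
    have h1 := intervalIntegral.integral_interval_sub_left (hω.integrable t) (hω.integrable s)
    rw [hω.eq t, hω.eq s, intervalIntegral.integral_smul, ← h1, smul_sub]
    abel
  dominated := fun t => by
    have hm := aemeasurable_lintegral_path (fun t => (h.adapted t).mono (𝓕.le t) le_rfl)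
      h.ae_continuous (measurable_driftD (n := n)).enorm (Icc (0 : ℝ) t)
    refine ⟨_, (integrable_toReal_of_lintegral_ne_top hm (h.drift_lt_top t).ne).const_mul |k|, ?_⟩
    filter_upwards [h.path] with ω hω
    simp only [norm_smul, Real.norm_eq_abs]
    rw [intervalIntegral.integral_const_mul, intervalIntegral.integral_of_le t.coe_nonneg,
      ← integral_Icc_eq_integral_Ioc, integral_norm_eq_lintegral_enorm]
    exact ((intervalIntegrable_iff_integrableOn_Icc_of_le t.coe_nonneg).1
      (hω.integrable t)).aestronglyMeasurable

end BesselD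

/-! ### Reflection of the last coordinate, and folding. -/

section Reflection

variable {n : ℕ}

/-- The reflection that changes the sign of the last coordinate. -/
def reflLast (n : ℕ) : Vec n ≃ₗᵢ[ℝ] Vec n :=
  LinearIsometryEquiv.piLpCongrRight 2 fun i =>
    if i = Fin.last n then LinearIsometryEquiv.neg ℝ else LinearIsometryEquiv.refl ℝ ℝ

@[simp]
lemma reflLast_apply (y : Vec n) (i : Fin (n + 1)) :
    reflLast n y i = if i = Fin.last n then -y i else y i := by
  rw [reflLast, LinearIsometryEquiv.piLpCongrRight_apply]
  dsimp only
  split_ifs <;> rfl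

/-- This reduces every statement about the non-smooth folding of an invariant function to a linear
isometry. -/
lemma foldLast_eq_or (y : Vec n) : foldLast y = y ∨ foldLast y = reflLast n y := by
  rcases le_total 0 (y (Fin.last n)) with h | h
  · exact Or.inl (foldLast_eq_self h)
  · refine Or.inr (PiLp.ext fun i => ?_)
    simp only [foldLast, reflLast_apply]
    split_ifs with hi
    · subst hi
      exact abs_of_nonpos h
    · rfl

/-- Changing the sign of y_N exchanges the two terms 1/(y_i - y_N) and 1/(y_i + y_N) for i ≠ N, and
exchanges them with a minus sign in the last component. -/
lemma driftD_reflLast (y : Vec n) : driftD (reflLast n y) = reflLast n (driftD y) := by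
  refine PiLp.ext fun i => ?_
  rw [reflLast_apply, driftD_apply, driftD_apply]
  split_ifs with hi
  · rw [← Finset.sum_neg_distrib]
    refine Finset.sum_congr rfl fun j hj => ?_
    have hj : j ≠ Fin.last n := hi ▸ Finset.ne_of_mem_erase hj
    simp only [reflLast_apply, hi, if_true, if_neg hj]
    rw [show -y (Fin.last n) - y j = -(y (Fin.last n) + y j) by ring,
      show -y (Fin.last n) + y j = -(y (Fin.last n) - y j) by ring, one_div_neg_eq_neg_one_div,
      one_div_neg_eq_neg_one_div]
    ring
  · refine Finset.sum_congr rfl fun j hj => ?_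
    simp only [reflLast_apply, if_neg hi]
    split_ifs
    · rw [sub_neg_eq_add, ← sub_eq_add_neg, add_comm]
    · rfl

variable {f : Vec n → ℝ}

lemma IsInvariantB.comp_reflLast (hinv : IsInvariantB f) (y : Vec n) : f (reflLast n y) = f y := by
  rw [← hinv 1 (fun i => if i = Fin.last n then -1 else 1) y]
  congr 1
  refine PiLp.ext fun i => ?_
  rw [reflLast_apply]
  split_ifs with hi <;> simp [hi]

lemma IsInvariantB.comp_foldLast (hinv : IsInvariantB f) (y : Vec n) : f (foldLast y) = f y := by
  rcases foldLast_eq_or y with h | h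
  · rw [h]
  · rw [h, hinv.comp_reflLast]

lemma fderiv_comp_isometry_apply (R : Vec n ≃ₗᵢ[ℝ] Vec n) (hR : ∀ y, f (R y) = f y) (y v : Vec n) :
    fderiv ℝ f (R y) (R v) = fderiv ℝ f y v := by
  have h1 : f ∘ R.toContinuousLinearEquiv = f := funext hR
  have h2 := R.toContinuousLinearEquiv.comp_right_fderiv (f := f) (x := y)
  rw [h1] at h2
  rw [h2]
  rfl

lemma laplacian_comp_isometry (hf : ContDiff ℝ 2 f) (R : Vec n ≃ₗᵢ[ℝ] Vec n)
    (hR : ∀ y, f (R y) = f y) (y : Vec n) :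
    Laplacian.laplacian f (R y) = Laplacian.laplacian f y := by
  have h1 : f ∘ (R.toContinuousLinearEquiv : Vec n →L[ℝ] Vec n) = f := funext hR
  have h2 := ContinuousLinearMap.iteratedFDeriv_comp_right
    (R.toContinuousLinearEquiv : Vec n →L[ℝ] Vec n) hf y (i := 2) le_rfl
  rw [h1] at h2
  set b := EuclideanSpace.basisFun (Fin (n + 1)) ℝ
  -- The Laplacian may be computed in any orthonormal basis: at R y in the image basis, at y in the
  -- standard one, so that the sums agree term by term.
  rw [congrFun (InnerProductSpace.laplacian_eq_iteratedFDeriv_orthonormalBasis f (b.map R)) (R y),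
    congrFun (InnerProductSpace.laplacian_eq_iteratedFDeriv_orthonormalBasis f b) y]
  refine Finset.sum_congr rfl fun i _ => ?_
  rw [h2, ContinuousMultilinearMap.compContinuousLinearMap_apply]
  congr 1
  funext l
  fin_cases l <;> simp

lemma genB_zero_eq (k : ℝ) (y : Vec n) :
    genB 0 k f y = 1 / 2 * Laplacian.laplacian f y + fderiv ℝ f y (k • driftD y) := by
  rw [genB, zero_mul, add_zero, map_smul, smul_eq_mul, clm_apply_eq_sum]
  simp only [driftD_apply, mul_comm]

lemma genB_zero_foldLast (hf : ContDiff ℝ 2 f) (hinv : IsInvariantB f) (k : ℝ) (y : Vec n) :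
    genB 0 k f (foldLast y)
      = 1 / 2 * Laplacian.laplacian f y + fderiv ℝ f y (k • driftD y) := by
  rcases foldLast_eq_or y with h | h
  · rw [h, genB_zero_eq]
  · rw [h, genB_zero_eq, driftD_reflLast, ← map_smul, laplacian_comp_isometry hf _
      hinv.comp_reflLast, fderiv_comp_isometry_apply _ hinv.comp_reflLast]

end Reflection

section BesselB

variable {P : Measure Ω} {𝓕 : Filtration ℝ≥0 mΩ} {n : ℕ}
  {B X : ℝ≥0 → Ω → Vec n} {k : ℝ} {y₀ : Vec n}

lemma IsBrownianVec.ae_zero (hB : IsBrownianVec B 𝓕 P) : ∀ᵐ ω ∂P, B 0 ω = 0 := by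
  filter_upwards [ae_all_iff.2 fun i => (hB.coord i).eval_zero_ae_eq_zero] with ω hω
  exact PiLp.ext hω

/-- Folding the last coordinate of a Bessel process of type `D` gives one of type `B`. -/
theorem IsBesselD.isBesselB_foldLast [IsProbabilityMeasure P] (hB : IsBrownianVec B 𝓕 P)
    (hy₀ : y₀ (Fin.last n) = 0)
    (h : IsBesselD k y₀ B 𝓕 P X) : IsBesselB 0 k y₀ 𝓕 P fun t ω => foldLast (X t ω) where
  adapted t := continuous_foldLast.measurable.comp (h.adapted t)
  init := by
    filter_upwards [h.path, hB.ae_zero] with ω hω h0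
    have h1 : X 0 ω = y₀ := by simpa [h0] using hω.eq 0
    rw [h1]
    exact foldLast_eq_self hy₀.ge
  path := h.path.mono fun ω hω =>
    ⟨continuous_foldLast.comp hω.cont, fun t => foldLast_mem_chamberB (hω.mem t)⟩
  ae_regular := h.path.mono fun ω hω => hω.ae_mem.mono fun s hs =>
    ⟨fun i j hij => foldLast_apply_ne hs hij, fun h0 => (h0 rfl).elim⟩
  martingale f hf hc hinv := by
    -- For invariant f the process `martB` of the folded process equals, at every sample point, the
    -- Dynkin process of X itself.
    refine h.hasDrift.martingale hB hf hc fun t => Eventually.of_forall fun ω => ?_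
    simp only [martB, hinv.comp_foldLast, genB_zero_foldLast hf hinv]

end BesselB

end

end BesselLimit

end

open BesselLimit in
/-- The Bessel processes of type `B_N` with multiplicities `(0, k)` are realised on one probability
space, for all `k ≥ 1/2`, as `foldLast (X k t ω)` with the Bessel processes `X k` of type `D_N`
that are driven by one Brownian motion `B`, which also drives `W`. Each equation for `X k` holds
almost surely; as there are uncountably many `k`, the supremum over `k` at `ω` is taken over those
`k` for which the equation holds at `ω` (for each `k`, this is almost every `ω`; if the exceptional
null set is the same for all `k`, then these are all `k ≥ 1/2`). -/
theorem theorem5p3 {Ω : Type*} {mΩ : MeasurableSpace Ω} (P : Measure Ω) [IsProbabilityMeasure P]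
    (𝓕 : Filtration ℝ≥0 mΩ) (n : ℕ) (B : ℝ≥0 → Ω → Vec n) (hB : IsBrownianVec B 𝓕 P)
    (x : Vec n) (hx : ∀ i j, i < j → x j < x i) (hxN : x (Fin.last n) = 0)
    (φ : ℝ → Vec n) (hφ : IsFlowD x φ)
    (W : ℝ≥0 → Ω → Vec n) (hW : IsLimitW φ B P W)
    (X : ℝ → ℝ≥0 → Ω → Vec n)
    (hX : ∀ k : ℝ, 1 / 2 ≤ k → IsBesselD k (√k • x) B 𝓕 P (X k)) :
    (∀ k : ℝ, 1 / 2 ≤ k → IsBesselB 0 k (√k • x) 𝓕 P fun t ω => foldLast (X k t ω)) ∧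
    (∀ t : ℝ≥0, ∀ᵐ ω ∂P, BddAbove {r : ℝ | ∃ k : ℝ, 1 / 2 ≤ k ∧
      IsBesselDPath k (√k • x) (fun s => B s ω) (fun s => X k s ω) ∧
      ∃ s : ℝ≥0, s ≤ t ∧
        r = √k * ‖foldLast (X k s ω) - √k • φ s - foldLast (W s ω)‖}) ∧
    IsGaussianProcess W P ∧
    (∀ t : ℝ≥0, 0 < t →
      (∃ v : ℝ≥0, v ≠ 0 ∧
        HasLaw (fun ω => foldLast (W t ω) (Fin.last n)) (halfNormal v) P) ∧
      ¬ HasGaussianLaw (fun ω => foldLast (W t ω)) P) := by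
  refine ⟨fun k hk => (hX k hk).isBesselB_foldLast hB (by simp [hxN]), fun t => ?_,
    hW.isGaussianProcess hB hφ, fun t ht => ?_⟩
  -- The exceptional set involves only B and W, not k, so the bound K is chosen before k.
  · filter_upwards [hB.ae_continuous, hW] with ω hb hw
    obtain ⟨K, hK⟩ := bddAbove_of_path hφ hxN hb hw.1 hw.2 t
    refine ⟨K, ?_⟩
    rintro r ⟨k, hk, hp, s, hs, rfl⟩
    exact hK k hk _ hp s hs
  · obtain ⟨v, hv, hl⟩ := hW.exists_hasLaw_last hB hφ hxN ht
    refine ⟨⟨v, hv, ?_⟩, not_hasGaussianLaw_foldLast hv hl⟩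
    simp only [foldLast_last]
    exact hasLaw_abs_halfNormal hl
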